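/- Matroids may be infinite (in the sense of Bruhn, Diestel, Kriesell, Pendavingh and Wollan). Let $k$ be a field and $k^*=k\setminus\{0\}$. A *$k$-painting* of a matroid $M$ is a choice of a function $c_o\colon o\to k^*$ for each circuit $o$ of $M$ and a function $d_b\colon b\to k^*$ for each cocircuit $b$ of $M$ such that $\sum_{e\in o\cap b}c_o(e)d_b(e)=0$ for every circuit $o$ and cocircuit $b$; this includes the condition that only finitely many summands are nonzero. Two $k$-paintings $(c,d)$ and $(\tilde c,\tilde d)$ of $M$ are *equivalent* if there are constants $x(o),x(b),x(e)\in k^*$ for the circuits $o$, the cocircuits $b$ and the edges $e$ of $M$, and an automorphism $\varphi$ of $k$, such that $\tilde c_o(e)=\varphi\bigl(x(o)x(e)c_o(e)\bigr)$ whenever $e\in o$ and $\tilde d_b(e)=\varphi\bigl(x(b)d_b(e)/x(e)\bigr)$ whenever $e\in b$. A *signing* of $M$ is a choice of functions $c_o\colon o\to\{1,-1\}$ and $d_b\colon b\to\{1,-1\}$ satisfying the same condition with the sums evaluated in $\mathbb Z$; two signings are *equivalent* if the $\mathbb F_3$-paintings which they induce by reduction modulo $3$ are equivalent. **Theorem 5.5.**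 Any two $\mathbb F_3$-paintings of the same matroid are equivalent. Consequently, any two signings of the same matroid are equivalent. Moreover, let $G$ be a graph (loops and parallel edges allowed) and let $M$ be a matroid on the edge set of $G$ which is the finite, the algebraic or the topological cycle matroid of $G$, that is, whose circuits are exactly - the edge sets of the finite cycles of $G$, or - the edge sets of the finite cycles and of the double rays of $G$, or - the edge sets of the topological circles (homeomorphic images of the unit circle) in the space obtained from $G$ by adding its ends and identifying vertices and ends that are not separated by finitely many edges, where a basic neighbourhood of a vertex or end is given by a component of $G-F$ for a finite set $F$ of edges together with short end segments of edges of $F$ (for a connected locally finite graph this is the Freudenthal compactification), respectively. Then $M$ and its dual each have a signing, and it is unique up to equivalence. -/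

import Mathlib

namespace Matroid

/-- A painting of the (possibly infinite) matroid `M` with values in the units of `R`: a function
`c o : o → Rˣ` for each circuit `o` and a function `d b : b → Rˣ` for each cocircuit `b` such that
`∑ e ∈ o ∩ b, c o e * d b e = 0` for all `o` and `b`. That a sum equals zero includes that it is
well defined, that is, that only finitely many of its summands are nonzero.
When `R = k` is a field this is a `k`-painting; when `R = ℤ` (so that `Rˣ = {1, -1}`) this is a
signing. -/
structure Painting (R : Type*) [CommRing R] {E : Type*} (M : Matroid E) where
  /-- the function on each circuit -/
  c : ∀ o : {o : Set E // M.IsCircuit o}, o.1 → Rˣ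
  /-- the function on each cocircuit -/
  d : ∀ b : {b : Set E // M.IsCocircuit b}, b.1 → Rˣ
  finite_support : ∀ (o : {o : Set E // M.IsCircuit o}) (b : {b : Set E // M.IsCocircuit b}),
    (Function.support fun e : ↥(o.1 ∩ b.1) ↦
    (c o ⟨e, e.2.1⟩ : R) * (d b ⟨e, e.2.2⟩ : R)).Finite
  sum_eq_zero : ∀ (o : {o : Set E // M.IsCircuit o}) (b : {b : Set E // M.IsCocircuit b}),
    ∑ᶠ e : ↥(o.1 ∩ b.1), (c o ⟨e, e.2.1⟩ : R) * (d b ⟨e, e.2.2⟩ : R) = 0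

/-- A signing: functions with values in `{1, -1} = ℤˣ`, with sums evaluated in `ℤ`. -/
abbrev Signing {E : Type*} (M : Matroid E) := Painting ℤ M

namespace Painting

/-- Two paintings over a field `k` are equivalent if they differ by nonzero scalars `x(o)`, `x(b)`,
`x(e)` for the circuits, cocircuits and edges, and by an automorphism `φ` of `k`. (The values of
`xe` outside the ground set of `M` play no role.) -/
def Equivalent {k : Type*} [Field k] {E : Type*} {M : Matroid E} (P Q : Painting k M) : Prop :=
  ∃ (xo : {o : Set E // M.IsCircuit o} → kˣ) (xb : {b : Set E // M.IsCocircuit b} → kˣ)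
    (xe : E → kˣ) (φ : k ≃+* k),
    (∀ o (e : o.1), (Q.c o e : k) = φ ((xo o : k) * (xe e : k) * (P.c o e : k))) ∧
    (∀ b (e : b.1), (Q.d b e : k) = φ ((xb b : k) * (P.d b e : k) / (xe e : k)))

/-- The painting induced along a ring homomorphism. -/
def map {R S : Type*} [CommRing R] [CommRing S] (f : R →+* S) {E : Type*} {M : Matroid E}
    (P : Painting R M) : Painting S M where
  c o e := Units.map f (P.c o e)
  d b e := Units.map f (P.d b e)
  finite_support o b := by
    refine (P.finite_support o b).subset fun e he h0 ↦ he ?_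
    have := congrArg f h0
    simpa using this
  sum_eq_zero o b := by
    have := congrArg f (P.sum_eq_zero o b)
    rw [map_zero] at this
    have h := AddMonoidHom.map_finsum f.toAddMonoidHom (P.finite_support o b)
    simpa [← this] using h.symm

end Painting

/-- Two signings are equivalent if the `𝔽₃`-paintings which they induce (by reduction modulo 3) are
equivalent. -/
def Signing.Equivalent {E : Type*} {M : Matroid E} (P Q : Signing M) : Prop :=
  Painting.Equivalent (Painting.map (Int.castRingHom (ZMod 3)) P)
    (Painting.map (Int.castRingHom (ZMod 3)) Q)

/-- `M` has a signing, and this signing is unique up to equivalence. -/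
def HasUniqueSigning {E : Type*} (M : Matroid E) : Prop :=
  Nonempty (Signing M) ∧ ∀ P Q : Signing M, Signing.Equivalent P Q

end Matroid

namespace Graph

/-- `C` is the edge set of a finite cycle of the multigraph `G` (a loop is a cycle of length 1, and
two parallel edges form a cycle of length 2). -/
def IsFiniteCycle {V E : Type*} (G : Graph V E) (C : Set E) : Prop :=
  ∃ n : ℕ, n ≠ 0 ∧ ∃ (v : ZMod n → V) (e : ZMod n → E), Function.Injective v ∧
    Function.Injective e ∧ (∀ i, G.IsLink (e i) (v i) (v (i + 1))) ∧ C = Set.range e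

/-- `C` is the edge set of a double ray (two-way infinite path) of `G`. -/
def IsDoubleRay {V E : Type*} (G : Graph V E) (C : Set E) : Prop :=
  ∃ (v : ℤ → V) (e : ℤ → E), Function.Injective v ∧
    (∀ i, G.IsLink (e i) (v i) (v (i + 1))) ∧ C = Set.range e

/-- The vertex set of the component of `G - F` that contains the vertex `v`. -/
def componentAvoiding {V E : Type*} (G : Graph V E) (F : Finset E) (v : V) : Set V :=
  {w | Relation.ReflTransGen (G.deleteEdges (F : Set E)).Adj v w}

/-- A direction of `G` with respect to finite edge sets: a consistent choice of a component of
`G - F` for every finite set `F` of edges. Every vertex, and every end, gives a direction (the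
components of `G - F` in which it lies); two of these give the same direction precisely if no finite
set of edges separates them. -/
structure EdgeDirection {V E : Type*} (G : Graph V E) where
  /-- the vertex set of the chosen component of `G - F` -/
  comp : Finset E → Set V
  exists_eq_comp : ∀ F, ∃ v ∈ G.vertexSet, comp F = G.componentAvoiding F v
  anti : ∀ F F', F ⊆ F' → comp F' ⊆ comp F

/-- The points of the space obtained from the topological realisation of `G` by adding its ends and
identifying vertices and ends which are not separated by finitely many edges: the directions, and
the inner points `(e, t)`, with `0 < t < 1`, of the edges `e`. For a locally finite connected graph
this is the Freudenthal compactification. -/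
inductive EndSpace {V E : Type*} (G : Graph V E)
  | dir (d : G.EdgeDirection) : EndSpace G
  | inner (e : G.edgeSet) (t : Set.Ioo (0 : ℝ) 1) : EndSpace G

/-- The end of the edge `e` which the inner points `(e, t)` approach as `t → 0`. -/
noncomputable def src {V E : Type*} (G : Graph V E) (e : G.edgeSet) : V :=
  (G.exists_isLink_of_mem_edgeSet e.2).choose

/-- The end of the edge `e` which the inner points `(e, t)` approach as `t → 1`. -/
noncomputable def tgt {V E : Type*} (G : Graph V E) (e : G.edgeSet) : V :=
  (G.exists_isLink_of_mem_edgeSet e.2).choose_spec.choose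

namespace EndSpace

/-- For a component `K` of `G - F`: the directions which lie in `K`, the inner points of the edges
of `K`, and the open end segments of length `ε` at `K` of the edges in `F`. -/
def basicNhd {V E : Type*} {G : Graph V E} (F : Finset E) (K : Set V) (ε : ℝ) : Set (EndSpace G) :=
  {p | match p with
    | dir d => d.comp F = K
    | inner e t => (G.src e ∈ K ∧ ((e : E) ∈ F → (t : ℝ) < ε)) ∨
        (G.tgt e ∈ K ∧ ((e : E) ∈ F → 1 - ε < (t : ℝ)))}

/-- The topology in which inner points of edges have the usual neighbourhoods, and in which the sets
`basicNhd F (d.comp F) ε` are the basic neighbourhoods of a direction `d`. -/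
instance {V E : Type*} (G : Graph V E) : TopologicalSpace (EndSpace G) :=
  TopologicalSpace.generateFrom
    ({U | ∃ (d : G.EdgeDirection) (F : Finset E) (ε : ℝ), 0 < ε ∧ U = basicNhd F (d.comp F) ε} ∪
      {U | ∃ (e : G.edgeSet) (I : Set (Set.Ioo (0 : ℝ) 1)), IsOpen I ∧ U = inner e '' I})

end EndSpace

/-- `C` is the edge set of a topological circle (a homeomorphic image of the unit circle). -/
def IsTopologicalCycle {V E : Type*} (G : Graph V E) (C : Set E) : Prop :=
  ∃ f : Circle → EndSpace G, Topology.IsEmbedding f ∧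
    C = {e | ∃ he : e ∈ G.edgeSet, ∀ t, EndSpace.inner ⟨e, he⟩ t ∈ Set.range f}

end Graph

namespace Matroid

/-- `M` is the finite cycle matroid of `G`. -/
def IsFiniteCycleMatroid {V E : Type*} (M : Matroid E) (G : Graph V E) : Prop :=
  M.E = G.edgeSet ∧ ∀ C, M.IsCircuit C ↔ G.IsFiniteCycle C

/-- `M` is the algebraic cycle matroid of `G`. -/
def IsAlgebraicCycleMatroid {V E : Type*} (M : Matroid E) (G : Graph V E) : Prop :=
  M.E = G.edgeSet ∧ ∀ C, M.IsCircuit C ↔ G.IsFiniteCycle C ∨ G.IsDoubleRay C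

/-- `M` is the topological cycle matroid of `G`. -/
def IsTopologicalCycleMatroid {V E : Type*} (M : Matroid E) (G : Graph V E) : Prop :=
  M.E = G.edgeSet ∧ ∀ C, M.IsCircuit C ↔ G.IsTopologicalCycle C

end Matroid

/-! Uniqueness. Every unit of F₃ is its own inverse, so it suffices to find signs x(e) such that, on
every circuit, the product of the two paintings agrees with x up to one constant. A vanishing sum in
F₃ with two nonzero terms has opposite terms, one with three nonzero terms has equal terms. Hence a
circuit and a cocircuit with at most three common edges force the same relation on both paintings.

For a finite matroid, fix a base and build x by adding fundamental cocircuits one at a time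
(`exists_scalar_fundCocircuit`). Adding the cocircuit of z can only fail if two neighbours of z in
the same component of the fundamental graph built so far make conflicting demands. Along a shortest
path between such neighbours there is a circuit whose common edges with the cocircuits involved are
so few that the demands agree (`mul_eq_mul_of_inducedPath`). Linear algebra carries x from
fundamental cocircuits to all circuits (`exists_scalar_of_finite`). An infinite matroid is handled
by finite minors which retain finitely many circuits on finitely many edges (`exists_scalar_local`),
followed by compactness of {1,-1}^E (`exists_scalar`).

Existence. Circuits are oriented by traversal and cocircuits are cuts, oriented from one side to the
other; the sum over a circuit then telescopes. By `nonempty_signing_of_balanced` it is enough to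
find a family of vertex sets K for which every circuit is balanced and such that every cocircuit b
contains a nonempty cut of some K. The dual is signed by exchanging the two roles.

For finite cycles all K are allowed, and the component of an end of an edge of b in the complement
of b serves.

For topological circles the K with finite cut are used. If all finite cuts through an edge e of b
met the complement of b, a minimal set S in this complement that meets them all would be linearly
ordered by finite cuts, be countable, and form with e a topological circle which meets b in e only.
The converse fact, that a circle never meets a finite cut in one edge, comes from connectedness of a
circle minus a point.

For the algebraic cycle matroid the K with finitely many vertices on every double ray are used. One
end of e starts no ray outside b, since two such rays would give a double ray which meets b in e
only. If its component had infinitely many vertices on a double ray, a star-comb argument would give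
an infinite fan to this double ray, and then closure could not be transitive
(`false_of_fan_not_bddAbove`). -/

namespace Matroid

/-! ### Orthogonality over F₃ and induced paths in the fundamental graph -/

variable {E : Type*}

/-- The painting condition, for total functions which vanish outside circuits and cocircuits. -/
structure IsPaintingFun {R : Type*} [CommRing R] (M : Matroid E) (c d : Set E → E → R) :
    Prop where
  circuit_ne_zero : ∀ o, M.IsCircuit o → ∀ e, c o e ≠ 0 ↔ e ∈ o
  cocircuit_ne_zero : ∀ b, M.IsCocircuit b → ∀ e, d b e ≠ 0 ↔ e ∈ b
  finite_inter : ∀ o b, M.IsCircuit o → M.IsCocircuit b → (o ∩ b).Finite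
  finsum_eq_zero : ∀ o b, M.IsCircuit o → M.IsCocircuit b → ∑ᶠ e, c o e * d b e = 0

namespace IsPaintingFun

variable {M : Matroid E} {c d c' d' : Set E → E → ZMod 3} {o b : Set E}

lemma circuit_eq_zero {R : Type*} [CommRing R] {c d : Set E → E → R}
    (h : M.IsPaintingFun c d) (ho : M.IsCircuit o) {e : E} (he : e ∉ o) :
    c o e = 0 := by
  by_contra h0
  exact he ((h.circuit_ne_zero o ho e).1 h0)

lemma cocircuit_eq_zero {R : Type*} [CommRing R] {c d : Set E → E → R}
    (h : M.IsPaintingFun c d) (hb : M.IsCocircuit b) {e : E} (he : e ∉ b) :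
    d b e = 0 := by
  by_contra h0
  exact he ((h.cocircuit_ne_zero b hb e).1 h0)

lemma sum_eq_zero {R : Type*} [CommRing R] {c d : Set E → E → R}
    (h : M.IsPaintingFun c d) (ho : M.IsCircuit o) (hb : M.IsCocircuit b)
    (s : Finset E) (hs : o ∩ b ⊆ s) : ∑ e ∈ s, c o e * d b e = 0 := by
  rw [← h.finsum_eq_zero o b ho hb]
  symm
  apply finsum_eq_sum_of_support_subset
  intro e he
  apply hs
  by_contra hn
  rw [Set.mem_inter_iff, not_and_or] at hn
  rcases hn with hn | hn
  · exact he (by simp [h.circuit_eq_zero ho hn])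
  · exact he (by simp [h.cocircuit_eq_zero hb hn])

lemma add_eq_zero {R : Type*} [CommRing R] {c d : Set E → E → R}
    (h : M.IsPaintingFun c d) (ho : M.IsCircuit o) (hb : M.IsCocircuit b) {e f : E}
    (hef : e ≠ f) (hs : o ∩ b ⊆ {e, f}) : c o e * d b e + c o f * d b f = 0 := by
  classical
  have := h.sum_eq_zero ho hb {e, f} (by simpa using hs)
  rwa [Finset.sum_pair hef] at this

lemma add_add_eq_zero {R : Type*} [CommRing R] {c d : Set E → E → R}
    (h : M.IsPaintingFun c d) (ho : M.IsCircuit o) (hb : M.IsCocircuit b) {e f g : E}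
    (hef : e ≠ f) (heg : e ≠ g) (hfg : f ≠ g) (hs : o ∩ b ⊆ {e, f, g}) :
    c o e * d b e + (c o f * d b f + c o g * d b g) = 0 := by
  classical
  have := h.sum_eq_zero ho hb {e, f, g} (by simpa using hs)
  rwa [Finset.sum_insert (by simp [hef, heg]), Finset.sum_pair hfg] at this

end IsPaintingFun

lemma zmod_three_eq_or {a : ZMod 3} (h : a ≠ 0) : a = 1 ∨ a = 2 := by
  revert a; decide

/-- This and the three-term version below are where the field has to be F₃: the relation between the
products of values on the circuit and on the cocircuit depends only on the number of nonzero terms,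
not on the painting. -/
lemma zmod_three_mul_of_add {a b a' b' : ZMod 3} (h : a * b + a' * b' = 0) (ha : a ≠ 0)
    (hb : b ≠ 0) (ha' : a' ≠ 0) (hb' : b' ≠ 0) : a * a' = -(b * b') := by
  revert h
  rcases zmod_three_eq_or ha with rfl | rfl <;> rcases zmod_three_eq_or hb with rfl | rfl <;>
    rcases zmod_three_eq_or ha' with rfl | rfl <;> rcases zmod_three_eq_or hb' with rfl | rfl <;>
    decide

lemma zmod_three_mul_of_add_add {t a b a' b' : ZMod 3} (h : t + (a * b + a' * b') = 0) (ht : t ≠ 0)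
    (ha : a ≠ 0) (hb : b ≠ 0) (ha' : a' ≠ 0) (hb' : b' ≠ 0) : a * a' = b * b' := by
  revert h
  rcases zmod_three_eq_or ht with rfl | rfl <;> rcases zmod_three_eq_or ha with rfl | rfl <;>
    rcases zmod_three_eq_or hb with rfl | rfl <;> rcases zmod_three_eq_or ha' with rfl | rfl <;>
    rcases zmod_three_eq_or hb' with rfl | rfl <;> decide

lemma zmod_three_mul_self {a : ZMod 3} (h : a ≠ 0) : a * a = 1 := by
  revert a; decide

/-- A base B₁ containing this set would gain at least m + 1 elements over B and lose at most m, but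
|B₁ ∖ B| = |B ∖ B₁| for any two bases. -/
lemma dep_insert_union_sdiff {M : Matroid E} {B : Set E} (hB : M.IsBase B) {z : E} (hz : z ∈ B)
    {m : ℕ} {p q : ℕ → E} (hp : ∀ j ≤ m, p j ∈ M.E \ B) (hpinj : Set.InjOn p (Set.Iic m)) :
    M.Dep (insert z (p '' Set.Iic m ∪ (B \ q '' Set.Iio m))) := by
  have hY : insert z (p '' Set.Iic m ∪ (B \ q '' Set.Iio m)) ⊆ M.E := by
    rintro g (rfl | ⟨j, hj, rfl⟩ | hg)
    · exact hB.subset_ground hz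
    · exact (hp j hj).1
    · exact hB.subset_ground hg.1
  rw [← not_indep_iff hY]
  intro hI
  obtain ⟨B₁, hB₁, hYB⟩ := hI.exists_isBase_superset
  have h1 : p '' Set.Iic m ⊆ B₁ \ B := by
    rintro _ ⟨j, hj, rfl⟩
    exact ⟨hYB (Or.inr (Or.inl ⟨j, hj, rfl⟩)), (hp j hj).2⟩
  have h2 : B \ B₁ ⊆ q '' Set.Iio m := by
    intro g hg
    by_contra hn
    exact hg.2 (hYB (Or.inr (Or.inr ⟨hg.1, hn⟩)))
  have h3 := Set.encard_le_encard h1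
  have h4 := (Set.encard_le_encard h2).trans (Set.encard_image_le _ _)
  rw [hpinj.encard_image] at h3
  rw [hB₁.encard_sdiff_comm hB] at h3
  have h5 := h3.trans h4
  have e1 : (Set.Iic m).encard = (m + 1 : ℕ) := by
    rw [← Finset.coe_Iic, Set.encard_coe_eq_coe_finsetCard, Nat.card_Iic]
  have e2 : (Set.Iio m).encard = (m : ℕ) := by
    rw [← Finset.coe_Iio, Set.encard_coe_eq_coe_finsetCard, Nat.card_Iio]
  rw [e1, e2] at h5
  have := Nat.cast_le.1 h5
  omega

namespace IsPaintingFun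

variable {M : Matroid E} {c d c' d' : Set E → E → ZMod 3} {o b : Set E}

/-- The comparison of two paintings along an induced path in the fundamental graph of a base. -/
lemma mul_eq_mul_of_inducedPath (hP : M.IsPaintingFun c d) (hQ : M.IsPaintingFun c' d')
    {B : Set E} (hB : M.IsBase B) {z : E} (hz : z ∈ B) {m : ℕ} (hm : m ≠ 0) {p q : ℕ → E}
    (hp : ∀ j ≤ m, p j ∈ M.E \ B) (hpinj : Set.InjOn p (Set.Iic m))
    (hq : ∀ j < m, q j ∈ B) (hqz : ∀ j < m, q j ≠ z)
    (hadj : ∀ j < m, p j ∈ M.fundCocircuit (q j) B)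
    (hadj' : ∀ j < m, p (j + 1) ∈ M.fundCocircuit (q j) B)
    (hind : ∀ j < m, ∀ i ≤ m, p i ∈ M.fundCocircuit (q j) B → i = j ∨ i = j + 1)
    (h0 : p 0 ∈ M.fundCocircuit z B) (hl : p m ∈ M.fundCocircuit z B)
    (hzind : ∀ i ≤ m, p i ∈ M.fundCocircuit z B → i = 0 ∨ i = m)
    (D : E → Set E) (hD : D = fun f ↦ M.fundCocircuit f B)
    (r : E → E → ZMod 3)
    (hr : r = fun e f ↦ d (D f) e * d (D f) f * (d' (D f) e * d' (D f) f))
    (x : E → ZMod 3) (hx0 : ∀ e, x e ≠ 0)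
    (hx : ∀ j < m, r (p j) (q j) = x (p j) * x (q j))
    (hx' : ∀ j < m, r (p (j + 1)) (q j) = x (p (j + 1)) * x (q j)) :
    r (p 0) z * x (p 0) = r (p m) z * x (p m) := by
  -- Since the path is induced, this circuit meets the cocircuit of each q j at most in p j and p (j
  -- + 1), and that of z at most in z, p 0 and p m.
  obtain ⟨o, hoY, ho⟩ := (dep_insert_union_sdiff (q := q) hB hz hp hpinj).exists_isCircuit_subset
  have hDco : ∀ f ∈ B, M.IsCocircuit (D f) := fun f hf ↦ by
    rw [hD]; exact fundCocircuit_isCocircuit hf hB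
  have hself : ∀ f, f ∈ D f := fun f ↦ by rw [hD]; exact mem_fundCocircuit _ _ _
  have hDsub : ∀ f, D f ⊆ insert f (M.E \ B) := fun f ↦ by
    rw [hD]; exact fundCocircuit_subset_insert_compl _ _ _
  have hDo : ∀ j < m, o ∩ D (q j) ⊆ {p j, p (j + 1)} := by
    rintro j hj g ⟨hgo, hgD⟩
    have hgB : g ∉ B := by
      intro hgB
      rcases hDsub _ hgD with rfl | h
      · rcases hoY hgo with h | ⟨i, hi, h⟩ | h
        · exact hqz j hj h
        · exact (hp i hi).2 (h ▸ hgB)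
        · exact h.2 ⟨j, hj, rfl⟩
      · exact h.2 hgB
    rcases hoY hgo with rfl | ⟨i, hi, rfl⟩ | h
    · exact absurd hz hgB
    · rw [hD] at hgD
      rcases hind j hj i hi hgD with rfl | rfl <;> simp
    · exact absurd h.1 hgB
  have hDz : o ∩ D z ⊆ {z, p 0, p m} := by
    rintro g ⟨hgo, hgD⟩
    rcases hDsub _ hgD with rfl | h
    · simp
    · rcases hoY hgo with rfl | ⟨i, hi, rfl⟩ | h'
      · simp
      · rw [hD] at hgD
        rcases hzind i hi hgD with rfl | rfl <;> simp
      · exact absurd h'.1 h.2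
  have hpne : ∀ i ≤ m, ∀ j ≤ m, i ≠ j → p i ≠ p j := fun i hi j hj hij h ↦ hij (hpinj hi hj h)
  have key : ∀ {c d : Set E → E → ZMod 3}, M.IsPaintingFun c d → ∀ j < m,
      c o (p j) * d (D (q j)) (p j) + c o (p (j + 1)) * d (D (q j)) (p (j + 1)) = 0 := by
    intro c d h j hj
    exact h.add_eq_zero ho (hDco _ (hq j hj)) (hpne _ hj.le _ hj (by simp)) (hDo j hj)
  have hdne : ∀ {c d : Set E → E → ZMod 3}, M.IsPaintingFun c d → ∀ f ∈ B, ∀ e ∈ D f,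
      d (D f) e ≠ 0 := fun h f hf e he ↦ (h.cocircuit_ne_zero _ (hDco f hf) e).2 he
  -- Two-term orthogonality puts both or none of p j, p (j + 1) into o. As o is not contained in B,
  -- it contains some p j and hence all of them.
  have hstep : ∀ j < m, (p j ∈ o ↔ p (j + 1) ∈ o) := by
    intro j hj
    have h1 := key hP j hj
    have n1 := hdne hP _ (hq j hj) (p j) (by rw [hD]; exact hadj j hj)
    have n2 := hdne hP _ (hq j hj) (p (j + 1)) (by rw [hD]; exact hadj' j hj)
    rw [← hP.circuit_ne_zero o ho, ← hP.circuit_ne_zero o ho, not_iff_not]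
    constructor
    · intro h; rw [h] at h1; simpa [n2] using h1
    · intro h; rw [h] at h1; simpa [n1] using h1
  have hall0 : ∀ j ≤ m, (p 0 ∈ o ↔ p j ∈ o) := by
    intro j
    induction j with
    | zero => simp
    | succ j ih => intro hj; rw [ih (by omega), hstep j (by omega)]
  have hex : ∃ j ≤ m, p j ∈ o := by
    by_contra! hno
    apply ho.not_indep
    apply hB.indep.subset
    intro g hg
    rcases hoY hg with rfl | ⟨i, hi, rfl⟩ | h'
    · exact hz
    · exact absurd hg (hno i hi)
    · exact h'.1
  obtain ⟨j₀, hj₀, hj₀o⟩ := hex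
  have hall : ∀ j ≤ m, p j ∈ o := fun j hj ↦ (hall0 j hj).1 ((hall0 j₀ hj₀).2 hj₀o)
  have hcne : ∀ {c d : Set E → E → ZMod 3}, M.IsPaintingFun c d → ∀ j ≤ m, c o (p j) ≠ 0 :=
    fun h j hj ↦ (h.circuit_ne_zero o ho _).2 (hall j hj)
  -- Comparing the two-term relations at the cocircuit of q j for both paintings turns circuit
  -- values into r (p j) (q j) * r (p (j + 1)) (q j); the contributions of q j itself are squares.
  have hy : ∀ j < m, c o (p j) * c o (p (j + 1)) * (c' o (p j) * c' o (p (j + 1))) =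
      x (p j) * x (p (j + 1)) := by
    intro j hj
    have eP := zmod_three_mul_of_add (key hP j hj) (hcne hP j hj.le)
      (hdne hP _ (hq j hj) (p j) (by rw [hD]; exact hadj j hj)) (hcne hP _ hj)
      (hdne hP _ (hq j hj) (p (j + 1)) (by rw [hD]; exact hadj' j hj))
    have eQ := zmod_three_mul_of_add (key hQ j hj) (hcne hQ j hj.le)
      (hdne hQ _ (hq j hj) (p j) (by rw [hD]; exact hadj j hj)) (hcne hQ _ hj)
      (hdne hQ _ (hq j hj) (p (j + 1)) (by rw [hD]; exact hadj' j hj))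
    have sP := zmod_three_mul_self (hdne hP _ (hq j hj) _ (hself _))
    have sQ := zmod_three_mul_self (hdne hQ _ (hq j hj) _ (hself _))
    have sx := zmod_three_mul_self (hx0 (q j))
    have h1 := hx j hj
    have h2 := hx' j hj
    simp only [hr] at h1 h2
    have h3 := congrArg₂ (· * ·) h1 h2
    rw [eP, eQ]
    linear_combination h3 + (x (p j) * x (p (j + 1))) * sx
      - (d (D (q j)) (p j) * d' (D (q j)) (p j) * d (D (q j)) (p (j + 1)) *
        d' (D (q j)) (p (j + 1))) * (d' (D (q j)) (q j) * d' (D (q j)) (q j) * sP + sQ)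
  have hY : ∀ j ≤ m, c o (p 0) * c o (p j) * (c' o (p 0) * c' o (p j)) = x (p 0) * x (p j) := by
    intro j
    induction j with
    | zero =>
      intro _
      rw [zmod_three_mul_self (hcne hP 0 (by omega)), zmod_three_mul_self (hcne hQ 0 (by omega)),
        zmod_three_mul_self (hx0 _), one_mul]
    | succ j ih =>
      intro hj
      have h1 := ih (by omega)
      have h2 := hy j hj
      have h3 := congrArg₂ (· * ·) h1 h2
      have sP := zmod_three_mul_self (hcne hP j (by omega))
      have sQ := zmod_three_mul_self (hcne hQ j (by omega))
      have sx := zmod_three_mul_self (hx0 (p j))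
      linear_combination h3 + (x (p 0) * x (p (j + 1))) * sx
        - (c o (p 0) * c' o (p 0) * c o (p (j + 1)) * c' o (p (j + 1))) *
          (c' o (p j) * c' o (p j) * sP + sQ)
  have hz0 : z ≠ p 0 := by rintro rfl; exact (hp 0 (by omega)).2 hz
  have hzm : z ≠ p m := by intro h; exact (hp m le_rfl).2 (h ▸ hz)
  have h0m : p 0 ≠ p m := hpne 0 (by omega) m le_rfl (Ne.symm hm)
  have key2 : ∀ {c d : Set E → E → ZMod 3}, M.IsPaintingFun c d →
      c o z * d (D z) z + (c o (p 0) * d (D z) (p 0) + c o (p m) * d (D z) (p m)) = 0 :=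
    fun h ↦ h.add_add_eq_zero ho (hDco z hz) hz0 hzm h0m hDz
  have h0' : p 0 ∈ D z := by rw [hD]; exact h0
  have hl' : p m ∈ D z := by rw [hD]; exact hl
  -- Whether z lies in o depends on the matroid only. So both paintings get the three-term relation
  -- or both get the two-term relation, and in the second case the two minus signs cancel.
  have hfin : c o (p 0) * c o (p m) * (c' o (p 0) * c' o (p m)) =
      d (D z) (p 0) * d (D z) (p m) * (d' (D z) (p 0) * d' (D z) (p m)) := by
    have kP := key2 hP
    have kQ := key2 hQ
    by_cases hzo : z ∈ o
    · rw [zmod_three_mul_of_add_add kP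
        (mul_ne_zero ((hP.circuit_ne_zero o ho z).2 hzo) (hdne hP z hz z (hself z)))
        (hcne hP 0 (by omega)) (hdne hP z hz _ h0') (hcne hP m le_rfl) (hdne hP z hz _ hl'),
        zmod_three_mul_of_add_add kQ
        (mul_ne_zero ((hQ.circuit_ne_zero o ho z).2 hzo) (hdne hQ z hz z (hself z)))
        (hcne hQ 0 (by omega)) (hdne hQ z hz _ h0') (hcne hQ m le_rfl) (hdne hQ z hz _ hl')]
    · rw [hP.circuit_eq_zero ho hzo, zero_mul, zero_add] at kP
      rw [hQ.circuit_eq_zero ho hzo, zero_mul, zero_add] at kQ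
      rw [zmod_three_mul_of_add kP
        (hcne hP 0 (by omega)) (hdne hP z hz _ h0') (hcne hP m le_rfl) (hdne hP z hz _ hl'),
        zmod_three_mul_of_add kQ
        (hcne hQ 0 (by omega)) (hdne hQ z hz _ h0') (hcne hQ m le_rfl) (hdne hQ z hz _ hl')]
      ring
  have hne : ∀ e ∈ D z, r e z ≠ 0 := by
    intro e he
    rw [hr]
    exact mul_ne_zero (mul_ne_zero (hdne hP z hz _ he) (hdne hP z hz _ (hself z)))
      (mul_ne_zero (hdne hQ z hz _ he) (hdne hQ z hz _ (hself z)))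
  have hrr : r (p 0) z * r (p m) z = x (p 0) * x (p m) := by
    rw [← hY m le_rfl, hfin, hr]
    have sP := zmod_three_mul_self (hdne hP z hz _ (hself _))
    have sQ := zmod_three_mul_self (hdne hQ z hz _ (hself _))
    linear_combination (d (D z) (p 0) * d (D z) (p m) * d' (D z) (p 0) * d' (D z) (p m)) *
      (d' (D z) z * d' (D z) z * sP + sQ)
  have : ∀ a b s t : ZMod 3, s ≠ 0 → t ≠ 0 → a ≠ 0 → b ≠ 0 → s * t = a * b → s * a = t * b := by
    decide
  exact this _ _ _ _ (hne _ h0') (hne _ hl') (hx0 _) (hx0 _) hrr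

end IsPaintingFun

end Matroid


/-! ### Scalars for fundamental cocircuits and for finite matroids -/

namespace Matroid

variable {E : Type*}

namespace IsPaintingFun

variable {M : Matroid E} {c d c' d' : Set E → E → ZMod 3} {o b : Set E}

/-- On finitely many fundamental cocircuits, two paintings differ by scalars on the edges. -/
lemma exists_scalar_fundCocircuit (hP : M.IsPaintingFun c d) (hQ : M.IsPaintingFun c' d')
    {B : Set E} (hB : M.IsBase B) {B₀ : Set E} (hfin : B₀.Finite) (hB₀ : B₀ ⊆ B) :
    ∃ x : E → ZMod 3, (∀ e, x e ≠ 0) ∧ ∀ f ∈ B₀, ∀ e ∈ M.fundCocircuit f B,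
      d (M.fundCocircuit f B) e * d (M.fundCocircuit f B) f *
        (d' (M.fundCocircuit f B) e * d' (M.fundCocircuit f B) f) = x e * x f := by
  classical
  obtain ⟨D, hD⟩ : ∃ D : E → Set E, D = fun f ↦ M.fundCocircuit f B := ⟨_, rfl⟩
  obtain ⟨r, hr⟩ : ∃ r : E → E → ZMod 3,
    r = fun e f ↦ d (D f) e * d (D f) f * (d' (D f) e * d' (D f) f) := ⟨_, rfl⟩
  have hDco : ∀ f ∈ B, M.IsCocircuit (D f) := fun f hf ↦ by
    rw [hD]; exact fundCocircuit_isCocircuit hf hB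
  have hself : ∀ f, f ∈ D f := fun f ↦ by rw [hD]; exact mem_fundCocircuit _ _ _
  have hDsub : ∀ f, ∀ e ∈ D f, e ≠ f → e ∈ M.E \ B := fun f e he hne ↦ by
    rw [hD] at he; exact (fundCocircuit_subset_insert_compl _ _ _ he).resolve_left hne
  have hdne : ∀ {c d : Set E → E → ZMod 3}, M.IsPaintingFun c d → ∀ f ∈ B, ∀ e ∈ D f,
      d (D f) e ≠ 0 := fun h f hf e he ↦ (h.cocircuit_ne_zero _ (hDco f hf) e).2 he
  have hrne : ∀ f ∈ B, ∀ e ∈ D f, r e f ≠ 0 := by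
    intro f hf e he
    rw [hr]
    exact mul_ne_zero (mul_ne_zero (hdne hP f hf _ he) (hdne hP f hf _ (hself f)))
      (mul_ne_zero (hdne hQ f hf _ he) (hdne hQ f hf _ (hself f)))
  have hrself : ∀ f ∈ B, r f f = 1 := by
    intro f hf
    rw [hr]
    simp only [zmod_three_mul_self (hdne hP f hf _ (hself f)),
      zmod_three_mul_self (hdne hQ f hf _ (hself f)), mul_one]
  suffices ∃ x : E → ZMod 3, (∀ e, x e ≠ 0) ∧ ∀ f ∈ B₀, ∀ e ∈ D f, r e f = x e * x f by
    simpa only [hr, hD] using this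
  induction B₀, hfin using Set.Finite.induction_on with
  | empty => exact ⟨fun _ ↦ 1, fun _ ↦ one_ne_zero, by simp⟩
  | @insert z B₀ hzB₀ hfin ih =>
    obtain ⟨x, hx0, hx⟩ := ih ((Set.subset_insert _ _).trans hB₀)
    have hz : z ∈ B := hB₀ (Set.mem_insert _ _)
    have hsub : B₀ ⊆ B := (Set.subset_insert _ _).trans hB₀
    -- The fundamental graph of B restricted to the cocircuits already treated; it is bipartite with
    -- sides outside B and in B₀.
    let H : SimpleGraph E := SimpleGraph.fromRel fun e f ↦ f ∈ B₀ ∧ e ∈ D f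
    have hHadj : ∀ {a b'}, H.Adj a b' →
        (a ∈ M.E \ B ∧ b' ∈ B₀ ∧ a ∈ D b') ∨ (b' ∈ M.E \ B ∧ a ∈ B₀ ∧ b' ∈ D a) := by
      intro a b' h
      rw [SimpleGraph.fromRel_adj] at h
      rcases h with ⟨hne, ⟨h1, h2⟩ | ⟨h1, h2⟩⟩
      · exact Or.inl ⟨hDsub _ _ h2 hne, h1, h2⟩
      · exact Or.inr ⟨hDsub _ _ h2 hne.symm, h1, h2⟩
    have hadjH : ∀ {e f}, f ∈ B₀ → e ∈ D f → e ≠ f → H.Adj e f := by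
      intro e f hf he hne
      rw [SimpleGraph.fromRel_adj]
      exact ⟨hne, Or.inl ⟨hf, he⟩⟩
    -- Induction on the length of the walk. An inner vertex in D z splits the walk, a chord or a
    -- repeated vertex shortens it; what remains is an induced path to which
    -- `mul_eq_mul_of_inducedPath` applies.
    have claim : ∀ n, ∀ e e' (w : H.Walk e e'), w.length = n → e ∈ D z → e ≠ z → e' ∈ D z →
        e' ≠ z → r e z * x e = r e' z * x e' := by
      intro n
      induction n using Nat.strong_induction_on with
      | _ n IH =>
      intro e e' w hw he hez he' hez'
      by_cases hint : ∃ i, 0 < i ∧ i < n ∧ w.getVert i ∈ D z ∧ w.getVert i ≠ z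
      · obtain ⟨i, hi0, hin, hiD, hiz⟩ := hint
        rw [IH _ hin e _ (w.take i) (by rw [SimpleGraph.Walk.take_length]; omega) he hez hiD hiz]
        exact IH (n - i) (by omega) _ e' (w.drop i) (by rw [SimpleGraph.Walk.drop_length]; omega)
          hiD hiz he' hez'
      by_cases hchord : ∃ i j, i + 1 < j ∧ j ≤ n ∧ H.Adj (w.getVert i) (w.getVert j)
      · obtain ⟨i, j, hij, hj, hA⟩ := hchord
        refine IH (i + (1 + (n - j))) (by omega) e e'
          ((w.take i).append (SimpleGraph.Walk.cons hA (w.drop j))) ?_ he hez he' hez'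
        rw [SimpleGraph.Walk.length_append, SimpleGraph.Walk.length_cons,
          SimpleGraph.Walk.take_length, SimpleGraph.Walk.drop_length]
        omega
      by_cases hrep : ∃ i j, i < j ∧ j ≤ n ∧ w.getVert i = w.getVert j
      · obtain ⟨i, j, hij, hj, hA⟩ := hrep
        refine IH (i + (n - j)) (by omega) e e'
          ((w.take i).append ((w.drop j).copy hA.symm rfl)) ?_ he hez he' hez'
        rw [SimpleGraph.Walk.length_append, SimpleGraph.Walk.length_copy,
          SimpleGraph.Walk.take_length, SimpleGraph.Walk.drop_length]
        omega
      push Not at hint hchord hrep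
      have hinj : ∀ i ≤ n, ∀ j ≤ n, w.getVert i = w.getVert j → i = j := by
        intro i hi j hj hij
        rcases lt_trichotomy i j with h | h | h
        · exact absurd hij (hrep i j h hj)
        · exact h
        · exact absurd hij.symm (hrep j i h hi)
      have hsucc : ∀ i < n, H.Adj (w.getVert i) (w.getVert (i + 1)) := fun i hi ↦
        w.adj_getVert_succ (by omega)
      have hpar : ∀ i ≤ n, (Even i → w.getVert i ∈ M.E \ B) ∧ (¬ Even i → w.getVert i ∈ B₀) := by
        intro i
        induction i with
        | zero => simpa using (hDsub _ _ he hez)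
        | succ i ihi =>
          intro hi
          have h1 := ihi (by omega)
          rcases hHadj (hsucc i (by omega)) with ⟨h2, h3, -⟩ | ⟨h2, h3, -⟩
          · refine ⟨fun hev ↦ ?_, fun _ ↦ h3⟩
            exact absurd (hsub (h1.2 (by simpa [Nat.even_add_one] using hev))) h2.2
          · refine ⟨fun _ ↦ h2, fun hev ↦ ?_⟩
            exact absurd (hsub h3) (h1.1 (by simpa [Nat.even_add_one] using hev)).2
      have hnev : Even n := by
        by_contra hn
        have := (hpar n le_rfl).2 hn
        rw [← hw, w.getVert_length] at this
        exact (hDsub _ _ he' hez').2 (hsub this)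
      obtain ⟨m, rfl⟩ := hnev
      rcases eq_or_ne m 0 with rfl | hm
      · have : e = e' := SimpleGraph.Walk.eq_of_length_eq_zero (by simpa using hw)
        rw [this]
      have hev : ∀ j, Even (2 * j) := fun j ↦ even_two_mul j
      have hod : ∀ j, ¬ Even (2 * j + 1) := fun j ↦ by simp
      have hadj1 : ∀ j < m, w.getVert (2 * j) ∈ D (w.getVert (2 * j + 1)) := by
        intro j hj
        rcases hHadj (hsucc (2 * j) (by omega)) with ⟨-, -, h⟩ | ⟨-, h3, -⟩
        · exact h
        · exact absurd (hsub h3) ((hpar (2 * j) (by omega)).1 (hev j)).2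
      have hadj2 : ∀ j < m, w.getVert (2 * (j + 1)) ∈ D (w.getVert (2 * j + 1)) := by
        intro j hj
        rcases hHadj (hsucc (2 * j + 1) (by omega)) with ⟨-, h, -⟩ | ⟨-, -, h3⟩
        · exact absurd (hsub h) ((hpar (2 * (j + 1)) (by omega)).1 (hev _)).2
        · exact h3
      have hlast : w.getVert (2 * m) = e' := by
        rw [two_mul, ← hw, w.getVert_length]
      have hfirst : w.getVert (2 * 0) = e := by simp
      have := hP.mul_eq_mul_of_inducedPath hQ hB hz hm (p := fun j ↦ w.getVert (2 * j))
        (q := fun j ↦ w.getVert (2 * j + 1))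
        (fun j hj ↦ (hpar (2 * j) (by omega)).1 (hev j))
        (fun i hi j hj hij ↦ by
          have := hinj (2 * i) (by simp at hi; omega) (2 * j) (by simp at hj; omega) hij
          omega)
        (fun j hj ↦ hsub ((hpar (2 * j + 1) (by omega)).2 (hod j)))
        (fun j hj h ↦ hzB₀ (h ▸ (hpar (2 * j + 1) (by omega)).2 (hod j)))
        (fun j hj ↦ by have := hadj1 j hj; rwa [hD] at this)
        (fun j hj ↦ by have := hadj2 j hj; rwa [hD] at this)
        (fun j hj i hi h ↦ by
          have hA : H.Adj (w.getVert (2 * i)) (w.getVert (2 * j + 1)) := by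
            refine hadjH ((hpar (2 * j + 1) (by omega)).2 (hod j)) (by rwa [hD]) ?_
            intro h'
            have := hinj _ (by omega) _ (by omega) h'
            omega
          by_contra! hne
          rcases lt_or_gt_of_ne hne.1 with h1 | h1
          · exact hchord (2 * i) (2 * j + 1) (by omega) (by omega) hA
          · exact hchord (2 * j + 1) (2 * i) (by omega) (by omega) hA.symm)
        (by simp only [hfirst]; rwa [hD] at he) (by simp only [hlast]; rwa [hD] at he')
        (fun i hi h ↦ by
          by_contra! hne
          have h1 : w.getVert (2 * i) ∈ D z := by rwa [hD]
          have h2 := hint (2 * i) (by omega) (by omega) h1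
          exact ((hpar (2 * i) (by omega)).1 (hev i)).2 (h2 ▸ hz))
        D hD r hr x hx0
        (fun j hj ↦ hx _ ((hpar (2 * j + 1) (by omega)).2 (hod j)) _ (hadj1 j hj))
        (fun j hj ↦ hx _ ((hpar (2 * j + 1) (by omega)).2 (hod j)) _ (hadj2 j hj))
      simpa only [hfirst, hlast] using this
    -- The sign of x is reversed on those components of H which contain a neighbour e of z with r e
    -- z * x e = -1. By `claim` all neighbours of z in one component agree on this, and relations
    -- inside a component are unaffected.
    let flag : E → Prop := fun g ↦ ∃ e ∈ D z, e ≠ z ∧ H.Reachable e g ∧ r e z * x e = -1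
    refine ⟨fun g ↦ if g = z then 1 else if flag g then - x g else x g, ?_, ?_⟩
    · intro e
      dsimp only
      split_ifs
      · exact one_ne_zero
      · exact neg_ne_zero.2 (hx0 e)
      · exact hx0 e
    · intro f hf e he
      rcases eq_or_ne f z with rfl | hfz
      · rcases eq_or_ne e f with rfl | hez
        · simp [hrself e hz]
        simp only [hez, if_true, if_false, mul_one]
        have hpm : ∀ a b : ZMod 3, a ≠ 0 → b ≠ 0 → (a * b = -1 → a = - b) ∧
          (a * b ≠ -1 → a = b) := by decide
        split_ifs with hfl
        · obtain ⟨e₁, h1, h2, ⟨w⟩, h4⟩ := hfl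
          have := claim _ e₁ e w rfl h1 h2 he hez
          rw [h4] at this
          exact (hpm _ _ (hrne f hz e he) (hx0 e)).1 this.symm
        · refine (hpm _ _ (hrne f hz e he) (hx0 e)).2 fun h ↦ hfl ⟨e, he, hez, ⟨.nil⟩, h⟩
      · have hf' : f ∈ B₀ := hf.resolve_left hfz
        rcases eq_or_ne e f with rfl | hef
        · rw [hrself e (hsub hf')]
          simp only [hfz, if_false]
          split_ifs
          · rw [neg_mul_neg, zmod_three_mul_self (hx0 e)]
          · rw [zmod_three_mul_self (hx0 e)]
        have hez : e ≠ z := by rintro rfl; exact (hDsub _ _ he hef).2 hz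
        have hA := hadjH hf' he hef
        have hflag : flag e ↔ flag f := by
          constructor
          · rintro ⟨e₁, h1, h2, h3, h4⟩
            exact ⟨e₁, h1, h2, h3.trans hA.reachable, h4⟩
          · rintro ⟨e₁, h1, h2, h3, h4⟩
            exact ⟨e₁, h1, h2, h3.trans hA.symm.reachable, h4⟩
        simp only [hfz, hez, if_false, hflag]
        rw [hx f hf' e he]
        split_ifs
        · ring
        · rfl

/-- Two paintings of a finite matroid over the field with three elements differ by scalars on the
edges and on the circuits. -/
lemma exists_scalar_of_finite (hP : M.IsPaintingFun c d) (hQ : M.IsPaintingFun c' d')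
    (hfin : M.E.Finite) :
    ∃ x : E → ZMod 3, (∀ e, x e ≠ 0) ∧ ∀ o, M.IsCircuit o → ∀ e ∈ o, ∀ g ∈ o,
      c o e * c o g * (c' o e * c' o g) = x e * x g := by
  classical
  obtain ⟨B, hB⟩ := M.exists_isBase
  obtain ⟨x, hx0, hx⟩ := hP.exists_scalar_fundCocircuit hQ hB (hfin.subset hB.subset_ground)
    subset_rfl
  refine ⟨x, hx0, fun o ho e₀ he₀ g₀ hg₀ ↦ ?_⟩
  let s := hfin.toFinset
  have hs : ∀ o b, M.IsCircuit o → o ∩ b ⊆ s := fun o b ho e he ↦ by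
    simpa [s] using ho.subset_ground he.1
  -- The difference between c o rescaled by x and c' o, both normalised to be 1 at e₀. It is
  -- orthogonal to the fundamental cocircuits, hence to all cocircuits, and is supported in the
  -- independent set o ∖ {e₀}; therefore it is zero.
  let w : E → ZMod 3 := fun g ↦ c o g * c o e₀ * (x g * x e₀) - c' o g * c' o e₀
  have hcne : ∀ {c d : Set E → E → ZMod 3}, M.IsPaintingFun c d → ∀ e ∈ o, c o e ≠ 0 :=
    fun h e he ↦ (h.circuit_ne_zero o ho e).2 he
  have hw0 : ∀ g, g ∉ o → w g = 0 := fun g hg ↦ by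
    simp [w, hP.circuit_eq_zero ho hg, hQ.circuit_eq_zero ho hg]
  have hwe₀ : w e₀ = 0 := by
    simp [w, zmod_three_mul_self (hcne hP _ he₀), zmod_three_mul_self (hcne hQ _ he₀),
      zmod_three_mul_self (hx0 e₀)]
  have hDw : ∀ f ∈ B, ∑ g ∈ s, w g * d' (M.fundCocircuit f B) g = 0 := by
    intro f hf
    have hco := fundCocircuit_isCocircuit hf hB
    have h1 := hP.sum_eq_zero ho hco s (hs _ _ ho)
    have h2 := hQ.sum_eq_zero ho hco s (hs _ _ ho)
    have hself := M.mem_fundCocircuit f B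
    have nP := (hP.cocircuit_ne_zero _ hco f).2 hself
    have nQ := (hQ.cocircuit_ne_zero _ hco f).2 hself
    have h3 : ∀ g, d' (M.fundCocircuit f B) g = d (M.fundCocircuit f B) g *
        (x g * (x f * d (M.fundCocircuit f B) f * d' (M.fundCocircuit f B) f)) := by
      intro g
      by_cases hg : g ∈ M.fundCocircuit f B
      · have := hx f hf g hg
        have n1 := (hP.cocircuit_ne_zero _ hco g).2 hg
        have n2 := (hQ.cocircuit_ne_zero _ hco g).2 hg
        have a1 := zmod_three_mul_self nP
        have a2 := zmod_three_mul_self nQ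
        have a3 := zmod_three_mul_self n1
        linear_combination (-(d' (M.fundCocircuit f B) g)) * (a1 +
          d (M.fundCocircuit f B) f * d (M.fundCocircuit f B) f * a2 +
          d (M.fundCocircuit f B) f * d (M.fundCocircuit f B) f * d' (M.fundCocircuit f B) f *
          d' (M.fundCocircuit f B) f * a3) + d (M.fundCocircuit f B) g *
          d (M.fundCocircuit f B) f * d' (M.fundCocircuit f B) f * this
      · rw [hP.cocircuit_eq_zero hco hg, hQ.cocircuit_eq_zero hco hg, zero_mul]
    have h4 : ∀ g ∈ s, w g * d' (M.fundCocircuit f B) g =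
        (c o e₀ * x e₀ * (x f * d (M.fundCocircuit f B) f * d' (M.fundCocircuit f B) f)) *
          (c o g * d (M.fundCocircuit f B) g) -
        c' o e₀ * (c' o g * d' (M.fundCocircuit f B) g) := by
      intro g _
      simp only [w]
      have := h3 g
      have a := zmod_three_mul_self (hx0 g)
      linear_combination c o g * c o e₀ * (x g * x e₀) * this + c o g * c o e₀ * x e₀ *
        d (M.fundCocircuit f B) g * (x f * d (M.fundCocircuit f B) f *
        d' (M.fundCocircuit f B) f) * a
    rw [Finset.sum_congr rfl h4, Finset.sum_sub_distrib, ← Finset.mul_sum, ← Finset.mul_sum, h1, h2]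
    simp
  -- `w` is a linear combination of fundamental circuits
  have hwB : ∀ g ∈ M.E, w g = ∑ e ∈ s.filter (· ∉ B),
      w e * c' (M.fundCircuit e B) e * c' (M.fundCircuit e B) g := by
    have hoff : ∀ g ∈ M.E, g ∉ B → w g = ∑ e ∈ s.filter (· ∉ B),
        w e * c' (M.fundCircuit e B) e * c' (M.fundCircuit e B) g := by
      intro g hgE hgB
      have hc := hB.fundCircuit_isCircuit hgE hgB
      rw [Finset.sum_eq_single g]
      · rw [mul_assoc, zmod_three_mul_self ((hQ.circuit_ne_zero _ hc g).2
          (M.mem_fundCircuit g B)), mul_one]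
      · intro e he hne
        have he' : e ∈ M.E ∧ e ∉ B := by simpa [s] using he
        rw [hQ.circuit_eq_zero (hB.fundCircuit_isCircuit he'.1 he'.2) (e := g), mul_zero]
        intro h
        rcases M.fundCircuit_subset_insert e B h with h | h
        · exact hne h.symm
        · exact hgB h
      · intro h; exact absurd (by simpa [s] using ⟨hgE, hgB⟩) h
    intro f hfE
    by_cases hfB : f ∈ B
    swap
    · exact hoff f hfE hfB
    have hco := fundCocircuit_isCocircuit hfB hB
    have nQ := (hQ.cocircuit_ne_zero _ hco f).2 (M.mem_fundCocircuit f B)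
    -- The difference of the two sides is zero outside B by `hoff` and orthogonal to the fundamental
    -- cocircuit of f, which meets B only in f.
    have hz : ∑ g ∈ s, (w g - ∑ e ∈ s.filter (· ∉ B),
        w e * c' (M.fundCircuit e B) e * c' (M.fundCircuit e B) g) *
          d' (M.fundCocircuit f B) g = 0 := by
      simp_rw [sub_mul]
      rw [Finset.sum_sub_distrib, hDw f hfB, zero_sub, neg_eq_zero]
      simp_rw [Finset.sum_mul]
      rw [Finset.sum_comm]
      refine Finset.sum_eq_zero fun e he ↦ ?_
      have he' : e ∈ M.E ∧ e ∉ B := by simpa [s] using he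
      simp_rw [mul_assoc]
      rw [← Finset.mul_sum, ← Finset.mul_sum,
        hQ.sum_eq_zero (hB.fundCircuit_isCircuit he'.1 he'.2) hco s
        (hs _ _ (hB.fundCircuit_isCircuit he'.1 he'.2)), mul_zero, mul_zero]
    rw [Finset.sum_eq_single f] at hz
    · exact sub_eq_zero.1 ((mul_eq_zero.1 hz).resolve_right nQ)
    · intro g hg hgf
      by_cases hgD : g ∈ M.fundCocircuit f B
      · have := (M.fundCocircuit_subset_insert_compl f B hgD).resolve_left hgf
        rw [← hoff g this.1 this.2, sub_self, zero_mul]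
      · rw [hQ.cocircuit_eq_zero hco hgD, mul_zero]
    · intro h; exact absurd (by simpa [s] using hfE) h
  have hwb : ∀ b, M.IsCocircuit b → ∑ g ∈ s, w g * d' b g = 0 := by
    intro b hb
    have : ∀ g ∈ s, w g * d' b g = ∑ e ∈ s.filter (· ∉ B),
        w e * c' (M.fundCircuit e B) e * c' (M.fundCircuit e B) g * d' b g := by
      intro g hg
      rw [hwB g (by simpa [s] using hg), Finset.sum_mul]
    rw [Finset.sum_congr rfl this, Finset.sum_comm]
    refine Finset.sum_eq_zero fun e he ↦ ?_
    have he' : e ∈ M.E ∧ e ∉ B := by simpa [s] using he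
    simp_rw [mul_assoc]
    rw [← Finset.mul_sum, ← Finset.mul_sum,
      hQ.sum_eq_zero (hB.fundCircuit_isCircuit he'.1 he'.2) hb s
      (hs _ _ (hB.fundCircuit_isCircuit he'.1 he'.2)), mul_zero, mul_zero]
  have hwg : w g₀ = 0 := by
    rcases eq_or_ne g₀ e₀ with rfl | hne
    · exact hwe₀
    -- A cocircuit meeting o ∖ {e₀} only in g₀ isolates the value of w at g₀.
    obtain ⟨b, hb, hbI⟩ := (ho.sdiff_singleton_indep he₀).exists_isCocircuit_inter_eq_mem
      (e := g₀) ⟨hg₀, hne⟩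
    have h1 := hwb b hb
    have hgb : g₀ ∈ b := (hbI.symm ▸ rfl : g₀ ∈ b ∩ (o \ {e₀})).1
    rw [Finset.sum_eq_single g₀] at h1
    · exact (mul_eq_zero.1 h1).resolve_right ((hQ.cocircuit_ne_zero b hb g₀).2 hgb)
    · intro g _ hg
      by_cases hgo : g ∈ o
      swap
      · rw [hw0 g hgo, zero_mul]
      rcases eq_or_ne g e₀ with rfl | hge
      · rw [hwe₀, zero_mul]
      rw [hQ.cocircuit_eq_zero hb, mul_zero]
      intro h
      have : g ∈ b ∩ (o \ {e₀}) := ⟨h, hgo, hge⟩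
      rw [hbI] at this
      exact hg this
    · intro h; exact absurd (by simpa [s] using ho.subset_ground hg₀) h
  have n1 := hcne hQ _ he₀
  have n2 := hcne hQ _ hg₀
  have : c o g₀ * c o e₀ * (x g₀ * x e₀) = c' o g₀ * c' o e₀ := sub_eq_zero.1 hwg
  have a1 := zmod_three_mul_self n1
  have a2 := zmod_three_mul_self n2
  have a3 := zmod_three_mul_self (hcne hP _ he₀)
  have a4 := zmod_three_mul_self (hcne hP _ hg₀)
  have hdec : ∀ a b y : ZMod 3, a ≠ 0 → b ≠ 0 → y ≠ 0 → a * y = b → a * b = y := by decide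
  have := hdec _ _ _ (mul_ne_zero (hcne hP _ hg₀) (hcne hP _ he₀)) (mul_ne_zero n2 n1)
    (mul_ne_zero (hx0 _) (hx0 _)) this
  rw [mul_comm (c o e₀), mul_comm (c' o e₀), this, mul_comm]

end IsPaintingFun

end Matroid


/-! ### From finite minors to infinite matroids by compactness -/

namespace Matroid

variable {E : Type*}

/-- A pair of elements of a circuit is the intersection of the circuit with some cocircuit. -/
lemma IsCircuit.exists_isCocircuit_inter_eq_pair {M : Matroid E} {o : Set E} (ho : M.IsCircuit o)
    {e f : E} (he : e ∈ o) (hf : f ∈ o) (hef : e ≠ f) :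
    ∃ b, M.IsCocircuit b ∧ o ∩ b = {e, f} := by
  obtain ⟨b, hb, hbI⟩ := (ho.sdiff_singleton_indep he).exists_isCocircuit_inter_eq_mem
    (e := f) ⟨hf, hef.symm⟩
  have hfb : f ∈ b := (hbI.symm ▸ rfl : f ∈ b ∩ (o \ {e})).1
  have hsub : ∀ g ∈ o ∩ b, g ≠ e → g = f := fun g hg hge ↦ by
    have : g ∈ b ∩ (o \ {e}) := ⟨hg.2, hg.1, hge⟩
    rwa [hbI] at this
  refine ⟨b, hb, Set.Subset.antisymm ?_ ?_⟩
  · intro g hg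
    by_cases hge : g = e
    · exact Or.inl hge
    · exact Or.inr (hsub g hg hge)
  · have heb : e ∈ b := by
      by_contra heb
      refine ho.inter_isCocircuit_ne_singleton hb (e := f) ?_
      refine Set.Subset.antisymm (fun g hg ↦ hsub g hg ?_) (by simpa using ⟨hf, hfb⟩)
      rintro rfl
      exact heb hg.2
    rintro g (rfl | rfl)
    · exact ⟨he, heb⟩
    · exact ⟨hf, hfb⟩

namespace IsPaintingFun

variable {R : Type*} [CommRing R] {M : Matroid E} {c d : Set E → E → R}

/-- A painting restricts to minors: choose, for every circuit or cocircuit of the minor, one of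
`M` which induces it. -/
lemma minor (hP : M.IsPaintingFun c d) {C D : Set E} {lc ld : Set E → Set E}
    (hlc : ∀ o, (M ／ C ＼ D).IsCircuit o → M.IsCircuit (lc o) ∧ o ⊆ lc o ∧ lc o ⊆ o ∪ C)
    (hld : ∀ b, (M ／ C ＼ D).IsCocircuit b → M.IsCocircuit (ld b) ∧ b ⊆ ld b ∧ ld b ⊆ b ∪ D)
    (hCD : Disjoint C D) :
    (M ／ C ＼ D).IsPaintingFun (fun o ↦ o.indicator (c (lc o)))
      (fun b ↦ b.indicator (d (ld b))) := by
  classical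
  -- Circuits are extended into C only and cocircuits into D only, and C and D are disjoint, so no
  -- new common elements arise.
  have hinter : ∀ o b, (M ／ C ＼ D).IsCircuit o → (M ／ C ＼ D).IsCocircuit b →
      lc o ∩ ld b ⊆ o ∩ b := by
    rintro o b ho hb e ⟨heo, heb⟩
    have hoE := ho.subset_ground
    have hbE := hb.subset_ground
    simp only [delete_ground, contract_ground] at hoE hbE
    rcases (hlc o ho).2.2 heo with h1 | h1 <;> rcases (hld b hb).2.2 heb with h2 | h2
    · exact ⟨h1, h2⟩
    · exact absurd h2 (hoE h1).2
    · exact absurd h1 (hbE h2).1.2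
    · exact absurd h2 (hCD.notMem_of_mem_left h1)
  refine ⟨fun o ho e ↦ ?_, fun b hb e ↦ ?_, fun o b ho hb ↦ ?_, fun o b ho hb ↦ ?_⟩
  · obtain ⟨h1, h2, h3⟩ := hlc o ho
    by_cases he : e ∈ o
    · simpa [he] using (hP.circuit_ne_zero _ h1 e).2 (h2 he)
    · simp [he]
  · obtain ⟨h1, h2, h3⟩ := hld b hb
    by_cases he : e ∈ b
    · simpa [he] using (hP.cocircuit_ne_zero _ h1 e).2 (h2 he)
    · simp [he]
  · exact (hP.finite_inter _ _ (hlc o ho).1 (hld b hb).1).subset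
      (Set.inter_subset_inter (hlc o ho).2.1 (hld b hb).2.1)
  · rw [← hP.finsum_eq_zero _ _ (hlc o ho).1 (hld b hb).1]
    refine finsum_congr fun e ↦ ?_
    by_cases he : e ∈ o ∩ b
    · simp [he.1, he.2]
    · have h1 : e ∉ lc o ∩ ld b := fun h ↦ he (hinter o b ho hb h)
      have h2 : o.indicator (c (lc o)) e * b.indicator (d (ld b)) e = 0 := by
        rw [Set.mem_inter_iff, not_and_or] at he
        rcases he with he | he <;> simp [he]
      rw [h2]
      rw [Set.mem_inter_iff, not_and_or] at h1
      rcases h1 with h1 | h1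
      · rw [hP.circuit_eq_zero (hlc o ho).1 h1, zero_mul]
      · rw [hP.cocircuit_eq_zero (hld b hb).1 h1, mul_zero]

variable {c d c' d' : Set E → E → ZMod 3}

/-- On a finite set of edges and for finitely many circuits, two paintings of a matroid over the
field with three elements differ by scalars. -/
lemma exists_scalar_local (hP : M.IsPaintingFun c d) (hQ : M.IsPaintingFun c' d')
    {O : Set (Set E)} (hO : O.Finite) (hOc : ∀ o ∈ O, M.IsCircuit o) {F₀ : Set E}
    (hF₀ : F₀.Finite) :
    ∃ x : E → ZMod 3, (∀ e, x e ≠ 0) ∧ ∀ o ∈ O, ∀ e ∈ o ∩ F₀, ∀ g ∈ o ∩ F₀,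
      c o e * c o g * (c' o e * c' o g) = x e * x g := by
  classical
  have hpair : ∀ o e f, ∃ b, (o ∈ O ∧ e ∈ o ∧ f ∈ o ∧ e ≠ f) → M.IsCocircuit b ∧ o ∩ b = {e, f} := by
    intro o e f
    by_cases h : o ∈ O ∧ e ∈ o ∧ f ∈ o ∧ e ≠ f
    · obtain ⟨b, hb⟩ := (hOc o h.1).exists_isCocircuit_inter_eq_pair h.2.1 h.2.2.1 h.2.2.2
      exact ⟨b, fun _ ↦ hb⟩
    · exact ⟨∅, fun h' ↦ absurd h' h⟩
  choose bb hbb using hpair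
  let T : Set (Set E × E × E) := {t | t.1 ∈ O ∧ t.2.1 ∈ t.1 ∧ t.2.2 ∈ t.1 ∧ t.2.1 ≠ t.2.2} ∩
    (O ×ˢ (F₀ ×ˢ F₀))
  have hT : T.Finite := (hO.prod (hF₀.prod hF₀)).subset Set.inter_subset_right
  -- F contains the intersections of all given circuits with the chosen cocircuits. Hence the set C,
  -- to be contracted, avoids these cocircuits, and circuits of the minor can be extended through C
  -- without meeting them again.
  let F : Set E := F₀ ∪ ⋃ o ∈ O, ⋃ t ∈ T, o ∩ bb t.1 t.2.1 t.2.2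
  have hF : F.Finite := by
    refine hF₀.union (hO.biUnion fun o ho ↦ hT.biUnion fun t ht ↦ ?_)
    exact hP.finite_inter _ _ (hOc o ho) (hbb _ _ _ ht.1).1
  let C : Set E := (⋃ o ∈ O, o) \ F
  let D : Set E := (F ∪ C)ᶜ
  have hCD : Disjoint C D := Set.disjoint_left.2 fun e he he' ↦ he' (Or.inr he)
  have hlc : ∀ o, ∃ o', (M ／ C ＼ D).IsCircuit o → M.IsCircuit o' ∧ o ⊆ o' ∧ o' ⊆ o ∪ C := by
    intro o
    by_cases h : (M ／ C ＼ D).IsCircuit o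
    · obtain ⟨o', h'⟩ := h.of_delete.exists_subset_isCircuit_of_contract
      exact ⟨o', fun _ ↦ h'⟩
    · exact ⟨∅, fun h' ↦ absurd h' h⟩
  have hld : ∀ b, ∃ b', (M ／ C ＼ D).IsCocircuit b → M.IsCocircuit b' ∧ b ⊆ b' ∧ b' ⊆ b ∪ D := by
    intro b
    by_cases h : (M ／ C ＼ D).IsCocircuit b
    · rw [contract_delete_comm _ hCD] at h
      have h := h.of_contract
      rw [isCocircuit_def, dual_delete] at h
      obtain ⟨o', h'⟩ := h.exists_subset_isCircuit_of_contract
      exact ⟨o', fun _ ↦ h'⟩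
    · exact ⟨∅, fun h' ↦ absurd h' h⟩
  choose lc hlc using hlc
  choose ld hld using hld
  have hN : (M ／ C ＼ D).E.Finite := by
    refine hF.subset fun e he ↦ ?_
    simp only [delete_ground, contract_ground] at he
    by_contra heF
    exact he.2 fun h ↦ h.elim heF he.1.2
  obtain ⟨x, hx0, hx⟩ := (hP.minor hlc hld hCD).exists_scalar_of_finite (hQ.minor hlc hld hCD) hN
  refine ⟨x, hx0, fun o ho e he g hg ↦ ?_⟩
  have hoc := hOc o ho
  have hne : ∀ {c d : Set E → E → ZMod 3}, M.IsPaintingFun c d → ∀ e ∈ o, c o e ≠ 0 :=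
    fun h e he ↦ (h.circuit_ne_zero o hoc e).2 he
  rcases eq_or_ne e g with rfl | heg
  · rw [zmod_three_mul_self (hne hP e he.1), zmod_three_mul_self (hne hQ e he.1),
      zmod_three_mul_self (hx0 e), one_mul]
  -- a circuit of the minor through `e` inside `o`
  have hoC : o \ F ⊆ C := fun h hh ↦ ⟨Set.mem_biUnion ho hh.1, hh.2⟩
  have heC : e ∉ C := fun h ↦ h.2 (Or.inl he.2)
  have hFD : ∀ h ∈ F, h ∉ D := fun h hh h' ↦ h' (Or.inl hh)
  have hcl : e ∈ (M ／ C ＼ D).closure ((o ∩ F) \ {e}) := by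
    rw [delete_closure_eq_of_disjoint, contract_closure_eq]
    · refine ⟨⟨?_, heC⟩, hFD e (Or.inl he.2)⟩
      refine M.closure_subset_closure ?_ (hoc.mem_closure_sdiff_singleton_of_mem he.1)
      rintro h ⟨hh, hne⟩
      by_cases hhF : h ∈ F
      · exact Or.inl ⟨⟨hh, hhF⟩, hne⟩
      · exact Or.inr (hoC ⟨hh, hhF⟩)
    · exact Set.disjoint_left.2 fun h hh ↦ hFD h hh.1.2
  obtain ⟨o', ho'sub, ho', heo'⟩ := exists_isCircuit_of_mem_closure hcl (by simp)
  have ho'F : o' ⊆ o ∩ F := by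
    intro h hh
    rcases ho'sub hh with rfl | hh
    · exact ⟨he.1, Or.inl he.2⟩
    · exact hh.1
  obtain ⟨hl, hl1, hl2⟩ := hlc o' ho'
  obtain ⟨hb, hob⟩ := hbb o e g ⟨ho, he.1, hg.1, heg⟩
  have htT : (o, e, g) ∈ T := ⟨⟨ho, he.1, hg.1, heg⟩, ho, he.2, hg.2⟩
  have hlb : lc o' ∩ bb o e g ⊆ {e, g} := by
    rintro h ⟨h1, h2⟩
    rw [← hob]
    rcases hl2 h1 with h3 | h3
    · exact ⟨(ho'F h3).1, h2⟩
    · obtain ⟨h4, h5⟩ := h3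
      simp only [Set.mem_iUnion] at h4
      obtain ⟨o₁, ho₁, h6⟩ := h4
      have h7 : h ∈ F := Or.inr (Set.mem_biUnion ho₁ (Set.mem_biUnion htT ⟨h6, h2⟩))
      exact absurd h7 h5
  have heb : e ∈ bb o e g := (hob.symm ▸ Or.inl rfl : e ∈ o ∩ bb o e g).2
  have hgb : g ∈ bb o e g := (hob.symm ▸ Or.inr rfl : g ∈ o ∩ bb o e g).2
  -- Otherwise the circuit and the cocircuit would have just the element e in common.
  have hgl : g ∈ lc o' := by
    by_contra hgl
    refine hl.inter_isCocircuit_ne_singleton hb (e := e) (Set.Subset.antisymm ?_ ?_)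
    · intro h hh
      rcases hlb hh with rfl | rfl
      · rfl
      · exact absurd hh.1 hgl
    · simpa using ⟨hl1 heo', heb⟩
  have hgo' : g ∈ o' := (hl2 hgl).resolve_right fun h ↦ h.2 (Or.inl hg.2)
  -- Both circuits meet the same cocircuit in the pair e, g, so both products equal minus the
  -- product of the cocircuit values. This transfers the relation from the circuit of the minor to
  -- o.
  have hrel : ∀ {c d : Set E → E → ZMod 3}, M.IsPaintingFun c d →
      c o e * c o g = c (lc o') e * c (lc o') g := by
    intro c d h
    have n1 := (h.cocircuit_ne_zero _ hb e).2 heb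
    have n2 := (h.cocircuit_ne_zero _ hb g).2 hgb
    rw [zmod_three_mul_of_add (h.add_eq_zero hoc hb heg hob.subset) (hne h e he.1) n1
      (hne h g hg.1) n2,
      zmod_three_mul_of_add (h.add_eq_zero hl hb heg hlb)
      ((h.circuit_ne_zero _ hl e).2 (hl1 heo')) n1 ((h.circuit_ne_zero _ hl g).2 hgl) n2]
  have := hx o' ho' e heo' g hgo'
  simp only [Set.indicator_of_mem heo', Set.indicator_of_mem hgo'] at this
  rw [hrel hP, hrel hQ, this]

/-- Two paintings over the field with three elements differ by scalars on the edges and on the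
circuits. -/
lemma exists_scalar (hP : M.IsPaintingFun c d) (hQ : M.IsPaintingFun c' d') :
    ∃ x : E → ZMod 3, (∀ e, x e ≠ 0) ∧ ∀ o, M.IsCircuit o → ∀ e ∈ o, ∀ g ∈ o,
      c o e * c o g * (c' o e * c' o g) = x e * x g := by
  classical
  let S : {t : Set E × E × E // M.IsCircuit t.1 ∧ t.2.1 ∈ t.1 ∧ t.2.2 ∈ t.1} →
      Set (E → (ZMod 3)ˣ) := fun t ↦ {x | c t.1.1 t.1.2.1 * c t.1.1 t.1.2.2 *
      (c' t.1.1 t.1.2.1 * c' t.1.1 t.1.2.2) = (x t.1.2.1 : ZMod 3) * (x t.1.2.2 : ZMod 3)}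
  let : TopologicalSpace (ZMod 3)ˣ := ⊥
  have : DiscreteTopology (ZMod 3)ˣ := ⟨rfl⟩
  have hne : (⋂ t, S t).Nonempty := by
    -- The space of all sign vectors is a product of finite discrete spaces. Each condition involves
    -- two coordinates and so is closed; finitely many of them are satisfiable by
    -- `exists_scalar_local`.
    apply CompactSpace.iInter_nonempty
    · intro t
      have : S t = (fun x : E → (ZMod 3)ˣ ↦ (x t.1.2.1, x t.1.2.2)) ⁻¹'
          {p | c t.1.1 t.1.2.1 * c t.1.1 t.1.2.2 * (c' t.1.1 t.1.2.1 * c' t.1.1 t.1.2.2) =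
          (p.1 : ZMod 3) * (p.2 : ZMod 3)} := rfl
      rw [this]
      exact (isClosed_discrete _).preimage (by fun_prop)
    · intro s
      obtain ⟨x, hx0, hx⟩ := hP.exists_scalar_local hQ
        (O := (fun t : {t : Set E × E × E // M.IsCircuit t.1 ∧ t.2.1 ∈ t.1 ∧ t.2.2 ∈ t.1} ↦
          t.1.1) '' (s : Set _)) (s.finite_toSet.image _)
        (by rintro _ ⟨t, -, rfl⟩; exact t.2.1)
        (F₀ := (fun t : {t : Set E × E × E // M.IsCircuit t.1 ∧ t.2.1 ∈ t.1 ∧ t.2.2 ∈ t.1} ↦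
          t.1.2.1) '' (s : Set _) ∪ (fun t : {t : Set E × E × E //
            M.IsCircuit t.1 ∧ t.2.1 ∈ t.1 ∧ t.2.2 ∈ t.1} ↦ t.1.2.2) '' (s : Set _))
        ((s.finite_toSet.image _).union (s.finite_toSet.image _))
      refine ⟨fun e ↦ Units.mk0 (x e) (hx0 e), ?_⟩
      simp only [Set.mem_iInter]
      intro t ht
      exact hx _ ⟨t, ht, rfl⟩ _ ⟨t.2.2.1, Or.inl ⟨t, ht, rfl⟩⟩ _ ⟨t.2.2.2, Or.inr ⟨t, ht, rfl⟩⟩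
  obtain ⟨x, hx⟩ := hne
  rw [Set.mem_iInter] at hx
  exact ⟨fun e ↦ x e, fun e ↦ (x e).ne_zero, fun o ho e he g hg ↦ hx ⟨(o, e, g), ho, he, hg⟩⟩

end IsPaintingFun

namespace Painting

variable {M : Matroid E} {k : Type*} [Field k]

open Classical in
/-- The values on circuits, extended by zero. -/
noncomputable def circuitFun (P : Painting k M) (o : Set E) (e : E) : k :=
  if h : M.IsCircuit o ∧ e ∈ o then P.c ⟨o, h.1⟩ ⟨e, h.2⟩ else 0

open Classical in
/-- The values on cocircuits, extended by zero. -/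
noncomputable def cocircuitFun (P : Painting k M) (b : Set E) (e : E) : k :=
  if h : M.IsCocircuit b ∧ e ∈ b then P.d ⟨b, h.1⟩ ⟨e, h.2⟩ else 0

lemma circuitFun_apply (P : Painting k M) (o : {o : Set E // M.IsCircuit o}) (e : o.1) :
    P.circuitFun o.1 e = P.c o e := by
  simp [circuitFun, o.2, e.2]

lemma cocircuitFun_apply (P : Painting k M) (b : {b : Set E // M.IsCocircuit b}) (e : b.1) :
    P.cocircuitFun b.1 e = P.d b e := by
  simp [cocircuitFun, b.2, e.2]

lemma isPaintingFun (P : Painting k M) : M.IsPaintingFun P.circuitFun P.cocircuitFun := by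
  refine ⟨fun o ho e ↦ ?_, fun b hb e ↦ ?_, fun o b ho hb ↦ ?_, fun o b ho hb ↦ ?_⟩
  · by_cases he : e ∈ o <;> simp [circuitFun, ho, he]
  · by_cases he : e ∈ b <;> simp [cocircuitFun, hb, he]
  · have := P.finite_support ⟨o, ho⟩ ⟨b, hb⟩
    rw [show (Function.support fun e : ↥(o ∩ b) ↦ (P.c ⟨o, ho⟩ ⟨e, e.2.1⟩ : k) *
      (P.d ⟨b, hb⟩ ⟨e, e.2.2⟩ : k)) = Set.univ from Set.eq_univ_of_forall fun e ↦ by simp] at this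
    exact Set.finite_coe_iff.1 (Set.finite_univ_iff.1 this)
  · rw [← P.sum_eq_zero ⟨o, ho⟩ ⟨b, hb⟩]
    have h1 : ∀ e : ↥(o ∩ b), (P.c ⟨o, ho⟩ ⟨e, e.2.1⟩ : k) * (P.d ⟨b, hb⟩ ⟨e, e.2.2⟩ : k) =
        P.circuitFun o e * P.cocircuitFun b e := by
      intro e
      rw [← P.circuitFun_apply ⟨o, ho⟩ ⟨e, e.2.1⟩, ← P.cocircuitFun_apply ⟨b, hb⟩ ⟨e, e.2.2⟩]
    simp_rw [h1]
    rw [finsum_set_coe_eq_finsum_mem (s := o ∩ b)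
      (f := fun e ↦ P.circuitFun o e * P.cocircuitFun b e), finsum_mem_def]
    refine finsum_congr fun e ↦ ?_
    by_cases he : e ∈ o ∩ b
    · rw [Set.indicator_of_mem he]
    · rw [Set.indicator_of_notMem he]
      rw [Set.mem_inter_iff, not_and_or] at he
      rcases he with he | he
      · simp [circuitFun, he]
      · simp [cocircuitFun, he]

/-- Any two paintings of a matroid over the field with three elements are equivalent. -/
theorem equivalent_zmod_three (P Q : Painting (ZMod 3) M) : P.Equivalent Q := by
  obtain ⟨x, hx0, hx⟩ := P.isPaintingFun.exists_scalar Q.isPaintingFun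
  have hc : ∀ (o : {o : Set E // M.IsCircuit o}) (e g : o.1),
      (P.c o e : ZMod 3) * P.c o g * (Q.c o e * Q.c o g) = x e * x g := by
    intro o e g
    simpa only [circuitFun_apply] using hx o.1 o.2 e e.2 g g.2
  -- The scalars found for circuits also serve cocircuits: a pair in b is the intersection of b with
  -- some circuit, and the two-term relation expresses the values of d by those of c, for both
  -- paintings with the same sign.
  have hd : ∀ (b : {b : Set E // M.IsCocircuit b}) (e g : b.1),
      (P.d b e : ZMod 3) * P.d b g * (Q.d b e * Q.d b g) = x e * x g := by
    intro b e g
    rcases eq_or_ne e g with rfl | heg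
    · rw [zmod_three_mul_self (P.d b e).ne_zero, zmod_three_mul_self (Q.d b e).ne_zero,
        zmod_three_mul_self (hx0 e), one_mul]
    have heg' : (e : E) ≠ g := fun h ↦ heg (Subtype.ext h)
    obtain ⟨o, ho, hbo⟩ := b.2.isCircuit.exists_isCocircuit_inter_eq_pair e.2 g.2 heg'
    rw [dual_isCocircuit_iff] at ho
    have heo : (e : E) ∈ o := (hbo.symm ▸ Or.inl rfl : (e : E) ∈ b.1 ∩ o).2
    have hgo : (g : E) ∈ o := (hbo.symm ▸ Or.inr rfl : (g : E) ∈ b.1 ∩ o).2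
    have hob : o ∩ b.1 ⊆ {(e : E), (g : E)} := by rw [Set.inter_comm, hbo]
    have key : ∀ P : Painting (ZMod 3) M, (P.d b e : ZMod 3) * P.d b g =
        -(P.circuitFun o e * P.circuitFun o g) := by
      intro P
      have h := P.isPaintingFun
      rw [← P.cocircuitFun_apply, ← P.cocircuitFun_apply, zmod_three_mul_of_add
        (h.add_eq_zero ho b.2 heg' hob) ((h.circuit_ne_zero _ ho _).2 heo)
        ((h.cocircuit_ne_zero _ b.2 _).2 e.2) ((h.circuit_ne_zero _ ho _).2 hgo)
        ((h.cocircuit_ne_zero _ b.2 _).2 g.2), neg_neg]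
    rw [key P, key Q, neg_mul_neg, hx o ho e heo g hgo]
  have hsol : ∀ p q y p₀ q₀ y₀ : ZMod 3, p ≠ 0 → q ≠ 0 → y ≠ 0 → p₀ ≠ 0 → q₀ ≠ 0 → y₀ ≠ 0 →
      p * p₀ * (q * q₀) = y * y₀ → q = p₀ * q₀ * y₀ * y * p ∧ q = p₀ * q₀ * y₀ * p / y := by
    intro p q y p₀ q₀ y₀ h1 h2 h3 h4 h5 h6 h
    have a1 := zmod_three_mul_self h1
    have a2 := zmod_three_mul_self h2
    have a3 := zmod_three_mul_self h3
    have a4 := zmod_three_mul_self h4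
    have a5 := zmod_three_mul_self h5
    have a6 := zmod_three_mul_self h6
    have h7 : q = p₀ * q₀ * y₀ * y * p := by
      linear_combination p * p₀ * q₀ * h - q * (a1 + p * p * a4 + p * p * p₀ * p₀ * a5)
    refine ⟨h7, ?_⟩
    rw [eq_div_iff h3]
    linear_combination y * h7 + p₀ * q₀ * y₀ * p * a3
  -- An arbitrary reference edge on each circuit and cocircuit determines its scalar.
  let eo : ∀ o : {o : Set E // M.IsCircuit o}, o.1 := fun o ↦ ⟨_, o.2.nonempty.some_mem⟩
  let eb : ∀ b : {b : Set E // M.IsCocircuit b}, b.1 := fun b ↦ ⟨_, b.2.nonempty.some_mem⟩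
  refine ⟨fun o ↦ P.c o (eo o) * Q.c o (eo o) * Units.mk0 (x (eo o)) (hx0 _),
    fun b ↦ P.d b (eb b) * Q.d b (eb b) * Units.mk0 (x (eb b)) (hx0 _),
    fun e ↦ Units.mk0 (x e) (hx0 e), RingEquiv.refl _, fun o e ↦ ?_, fun b e ↦ ?_⟩
  · simpa using (hsol _ _ _ _ _ _ (P.c o e).ne_zero (Q.c o e).ne_zero (hx0 e)
      (P.c o (eo o)).ne_zero (Q.c o (eo o)).ne_zero (hx0 (eo o)) (hc o e (eo o))).1
  · simpa using (hsol _ _ _ _ _ _ (P.d b e).ne_zero (Q.d b e).ne_zero (hx0 e)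
      (P.d b (eb b)).ne_zero (Q.d b (eb b)).ne_zero (hx0 (eb b)) (hd b e (eb b))).2

end Painting

end Matroid


/-! ### Cuts, balanced edge sets and a criterion for signings -/

namespace Graph

variable {V E : Type*} {G : Graph V E} {A : Set E} {K : Set V} {e : E} {u v w x y : V}

/-- The edges of `G` with exactly one end in `K`. -/
def cut (G : Graph V E) (K : Set V) : Set E := {e | ∃ x y, G.IsLink e x y ∧ x ∈ K ∧ y ∉ K}

lemma IsLink.mem_cut_iff (h : G.IsLink e x y) : e ∈ G.cut K ↔ ¬ (x ∈ K ↔ y ∈ K) := by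
  constructor
  · rintro ⟨x', y', h', hx, hy⟩
    rcases h.eq_and_eq_or_eq_and_eq h' with ⟨rfl, rfl⟩ | ⟨rfl, rfl⟩ <;> tauto
  · intro hne
    by_cases hx : x ∈ K
    · exact ⟨x, y, h, hx, by tauto⟩
    · exact ⟨y, x, h.symm, by tauto, hx⟩

lemma IsLink.mem_iff_of_notMem_cut (h : G.IsLink e x y) (he : e ∉ G.cut K) : x ∈ K ↔ y ∈ K := by
  rw [h.mem_cut_iff] at he; tauto

lemma isLink_src_tgt (e : G.edgeSet) : G.IsLink e (G.src e) (G.tgt e) :=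
  (G.exists_isLink_of_mem_edgeSet e.2).choose_spec.choose_spec

open Classical in
/-- The sign of an edge of the cut of `K`: positive if the edge starts in `K`. -/
noncomputable def cutUnit (G : Graph V E) (K : Set V) (e : E) : ℤˣ :=
  if ∃ h : e ∈ G.edgeSet, G.src ⟨e, h⟩ ∈ K then 1 else -1

open Classical in
/-- The signed characteristic function of the cut of `K`. -/
noncomputable def cutSign (G : Graph V E) (K : Set V) (e : E) : ℤ :=
  if e ∈ G.cut K then G.cutUnit K e else 0

open Classical in
/-- The sign with which the edge `e` is traversed when starting from `x`. -/
noncomputable def traverseSign (G : Graph V E) (e : E) (x : V) : ℤˣ :=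
  if ∃ h : e ∈ G.edgeSet, G.src ⟨e, h⟩ = x then 1 else -1

lemma cutSign_of_mem (h : e ∈ G.cut K) : G.cutSign K e = G.cutUnit K e := if_pos h

lemma cutSign_of_notMem (h : e ∉ G.cut K) : G.cutSign K e = 0 := if_neg h

-- The reference orientation by `src` and `tgt` enters both factors and cancels. The difference on
-- the right makes sums along cycles, double rays and circles telescope.
open Classical in
lemma IsLink.traverseSign_mul_cutSign (h : G.IsLink e x y) :
    (G.traverseSign e x : ℤ) * G.cutSign K e =
      K.indicator (fun _ ↦ (1 : ℤ)) x - K.indicator (fun _ ↦ (1 : ℤ)) y := by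
  by_cases hc : e ∈ G.cut K
  · rw [cutSign_of_mem hc]
    have hne := h.mem_cut_iff.1 hc
    have hl := isLink_src_tgt ⟨e, h.edge_mem⟩
    rcases h.eq_and_eq_or_eq_and_eq hl with ⟨h1, h2⟩ | ⟨h1, h2⟩
    · have : G.traverseSign e x = 1 := if_pos ⟨h.edge_mem, h1.symm⟩
      by_cases hx : x ∈ K
      · have h4 : G.cutUnit K e = 1 := if_pos ⟨h.edge_mem, h1 ▸ hx⟩
        have hy : y ∉ K := by tauto
        simp [this, h4, hx, hy]
      · have h4 : G.cutUnit K e = -1 := if_neg fun ⟨_, h'⟩ ↦ hx (h1 ▸ h')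
        have hy : y ∈ K := by tauto
        simp [this, h4, hx, hy]
    · have hxy : x ≠ y := by rintro rfl; exact hne Iff.rfl
      have : G.traverseSign e x = -1 := if_neg fun ⟨_, h'⟩ ↦ hxy (h'.symm.trans h2.symm)
      by_cases hx : x ∈ K
      · have hy : y ∉ K := by tauto
        have h4 : G.cutUnit K e = -1 := if_neg fun ⟨_, h'⟩ ↦ hy (h2 ▸ h')
        simp [this, h4, hx, hy]
      · have hy : y ∈ K := by tauto
        have h4 : G.cutUnit K e = 1 := if_pos ⟨h.edge_mem, h2 ▸ hy⟩
        simp [this, h4, hx, hy]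
  · rw [cutSign_of_notMem hc]
    have := h.mem_iff_of_notMem_cut hc
    by_cases hx : x ∈ K
    · simp [hx, this.1 hx]
    · simp [hx, mt this.2 hx]

/-- A set `o` of edges with orientations is balanced with respect to `K` if it meets the cut of `K`
in finitely many edges, whose signs sum to zero. -/
def Balanced (G : Graph V E) (o : Set E) (c : E → ℤˣ) (K : Set V) : Prop :=
  (o ∩ G.cut K).Finite ∧ ∑ᶠ e ∈ o, (c e : ℤ) * G.cutSign K e = 0

-- With a single common edge, the balancing sum would consist of one unit.
open Classical in
lemma Balanced.inter_ne_singleton {o : Set E} {c : E → ℤˣ} (h : G.Balanced o c K) (e : E) :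
    o ∩ G.cut K ≠ {e} := by
  intro he
  have heo : e ∈ o ∩ G.cut K := he ▸ rfl
  have h0 := h.2
  have : ∑ᶠ e ∈ o, (c e : ℤ) * G.cutSign K e = c e * G.cutSign K e := by
    rw [finsum_eq_single _ e, finsum_eq_if, if_pos heo.1]
    intro f hf
    rw [finsum_eq_if]
    split_ifs with hfo
    · rw [cutSign_of_notMem, mul_zero]
      intro hfc
      have : f ∈ o ∩ G.cut K := ⟨hfo, hfc⟩
      rw [he] at this
      exact hf this
    · rfl
  rw [this, cutSign_of_mem heo.2, ← Units.val_mul] at h0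
  exact Units.ne_zero _ h0

end Graph

namespace Matroid

variable {V E : Type*}

/-- A proper subset of a cocircuit is coindependent, so by duality some circuit meets it in exactly
one prescribed element. -/
lemma IsCocircuit.eq_of_subset_of_forall_inter_ne {M : Matroid E} {b b' : Set E}
    (hb : M.IsCocircuit b) (hsub : b' ⊆ b) (hne : b'.Nonempty)
    (h : ∀ o, M.IsCircuit o → ∀ e, o ∩ b' ≠ {e}) : b' = b := by
  by_contra hbb
  obtain ⟨e, he⟩ := hne
  obtain ⟨o, ho, hoe⟩ := (hb.isCircuit.ssubset_indep
    (hsub.ssubset_of_ne hbb)).exists_isCocircuit_inter_eq_mem he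
  exact h o (dual_isCocircuit_iff.1 ho) e hoe

/-- A matroid on the edges of a graph has a signing if there is a family of vertex sets such that
every cocircuit contains the cut of one of them, and such that every circuit can be oriented to be
balanced with respect to all of them. -/
theorem nonempty_signing_of_balanced {M : Matroid E} (G : Graph V E) (S : Set (Set V))
    (hcoc : ∀ b, M.IsCocircuit b → ∃ K ∈ S, (G.cut K).Nonempty ∧ G.cut K ⊆ b)
    (hcir : ∀ o, M.IsCircuit o → ∃ c : E → ℤˣ, ∀ K ∈ S, G.Balanced o c K) :
    Nonempty (Signing M) := by
  choose! c hc using hcir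
  -- Balanced circuits never meet a cut in one edge, so the nonempty cut found inside b is all of b.
  have hcoc' : ∀ b, ∃ K, M.IsCocircuit b → K ∈ S ∧ G.cut K = b := by
    intro b
    by_cases hb : M.IsCocircuit b
    · obtain ⟨K, hK, hne, hsub⟩ := hcoc b hb
      exact ⟨K, fun _ ↦ ⟨hK, hb.eq_of_subset_of_forall_inter_ne hsub hne fun o ho ↦
        (hc o ho K hK).inter_ne_singleton⟩⟩
    · exact ⟨∅, fun h ↦ absurd h hb⟩
  choose κ hκ using hcoc'
  refine ⟨⟨fun o e ↦ c o.1 e, fun b e ↦ G.cutUnit (κ b.1) e, fun o b ↦ ?_, fun o b ↦ ?_⟩⟩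
  · have := (hc o.1 o.2 _ (hκ b.1 b.2).1).1
    rw [(hκ b.1 b.2).2] at this
    have := Set.finite_coe_iff.2 this
    exact Set.toFinite _
  · have := (hc o.1 o.2 _ (hκ b.1 b.2).1).2
    rw [← this, finsum_set_coe_eq_finsum_mem (s := o.1 ∩ b.1)
      (f := fun e ↦ (c o.1 e : ℤ) * (G.cutUnit (κ b.1) e : ℤ)), finsum_mem_def, finsum_mem_def]
    refine finsum_congr fun e ↦ ?_
    by_cases heo : e ∈ o.1
    · by_cases heb : e ∈ b.1
      · rw [Set.indicator_of_mem (show e ∈ o.1 ∩ b.1 from ⟨heo, heb⟩), Set.indicator_of_mem heo, Graph.cutSign_of_mem]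
        rwa [(hκ b.1 b.2).2]
      · rw [Set.indicator_of_notMem fun h ↦ heb h.2, Set.indicator_of_mem heo,
          Graph.cutSign_of_notMem, mul_zero]
        rwa [(hκ b.1 b.2).2]
    · rw [Set.indicator_of_notMem fun h ↦ heo h.1, Set.indicator_of_notMem heo]

/-- Circuits and cocircuits play symmetric roles in a signing. -/
lemma nonempty_signing_dual {M : Matroid E} (h : Nonempty (Signing M)) :
    Nonempty (Signing M✶) := by
  obtain ⟨P⟩ := h
  refine ⟨⟨fun o e ↦ P.d ⟨o.1, o.2⟩ e, fun b e ↦ P.c ⟨b.1, by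
    have := b.2; rwa [dual_isCocircuit_iff] at this⟩ e, fun o b ↦ ?_, fun o b ↦ ?_⟩⟩
  · have hb : M.IsCircuit b.1 := by have := b.2; rwa [dual_isCocircuit_iff] at this
    have := P.finite_support ⟨b.1, hb⟩ ⟨o.1, o.2⟩
    refine (this.image fun e ↦ (⟨e.1, e.2.2, e.2.1⟩ : ↥(o.1 ∩ b.1))).subset ?_
    intro e he
    refine ⟨⟨e.1, e.2.2, e.2.1⟩, ?_, rfl⟩
    simp
  · have hb : M.IsCircuit b.1 := by have := b.2; rwa [dual_isCocircuit_iff] at this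
    rw [← P.sum_eq_zero ⟨b.1, hb⟩ ⟨o.1, o.2⟩]
    refine finsum_eq_of_bijective (fun e : ↥(o.1 ∩ b.1) ↦ (⟨e.1, e.2.2, e.2.1⟩ : ↥(b.1 ∩ o.1)))
      ⟨fun a b h ↦ by simpa [Subtype.ext_iff] using h,
        fun e ↦ ⟨⟨e.1, e.2.2, e.2.1⟩, rfl⟩⟩ fun e ↦ ?_
    rw [mul_comm]

lemma signing_equivalent {M : Matroid E} (P Q : Signing M) : Signing.Equivalent P Q :=
  Painting.equivalent_zmod_three _ _

lemma hasUniqueSigning_and_dual {M : Matroid E} (h : Nonempty (Signing M)) :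
    M.HasUniqueSigning ∧ M✶.HasUniqueSigning :=
  ⟨⟨h, signing_equivalent⟩, ⟨nonempty_signing_dual h, signing_equivalent⟩⟩

end Matroid

/-! ### Finite cycles and the finite cycle matroid -/

namespace Graph

variable {V E : Type*} {G : Graph V E} {A : Set E} {K : Set V} {e : E} {u v w x y : V}

/-- Orient the edges in cyclic order; the two sums of indicators differ by the shift of `ZMod n` by
one. -/
lemma IsFiniteCycle.exists_balanced {C : Set E} (h : G.IsFiniteCycle C) :
    ∃ c : E → ℤˣ, ∀ K, G.Balanced C c K := by
  classical
  obtain ⟨n, hn, v, e, hv, he, hl, rfl⟩ := h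
  have : NeZero n := ⟨hn⟩
  let c : E → ℤˣ := fun f ↦ if h : ∃ i, e i = f then G.traverseSign f (v h.choose) else 1
  have hc : ∀ i, c (e i) = G.traverseSign (e i) (v i) := by
    intro i
    have h : ∃ j, e j = e i := ⟨i, rfl⟩
    have hch : h.choose = i := he h.choose_spec
    simp only [c, dif_pos h, hch]
  refine ⟨c, fun K ↦ ⟨(Set.finite_range e).inter_of_left _, ?_⟩⟩
  rw [finsum_mem_range he, finsum_eq_sum_of_fintype]
  simp_rw [hc, (hl _).traverseSign_mul_cutSign]
  rw [Finset.sum_sub_distrib, sub_eq_zero]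
  exact (Equiv.sum_comp (Equiv.addRight (1 : ZMod n)) fun i ↦ K.indicator (fun _ ↦ (1 : ℤ)) (v i)).symm

/-- Two vertices are joined in `A` if there is a walk between them whose edges lie in `A`. -/
def Joined (G : Graph V E) (A : Set E) (u v : V) : Prop :=
  Relation.ReflTransGen (fun x y ↦ ∃ f ∈ A, G.IsLink f x y) u v

lemma Joined.refl (G : Graph V E) (A : Set E) (u : V) : G.Joined A u u :=
  Relation.ReflTransGen.refl

lemma Joined.trans (h : G.Joined A u v) (h' : G.Joined A v w) : G.Joined A u w :=
  Relation.ReflTransGen.trans h h'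

lemma Joined.symm (h : G.Joined A u v) : G.Joined A v u := by
  induction h with
  | refl => exact Relation.ReflTransGen.refl
  | tail _ h ih =>
    obtain ⟨f, hf, hl⟩ := h
    exact Relation.ReflTransGen.head ⟨f, hf, hl.symm⟩ ih

lemma IsLink.joined (h : G.IsLink e x y) (he : e ∈ A) : G.Joined A x y :=
  .single ⟨e, he, h⟩

lemma Joined.mono {A' : Set E} (h : G.Joined A u v) (hA : A ⊆ A') : G.Joined A' u v :=
  Relation.ReflTransGen.mono (fun _ _ ⟨f, hf, hl⟩ ↦ ⟨f, hA hf, hl⟩) _ _ h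

lemma Joined.mem_iff (h : G.Joined A u v) (hA : Disjoint A (G.cut K)) : u ∈ K ↔ v ∈ K := by
  induction h with
  | refl => rfl
  | tail _ h ih =>
    obtain ⟨f, hf, hl⟩ := h
    rw [ih, hl.mem_iff_of_notMem_cut (Set.disjoint_left.1 hA hf)]

/-- The vertices joined to `u` in `A`. -/
def componentIn (G : Graph V E) (A : Set E) (u : V) : Set V := {v | G.Joined A u v}

lemma disjoint_cut_componentIn (G : Graph V E) (A : Set E) (u : V) :
    Disjoint A (G.cut (G.componentIn A u)) := by
  rw [Set.disjoint_left]
  rintro f hf ⟨x, y, hl, hx, hy⟩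
  exact hy (hx.trans (hl.joined hf))

/-- Vertices which are joined in `A` are joined by a path in `A`. -/
lemma Joined.exists_path [Nonempty E] (h : G.Joined A u w) :
    ∃ (n : ℕ) (v : ℕ → V) (f : ℕ → E), v 0 = u ∧ v n = w ∧ Set.InjOn v (Set.Iic n) ∧
      ∀ i < n, f i ∈ A ∧ G.IsLink (f i) (v i) (v (i + 1)) := by
  classical
  let H : SimpleGraph V := SimpleGraph.fromRel fun x y ↦ ∃ f ∈ A, G.IsLink f x y
  have hH : H.Reachable u w := by
    induction h with
    | refl => rfl
    | @tail b c _ h ih =>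
      rcases eq_or_ne b c with rfl | hne
      · exact ih
      · exact ih.trans (SimpleGraph.Adj.reachable
          ((SimpleGraph.fromRel_adj _ _ _).2 ⟨hne, Or.inl h⟩))
  obtain ⟨p, hp⟩ := hH.exists_isPath
  have hadj : ∀ i, ∃ f, i < p.length → f ∈ A ∧ G.IsLink f (p.getVert i) (p.getVert (i + 1)) := by
    intro i
    by_cases hi : i < p.length
    · have := p.adj_getVert_succ hi
      rw [SimpleGraph.fromRel_adj] at this
      rcases this.2 with ⟨f, hf, hl⟩ | ⟨f, hf, hl⟩
      · exact ⟨f, fun _ ↦ ⟨hf, hl⟩⟩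
      · exact ⟨f, fun _ ↦ ⟨hf, hl.symm⟩⟩
    · obtain ⟨f⟩ := ‹Nonempty E›
      exact ⟨f, fun h ↦ absurd h hi⟩
  choose f hf using hadj
  refine ⟨p.length, p.getVert, f, p.getVert_zero, p.getVert_length, ?_, hf⟩
  exact hp.getVert_injOn

/-- An edge whose ends are joined in `A` lies in a finite cycle whose other edges are in `A`. -/
lemma IsLink.exists_isFiniteCycle (he : G.IsLink e u w) (heA : e ∉ A) (h : G.Joined A u w) :
    ∃ o, G.IsFiniteCycle o ∧ e ∈ o ∧ o ⊆ insert e A := by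
  classical
  have : Nonempty E := ⟨e⟩
  obtain ⟨n, v, f, rfl, rfl, hv, hf⟩ := h.exists_path
  -- The last index closes the path by e. For n = 0 the edge e is a loop and forms the cycle alone.
  let g : Fin (n + 1) → E := fun i ↦ if i.1 < n then f i.1 else e
  have hgl : ∀ i : Fin (n + 1), G.IsLink (g i) (v i.1) (v (i + 1 : Fin (n + 1)).1) := by
    intro i
    rw [Fin.val_add_one]
    by_cases hi : i = Fin.last n
    · subst hi
      simpa [g] using he.symm
    · have : i.1 < n := Fin.val_lt_last hi
      simpa [g, hi, this] using (hf i.1 this).2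
  have hsub : ∀ i, g i ∈ insert e A := by
    intro i
    by_cases hi : i.1 < n
    · simpa [g, hi] using Or.inr (hf i.1 hi).1
    · simp [g, hi]
  refine ⟨Set.range g, ⟨n + 1, by omega, fun i : Fin (n + 1) ↦ v i.1, g, ?_, ?_, hgl, rfl⟩, ?_, ?_⟩
  · intro i j hij
    exact Fin.ext (hv (Nat.lt_succ_iff.1 i.2) (Nat.lt_succ_iff.1 j.2) hij)
  · have hlt : ∀ i j : Fin (n + 1), i.1 < j.1 → g i ≠ g j := by
      intro i j hij hg
      have hi : i.1 < n := by have := j.2; omega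
      by_cases hj : j.1 < n
      · simp only [g, hi, hj, if_true] at hg
        have h1 := (hf _ hi).2
        have h2 := (hf _ hj).2
        rw [hg] at h1
        rcases h1.left_eq_or_eq h2 with h3 | h3
        · have := hv (by simp; omega) (by simp; omega) h3
          omega
        · have := hv (by simp; omega) (by simp; omega) h3
          omega
      · simp only [g, hi, hj, if_true, if_false] at hg
        exact heA (hg ▸ (hf _ hi).1)
    intro i j hij
    rcases lt_trichotomy i.1 j.1 with h | h | h
    · exact absurd hij (hlt i j h)
    · exact Fin.ext h
    · exact absurd hij.symm (hlt j i h)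
  · exact ⟨Fin.last n, by simp [g]⟩
  · rintro _ ⟨i, rfl⟩
    exact hsub i

end Graph

namespace Matroid

variable {V E : Type*} {M : Matroid E} {G : Graph V E}

/-- If all finite cycles are dependent, then the complement of a cocircuit does not join the ends
of an edge of this cocircuit. -/
lemma IsCocircuit.not_joined {b : Set E} (hb : M.IsCocircuit b)
    (hG : ∀ C, G.IsFiniteCycle C → M.IsCircuit C) {e : E} {u w : V} (he : e ∈ b)
    (hl : G.IsLink e u w) : ¬ G.Joined bᶜ u w := by
  intro hj
  obtain ⟨o, ho, heo, hoA⟩ := hl.exists_isFiniteCycle (by simpa using he) hj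
  refine (hG o ho).inter_isCocircuit_ne_singleton hb (e := e) ?_
  refine Set.Subset.antisymm ?_ (by simpa using ⟨heo, he⟩)
  rintro f ⟨hfo, hfb⟩
  exact (hoA hfo).resolve_right fun h ↦ h hfb

/-- For an edge e of the cocircuit b, the component of one end of e in the complement of b misses
the other end. Its cut contains e and lies in b. -/
lemma IsFiniteCycleMatroid.nonempty_signing (h : M.IsFiniteCycleMatroid G) :
    Nonempty (Signing M) := by
  refine nonempty_signing_of_balanced G Set.univ (fun b hb ↦ ?_) fun o ho ↦ ?_
  · obtain ⟨e, he⟩ := hb.nonempty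
    have heE : e ∈ G.edgeSet := h.1 ▸ hb.subset_ground he
    obtain ⟨u, w, hl⟩ := G.exists_isLink_of_mem_edgeSet heE
    have hn := hb.not_joined (fun C hC ↦ (h.2 C).2 hC) he hl
    refine ⟨G.componentIn bᶜ u, trivial, ⟨e, u, w, hl, Graph.Joined.refl _ _ _, hn⟩, fun f hf ↦ ?_⟩
    by_contra hfb
    exact Set.disjoint_left.1 (G.disjoint_cut_componentIn bᶜ u) hfb hf
  · obtain ⟨c, hc⟩ := ((h.2 o).1 ho).exists_balanced
    exact ⟨c, fun K _ ↦ hc K⟩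

end Matroid


/-! ### Realising a countable linear order by intervals -/

/-- A countable linear order can be realised by the order of disjoint open intervals which cover an
interval of the real line up to a set without inner points. -/
theorem exists_interval_arrangement (I : Type*) [LinearOrder I] [Countable I] :
    ∃ (a l : I → ℝ) (T : ℝ), (∀ i, 0 < l i) ∧ (∀ i j, i < j → a i + l i ≤ a j) ∧ (∀ i, 0 ≤ a i) ∧
      (∀ i, a i + l i ≤ T) ∧ ∀ t t', 0 ≤ t → t < t' → t' ≤ T →
        (∀ i, ¬ (a i < t ∧ t < a i + l i)) → (∀ i, ¬ (a i < t' ∧ t' < a i + l i)) →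
        ∃ i, t ≤ a i ∧ a i + l i ≤ t' := by
  classical
  have := Encodable.ofCountable I
  obtain ⟨l, hl0, S, hsum, -⟩ := posSumOfEncodable one_pos I
  -- The total length of the intervals with indices in a set; the ith interval is going to start at
  -- μ (Set.Iio i).
  let μ : Set I → ℝ := fun A ↦ ∑' i, A.indicator l i
  have hs : ∀ A : Set I, Summable (A.indicator l) := fun A ↦ hsum.summable.indicator A
  have hadd : ∀ A B : Set I, Disjoint A B → μ (A ∪ B) = μ A + μ B := by
    intro A B h
    simp only [μ]
    rw [← (hs A).tsum_add (hs B)]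
    refine tsum_congr fun i ↦ ?_
    rw [Set.indicator_union_of_disjoint h]
  have hmono : ∀ A B : Set I, A ⊆ B → μ A ≤ μ B := fun A B h ↦
    (hs A).tsum_le_tsum (fun i ↦ Set.indicator_le_indicator_of_subset h (fun i ↦ (hl0 i).le) i) (hs B)
  have hsing : ∀ i, μ {i} = l i := by
    intro i
    simp only [μ]
    rw [tsum_eq_single i]
    · simp
    · intro j hj; simp [hj]
  have hnn : ∀ A : Set I, 0 ≤ μ A := fun A ↦
    tsum_nonneg fun i ↦ Set.indicator_nonneg (fun i _ ↦ (hl0 i).le) i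
  have hfin : ∀ (A : Set I) (C : ℝ), 0 ≤ C →
      (∀ s : Finset I, s.Nonempty → (s : Set I) ⊆ A → μ s ≤ C) → μ A ≤ C := by
    intro A C hC h
    refine (hs A).tsum_le_of_sum_le fun s ↦ ?_
    rcases (s.filter (· ∈ A)).eq_empty_or_nonempty with h0 | h0
    · rw [Finset.sum_eq_zero]
      · exact hC
      · intro i hi
        refine Set.indicator_of_notMem (fun hiA ↦ ?_) _
        have : i ∈ s.filter (· ∈ A) := Finset.mem_filter.2 ⟨hi, hiA⟩
        simp [h0] at this
    · refine le_trans ?_ (h _ h0 fun i hi ↦ (Finset.mem_filter.1 hi).2)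
      refine le_trans (le_of_eq ?_) ((hs _).sum_le_tsum s
        fun i _ ↦ Set.indicator_nonneg (fun i _ ↦ (hl0 i).le) i)
      refine Finset.sum_congr rfl fun i hi ↦ ?_
      by_cases hiA : i ∈ A <;> simp [hi, hiA]
  have hIic : ∀ i, μ (Set.Iic i) = μ (Set.Iio i) + l i := by
    intro i
    rw [← hsing i, ← hadd _ _ (by simp), Set.Iio_union_right]
  have hIci : ∀ i, μ Set.univ = μ (Set.Iio i) + μ (Set.Ici i) := by
    intro i
    rw [← hadd _ _ (Set.disjoint_left.2 fun j h1 h2 ↦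
      not_lt_of_ge (Set.mem_Ici.1 h2) (Set.mem_Iio.1 h1)), Set.Iio_union_Ici]
  -- A point in no interval equals the total length of the intervals to its left. A finite set of
  -- intervals on the left has a greatest one, whose right end bounds their total length; a finite
  -- set on the right has a least one, which bounds theirs. So neither total is too large, and
  -- together they are μ Set.univ.
  have key : ∀ t, 0 ≤ t → t ≤ μ Set.univ →
      (∀ i, ¬ (μ (Set.Iio i) < t ∧ t < μ (Set.Iio i) + l i)) →
      μ {i | μ (Set.Iio i) + l i ≤ t} = t := by
    intro t h0 hT ht
    have h1 : μ {i | μ (Set.Iio i) + l i ≤ t} ≤ t := by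
      refine hfin _ _ h0 fun s hsn hss ↦ ?_
      have hm := hss (s.max'_mem hsn)
      refine le_trans (hmono _ _ fun i hi ↦ ?_) ((hIic _).trans_le hm)
      exact s.le_max' i hi
    have h2 : μ {i | μ (Set.Iio i) + l i ≤ t}ᶜ ≤ μ Set.univ - t := by
      refine hfin _ _ (by linarith) fun s hsn hss ↦ ?_
      have hm := hss (s.min'_mem hsn)
      have h3 : t ≤ μ (Set.Iio (s.min' hsn)) := by
        by_contra! h4
        exact ht _ ⟨h4, not_le.1 hm⟩
      have h5 := hIci (s.min' hsn)
      have h6 : μ s ≤ μ (Set.Ici (s.min' hsn)) := hmono _ _ fun i hi ↦ s.min'_le i hi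
      linarith
    have h3 := hadd {i | μ (Set.Iio i) + l i ≤ t} _ disjoint_compl_right
    rw [Set.union_compl_self] at h3
    linarith
  refine ⟨fun i ↦ μ (Set.Iio i), l, μ Set.univ, hl0, fun i j hij ↦ ?_, fun i ↦ hnn _, fun i ↦ ?_,
    fun t t' h0 htt hT ht ht' ↦ ?_⟩
  · rw [← hIic]
    exact hmono _ _ fun k hk ↦ lt_of_le_of_lt hk hij
  · rw [← hIic]
    exact hmono _ _ (Set.subset_univ _)
  -- If no interval fits between t and t', the same intervals lie to the left of both, and `key`
  -- gives t = t'.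
  · by_contra! hno
    have h1 := key t h0 (by linarith) ht
    have h2 := key t' (by linarith) hT ht'
    have : {i | μ (Set.Iio i) + l i ≤ t} = {i | μ (Set.Iio i) + l i ≤ t'} := by
      ext i
      simp only [Set.mem_ofPred_eq]
      refine ⟨fun h ↦ h.trans htt.le, fun h ↦ ?_⟩
      by_contra! h3
      have h4 : t ≤ μ (Set.Iio i) := by
        by_contra! h4
        exact ht i ⟨h4, h3⟩
      exact absurd h (not_le.2 (hno i h4))
    rw [this, h2] at h1
    exact htt.ne' h1


/-! ### Directions, the end space and circular orders of edges -/

namespace Graph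

variable {V E : Type*} {G : Graph V E}

lemma mem_componentAvoiding_iff {F : Finset E} {u v : V} :
    v ∈ G.componentAvoiding F u ↔ G.Joined (F : Set E)ᶜ u v := by
  have : (G.deleteEdges (F : Set E)).Adj = fun x y ↦ ∃ f ∈ (F : Set E)ᶜ, G.IsLink f x y := by
    ext x y
    simp [Graph.Adj, and_comm]
  rw [componentAvoiding, Joined, this]
  rfl

lemma mem_componentAvoiding_self (F : Finset E) (u : V) : u ∈ G.componentAvoiding F u :=
  mem_componentAvoiding_iff.2 (Joined.refl _ _ _)

lemma componentAvoiding_eq_of_mem {F : Finset E} {u v : V} (h : v ∈ G.componentAvoiding F u) :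
    G.componentAvoiding F v = G.componentAvoiding F u := by
  rw [mem_componentAvoiding_iff] at h
  ext w
  rw [mem_componentAvoiding_iff, mem_componentAvoiding_iff]
  exact ⟨fun h' ↦ h.trans h', fun h' ↦ h.symm.trans h'⟩

lemma cut_componentAvoiding_subset (F : Finset E) (u : V) :
    G.cut (G.componentAvoiding F u) ⊆ F := by
  intro f hf
  by_contra hfF
  have := G.disjoint_cut_componentIn (F : Set E)ᶜ u
  have h : G.componentAvoiding F u = G.componentIn (F : Set E)ᶜ u := by
    ext v; rw [mem_componentAvoiding_iff]; rfl
  rw [h] at hf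
  exact Set.disjoint_left.1 this hfF hf

lemma componentAvoiding_anti {F F' : Finset E} (h : F ⊆ F') (u : V) :
    G.componentAvoiding F' u ⊆ G.componentAvoiding F u := by
  intro v hv
  rw [mem_componentAvoiding_iff] at hv ⊢
  exact hv.mono (Set.compl_subset_compl.2 (Finset.coe_subset.2 h))

/-- A component of `G - F` lies on one side of each cut contained in `F`. -/
lemma mem_iff_of_mem_componentAvoiding {F : Finset E} {K : Set V} (hK : G.cut K ⊆ F) {u v : V}
    (h : v ∈ G.componentAvoiding F u) : u ∈ K ↔ v ∈ K := by
  rw [mem_componentAvoiding_iff] at h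
  exact h.mem_iff (Set.disjoint_left.2 fun f hf hf' ↦ hf (hK hf'))

lemma EdgeDirection.ext_comp {d d' : G.EdgeDirection} (h : ∀ F, d.comp F = d'.comp F) : d = d' := by
  cases d; cases d'
  congr
  exact funext h

lemma EdgeDirection.cut_comp_subset (d : G.EdgeDirection) (F : Finset E) :
    G.cut (d.comp F) ⊆ F := by
  obtain ⟨v, -, hv⟩ := d.exists_eq_comp F
  rw [hv]
  exact cut_componentAvoiding_subset F v

lemma EdgeDirection.comp_eq_of_mem_of_mem (d d' : G.EdgeDirection) {F : Finset E} {v : V}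
    (h : v ∈ d.comp F) (h' : v ∈ d'.comp F) : d.comp F = d'.comp F := by
  obtain ⟨x, -, hx⟩ := d.exists_eq_comp F
  obtain ⟨y, -, hy⟩ := d'.exists_eq_comp F
  rw [hx] at h
  rw [hy] at h'
  rw [hx, hy, ← componentAvoiding_eq_of_mem h, ← componentAvoiding_eq_of_mem h']

namespace EndSpace

lemma isOpen_basicNhd (d : G.EdgeDirection) (F : Finset E) {ε : ℝ} (hε : 0 < ε) :
    IsOpen (basicNhd F (d.comp F) ε : Set (EndSpace G)) :=
  TopologicalSpace.isOpen_generateFrom_of_mem (Or.inl ⟨d, F, ε, hε, rfl⟩)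

lemma isOpen_inner_image (e : G.edgeSet) {I : Set (Set.Ioo (0 : ℝ) 1)} (hI : IsOpen I) :
    IsOpen (inner e '' I : Set (EndSpace G)) :=
  TopologicalSpace.isOpen_generateFrom_of_mem (Or.inr ⟨e, I, hI, rfl⟩)

lemma dir_mem_basicNhd {d : G.EdgeDirection} {F : Finset E} {K : Set V} {ε : ℝ} :
    (dir d : EndSpace G) ∈ basicNhd F K ε ↔ d.comp F = K := Iff.rfl

lemma inner_mem_basicNhd {e : G.edgeSet} {t : Set.Ioo (0 : ℝ) 1} {F : Finset E} {K : Set V} {ε : ℝ} :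
    (inner e t : EndSpace G) ∈ basicNhd F K ε ↔
      (G.src e ∈ K ∧ ((e : E) ∈ F → (t : ℝ) < ε)) ∨
        (G.tgt e ∈ K ∧ ((e : E) ∈ F → 1 - ε < (t : ℝ))) := Iff.rfl

lemma exists_separating_dir_inner (d : G.EdgeDirection) (e : G.edgeSet) (t : Set.Ioo (0 : ℝ) 1) :
    ∃ U W : Set (EndSpace G), IsOpen U ∧ IsOpen W ∧ dir d ∈ U ∧ inner e t ∈ W ∧ Disjoint U W := by
  obtain ⟨ht0, ht1⟩ := t.2
  let ε : ℝ := min (t : ℝ) (1 - t) / 2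
  have hε : 0 < ε := by
    have : 0 < min (t : ℝ) (1 - t) := lt_min ht0 (by linarith)
    simp only [ε]; linarith
  have h1 : 2 * ε ≤ t := by
    have := min_le_left (t : ℝ) (1 - t)
    simp only [ε]; linarith
  have h2 : 2 * ε ≤ 1 - t := by
    have := min_le_right (t : ℝ) (1 - t)
    simp only [ε]; linarith
  refine ⟨basicNhd {(e : E)} (d.comp {(e : E)}) ε, inner e '' {s | ε < (s : ℝ) ∧ (s : ℝ) < 1 - ε},
    isOpen_basicNhd d _ hε, isOpen_inner_image e ?_, rfl, ⟨t, ⟨by linarith, by linarith⟩, rfl⟩, ?_⟩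
  · exact (isOpen_lt continuous_const continuous_subtype_val).inter
      (isOpen_lt continuous_subtype_val continuous_const)
  · rw [Set.disjoint_right]
    rintro _ ⟨s, ⟨hs1, hs2⟩, rfl⟩ hmem
    rw [inner_mem_basicNhd] at hmem
    rcases hmem with ⟨-, h⟩ | ⟨-, h⟩
    · have := h (by simp); linarith
    · have := h (by simp); linarith

/-- Distinct directions choose disjoint components for some finite F. Neighbourhoods with ε = 1 / 2
then contain opposite open halves of an edge of F between these components. -/
instance : T2Space (EndSpace G) := by
  refine ⟨fun p q hpq ↦ ?_⟩
  cases p with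
  | dir d =>
    cases q with
    | dir d' =>
      obtain ⟨F, hF⟩ : ∃ F, d.comp F ≠ d'.comp F := by
        by_contra! h
        exact hpq (congrArg dir (EdgeDirection.ext_comp h))
      refine ⟨basicNhd F (d.comp F) (1 / 2), basicNhd F (d'.comp F) (1 / 2),
        isOpen_basicNhd d F (by norm_num), isOpen_basicNhd d' F (by norm_num), rfl, rfl, ?_⟩
      rw [Set.disjoint_left]
      intro p hp hp'
      have hdisj : ∀ v, v ∈ d.comp F → v ∉ d'.comp F := fun v h h' ↦
        hF (d.comp_eq_of_mem_of_mem d' h h')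
      cases p with
      | dir d₁ =>
        rw [dir_mem_basicNhd] at hp hp'
        exact hF (hp.symm.trans hp')
      | inner e t =>
        rw [inner_mem_basicNhd] at hp hp'
        have hl := isLink_src_tgt e
        by_cases heF : (e : E) ∈ F
        · rcases hp with ⟨h1, h2⟩ | ⟨h1, h2⟩ <;> rcases hp' with ⟨h3, h4⟩ | ⟨h3, h4⟩
          · exact hdisj _ h1 h3
          · have := h2 heF; have := h4 heF; linarith
          · have := h2 heF; have := h4 heF; linarith
          · exact hdisj _ h1 h3
        · have h5 := hl.mem_iff_of_notMem_cut fun h ↦ heF (d.cut_comp_subset F h)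
          have h6 := hl.mem_iff_of_notMem_cut fun h ↦ heF (d'.cut_comp_subset F h)
          have := hdisj (G.src e)
          tauto
    | inner e t => exact exists_separating_dir_inner d e t
  | inner e t =>
    cases q with
    | dir d =>
      obtain ⟨U, W, hU, hW, h1, h2, h3⟩ := exists_separating_dir_inner d e t
      exact ⟨W, U, hW, hU, h2, h1, h3.symm⟩
    | inner e' t' =>
      rcases eq_or_ne e e' with rfl | hne
      · have htt : t ≠ t' := fun h ↦ hpq (by rw [h])
        obtain ⟨U, W, hU, hW, h1, h2, h3⟩ := t2_separation htt
        refine ⟨inner e '' U, inner e '' W, isOpen_inner_image e hU, isOpen_inner_image e hW,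
          ⟨t, h1, rfl⟩, ⟨t', h2, rfl⟩, ?_⟩
        exact Set.disjoint_image_of_injective (fun a b h ↦ by simpa using h) h3
      · refine ⟨inner e '' Set.univ, inner e' '' Set.univ, isOpen_inner_image e isOpen_univ,
          isOpen_inner_image e' isOpen_univ, ⟨t, trivial, rfl⟩, ⟨t', trivial, rfl⟩, ?_⟩
        rw [Set.disjoint_left]
        rintro _ ⟨s, -, rfl⟩ ⟨s', -, h⟩
        exact hne (by simp at h; exact h.1.symm)

end EndSpace

/-- The combinatorial data of a topological circle: the edges of the circle in a linear order,
with their end vertices in the order of traversal, and a start vertex. For a finite set of edges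
of the circle, the end of its last edge (or the start vertex) determines on which side of a cut the
circle is after traversing the edges of the set. -/
structure CircularOrder (G : Graph V E) (I : Type*) [LinearOrder I] where
  /-- the edges -/
  edge : I → E
  /-- the first end vertex -/
  fst : I → V
  /-- the second end vertex -/
  snd : I → V
  /-- the start vertex -/
  start : V
  edge_injective : Function.Injective edge
  isLink : ∀ i, G.IsLink (edge i) (fst i) (snd i)
  start_mem : start ∈ G.vertexSet

namespace CircularOrder

variable {I : Type*} [LinearOrder I] (Γ : G.CircularOrder I)

/-- The second end vertex of the last edge, or the start vertex. -/
noncomputable def last (Z : Finset I) : V :=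
  if h : Z.Nonempty then Γ.snd (Z.max' h) else Γ.start

open Classical in
/-- The edges in `F` at positions in `A`. -/
noncomputable def within (F : Finset E) (A : Set I) : Finset I :=
  (F.preimage Γ.edge Γ.edge_injective.injOn).filter (· ∈ A)

/-- The order is compatible with the cuts of the graph. -/
structure IsCompatible : Prop where
  -- Edges outside F do not cross the cut of K, so the start of edge i lies on the side which was
  -- reached by the last edge of F before i.
  fst_mem_iff : ∀ (F : Finset E) (K : Set V), G.cut K ⊆ F → ∀ i,
    Γ.fst i ∈ K ↔ Γ.last (Γ.within F (Set.Iio i)) ∈ K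
  start_mem_iff : ∀ (F : Finset E) (K : Set V), G.cut K ⊆ F →
    (Γ.start ∈ K ↔ Γ.last (Γ.within F Set.univ) ∈ K)
  -- A finite cut crossed by the circle at i and j only; this is what makes the parametrisation
  -- injective.
  exists_cut : ∀ i j, i < j → ∃ L, (G.cut L).Finite ∧ (∀ k, Γ.edge k ∈ G.cut L ↔ k = i ∨ k = j) ∧
    Γ.snd i ∈ L ∧ Γ.snd j ∉ L ∧ Γ.start ∉ L

variable {Γ}

lemma mem_within {F : Finset E} {A : Set I} {i : I} :
    i ∈ Γ.within F A ↔ Γ.edge i ∈ F ∧ i ∈ A := by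
  classical
  simp [within]

lemma last_of_empty {Z : Finset I} (h : Z = ∅) : Γ.last Z = Γ.start := by
  simp [last, h]

lemma last_of_isGreatest {Z : Finset I} {i : I} (h : IsGreatest (Z : Set I) i) :
    Γ.last Z = Γ.snd i := by
  have hne : Z.Nonempty := ⟨i, h.1⟩
  rw [last, dif_pos hne]
  congr 1
  exact le_antisymm (h.2 (Z.max'_mem hne)) (Z.le_max' i h.1)

lemma last_mem_vertexSet (Z : Finset I) : Γ.last Z ∈ G.vertexSet := by
  rw [last]
  split_ifs with h
  · exact (Γ.isLink _).right_mem
  · exact Γ.start_mem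

/-- The side of a cut does not change along edges outside this cut. -/
lemma IsCompatible.last_mem_iff_of_subset (hΓ : Γ.IsCompatible) {F F' : Finset E} (h : F ⊆ F')
    {K : Set V} (hK : G.cut K ⊆ F) {A : Set I} (hA : IsLowerSet A) :
    Γ.last (Γ.within F' A) ∈ K ↔ Γ.last (Γ.within F A) ∈ K := by
  have hsub : ∀ i, i ∈ Γ.within F A → i ∈ Γ.within F' A := fun i hi ↦ by
    rw [mem_within] at hi ⊢
    exact ⟨h hi.1, hi.2⟩
  rcases (Γ.within F' A).eq_empty_or_nonempty with h0 | h0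
  · have h1 : Γ.within F A = ∅ := Finset.eq_empty_of_forall_notMem fun i hi ↦ by
      have := hsub i hi
      simp [h0] at this
    rw [h0, h1]
  · have hm := (Γ.within F' A).max'_mem h0
    have hgr : IsGreatest (Γ.within F' A : Set I) ((Γ.within F' A).max' h0) :=
      (Γ.within F' A).isGreatest_max' h0
    generalize (Γ.within F' A).max' h0 = m at hm hgr
    rw [last_of_isGreatest hgr]
    by_cases hmF : Γ.edge m ∈ F
    · rw [last_of_isGreatest (Z := Γ.within F A) (i := m)]
      refine ⟨?_, fun i hi ↦ hgr.2 (hsub i hi)⟩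
      exact mem_within.2 ⟨hmF, (mem_within.1 hm).2⟩
    -- If the last edge m is not in F, it does not cross the cut; its first end vertex is on the
    -- side determined by the edges of F before m, and these are all the edges of F in A.
    · rw [← (Γ.isLink m).mem_iff_of_notMem_cut (fun h ↦ hmF (hK h)), hΓ.fst_mem_iff F K hK]
      suffices Γ.within F (Set.Iio m) = Γ.within F A by rw [this]
      ext i
      rw [mem_within, mem_within]
      refine and_congr_right fun hi ↦ ⟨fun him ↦ hA (le_of_lt him) (mem_within.1 hm).2, fun hiA ↦ ?_⟩
      refine lt_of_le_of_ne (hgr.2 (hsub i (mem_within.2 ⟨hi, hiA⟩))) ?_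
      rintro rfl
      exact hmF hi

/-- The direction at a cut of the linear order. -/
noncomputable def dirAt (hΓ : Γ.IsCompatible) (A : LowerSet I) : G.EdgeDirection where
  comp F := G.componentAvoiding F (Γ.last (Γ.within F A))
  exists_eq_comp F := ⟨_, last_mem_vertexSet _, rfl⟩
  anti F F' h := by
    refine (componentAvoiding_anti h _).trans (Eq.subset ?_)
    apply componentAvoiding_eq_of_mem
    exact (hΓ.last_mem_iff_of_subset h (cut_componentAvoiding_subset _ _) A.lower).2
      (mem_componentAvoiding_self _ _)

lemma dirAt_comp_eq_iff (hΓ : Γ.IsCompatible) (A : LowerSet I) (d : G.EdgeDirection)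
    (F : Finset E) : (dirAt hΓ A).comp F = d.comp F ↔ Γ.last (Γ.within F A) ∈ d.comp F := by
  constructor
  · intro h
    rw [← h]
    exact mem_componentAvoiding_self _ _
  · intro h
    exact (dirAt hΓ A).comp_eq_of_mem_of_mem d (mem_componentAvoiding_self _ _) h

/-- This closes up the circle: the two ends of the parameter interval are mapped to the same point.
-/
lemma dirAt_univ_eq_empty (hΓ : Γ.IsCompatible) : dirAt hΓ ⊤ = dirAt hΓ ⊥ := by
  refine EdgeDirection.ext_comp fun F ↦ ?_
  have h1 : Γ.last (Γ.within F (⊥ : LowerSet I)) = Γ.start :=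
    last_of_empty (Finset.eq_empty_of_forall_notMem fun i hi ↦ by simpa using (mem_within.1 hi).2)
  rw [dirAt_comp_eq_iff]
  have h2 := hΓ.start_mem_iff F _ ((dirAt hΓ ⊥).cut_comp_subset F)
  rw [LowerSet.coe_top, ← h2, ← h1]
  exact mem_componentAvoiding_self _ _

/-- For the cut L crossed at i and j only, the direction of a lower set is on the side L exactly if
the set contains i but not j. -/
lemma dirAt_ne (hΓ : Γ.IsCompatible) {A A' : LowerSet I} {i j : I} (hij : i < j)
    (h : i ∈ A ∧ j ∉ A) (h' : j ∈ A' ∨ i ∉ A') : dirAt hΓ A ≠ dirAt hΓ A' := by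
  classical
  obtain ⟨L, hfin, hL, hi, hj, hs⟩ := hΓ.exists_cut i j hij
  intro heq
  have hcomp := congrArg (fun d ↦ EdgeDirection.comp d hfin.toFinset) heq
  have hw : ∀ (B : LowerSet I) k, k ∈ Γ.within hfin.toFinset B ↔ (k = i ∨ k = j) ∧ k ∈ B := by
    intro B k
    rw [mem_within, Set.Finite.mem_toFinset, hL]; rfl
  have hside : ∀ B : LowerSet I, Γ.last (Γ.within hfin.toFinset B) ∈ L ↔ i ∈ B ∧ j ∉ B := by
    intro B
    by_cases hjB : j ∈ B
    · have : IsGreatest (Γ.within hfin.toFinset B : Set I) j := by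
        refine ⟨(hw B j).2 ⟨Or.inr rfl, hjB⟩, fun k hk ↦ ?_⟩
        rcases ((hw B k).1 hk).1 with rfl | rfl
        · exact hij.le
        · exact le_rfl
      rw [last_of_isGreatest this]
      simp [hjB, hj]
    · by_cases hiB : i ∈ B
      · have : IsGreatest (Γ.within hfin.toFinset B : Set I) i := by
          refine ⟨(hw B i).2 ⟨Or.inl rfl, hiB⟩, fun k hk ↦ ?_⟩
          rcases (hw B k).1 hk with ⟨rfl | rfl, h2⟩
          · exact le_rfl
          · exact absurd h2 hjB
        rw [last_of_isGreatest this]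
        simp [hjB, hiB, hi]
      · rw [last_of_empty]
        · simp [hiB, hs]
        · refine Finset.eq_empty_of_forall_notMem fun k hk ↦ ?_
          rcases (hw B k).1 hk with ⟨rfl | rfl, h2⟩
          · exact hiB h2
          · exact hjB h2
  have h1 := (dirAt_comp_eq_iff hΓ A (dirAt hΓ A') hfin.toFinset).1 hcomp
  have h2 := mem_iff_of_mem_componentAvoiding (K := L) (F := hfin.toFinset) (by simp) h1
  rw [hside, hside] at h2
  tauto

end CircularOrder

end Graph


/-! ### Parametrising a topological circle -/

open Topology

namespace Graph.CircularOrder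

variable {V E : Type*} {G : Graph V E} {I : Type*} [LinearOrder I] (Γ : G.CircularOrder I)

open Classical in
/-- The parameter of an inner point of the `i`th edge, in the direction of traversal. -/
noncomputable def orient (i : I) (s : Set.Ioo (0 : ℝ) 1) : Set.Ioo (0 : ℝ) 1 :=
  if G.src ⟨Γ.edge i, (Γ.isLink i).edge_mem⟩ = Γ.fst i then s
  else ⟨1 - s, by have := s.2.1; have := s.2.2; constructor <;> linarith⟩

/-- The inner point of the `i`th edge with parameter `s` in the direction of traversal. -/
noncomputable def innerPoint (i : I) (s : Set.Ioo (0 : ℝ) 1) : EndSpace G :=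
  .inner ⟨Γ.edge i, (Γ.isLink i).edge_mem⟩ (Γ.orient i s)

variable {Γ}

lemma orient_orient (i : I) (s : Set.Ioo (0 : ℝ) 1) : Γ.orient i (Γ.orient i s) = s := by
  unfold orient
  split_ifs
  · rfl
  · ext; simp

lemma continuous_orient (i : I) : Continuous (Γ.orient i) := by
  unfold orient
  split_ifs
  · exact continuous_id
  · exact (continuous_const.sub continuous_subtype_val).subtype_mk _

lemma innerPoint_mem_basicNhd {i : I} {s : Set.Ioo (0 : ℝ) 1} {F : Finset E} {K : Set V} {ε : ℝ} :
    Γ.innerPoint i s ∈ EndSpace.basicNhd F K ε ↔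
      (Γ.fst i ∈ K ∧ (Γ.edge i ∈ F → (s : ℝ) < ε)) ∨
      (Γ.snd i ∈ K ∧ (Γ.edge i ∈ F → 1 - ε < (s : ℝ))) := by
  rw [innerPoint, EndSpace.inner_mem_basicNhd]
  have hl := isLink_src_tgt ⟨Γ.edge i, (Γ.isLink i).edge_mem⟩
  unfold orient
  split_ifs with h
  · have h2 : G.tgt ⟨Γ.edge i, (Γ.isLink i).edge_mem⟩ = Γ.snd i := by
      rw [h] at hl
      exact hl.right_unique (Γ.isLink i)
    rw [h, h2]
  · obtain ⟨h1, h2⟩ := (hl.eq_and_eq_or_eq_and_eq (Γ.isLink i)).resolve_left fun h' ↦ h h'.1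
    rw [h1, h2, or_comm]
    have e1 : (1 - ε < 1 - (s : ℝ)) ↔ (s : ℝ) < ε := by constructor <;> intro <;> linarith
    have e2 : (1 - (s : ℝ) < ε) ↔ 1 - ε < (s : ℝ) := by constructor <;> intro <;> linarith
    simp only [e1, e2]

/-- Open intervals in the real line, disjoint and arranged in the order of their indices. -/
structure Arrangement (I : Type*) [LinearOrder I] where
  /-- the starting points of the intervals -/
  a : I → ℝ
  /-- the lengths of the intervals -/
  l : I → ℝ
  l_pos : ∀ i, 0 < l i
  le : ∀ i j, i < j → a i + l i ≤ a j

variable (Λ : Arrangement I)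

lemma Arrangement.lt_of_lt {Λ : Arrangement I} {i j : I} (h : Λ.a j < Λ.a i + Λ.l i) : j ≤ i := by
  by_contra! hn
  have := Λ.le i j hn
  linarith

lemma Arrangement.eq_of_mem {Λ : Arrangement I} {i j : I} {t : ℝ}
    (hi : Λ.a i < t ∧ t < Λ.a i + Λ.l i) (hj : Λ.a j < t ∧ t < Λ.a j + Λ.l j) : i = j :=
  le_antisymm (Λ.lt_of_lt (hi.1.trans hj.2)) (Λ.lt_of_lt (hj.1.trans hi.2))

/-- The intervals to the left of a point. -/
def Arrangement.lower (t : ℝ) : LowerSet I where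
  carrier := {i | Λ.a i + Λ.l i ≤ t}
  lower' i j hji hi := by
    rcases hji.eq_or_lt with rfl | h
    · exact hi
    · have h1 := Λ.le j i h
      have h2 := Λ.l_pos i
      have h3 : Λ.a i + Λ.l i ≤ t := hi
      show Λ.a j + Λ.l j ≤ t
      linarith

lemma Arrangement.mem_lower {Λ : Arrangement I} {t : ℝ} {i : I} :
    i ∈ Λ.lower t ↔ Λ.a i + Λ.l i ≤ t := Iff.rfl

lemma Arrangement.lower_eq_Iio {Λ : Arrangement I} {i : I} {t : ℝ}
    (hi : Λ.a i ≤ t ∧ t < Λ.a i + Λ.l i) : (Λ.lower t : Set I) = Set.Iio i := by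
  ext j
  rw [SetLike.mem_coe, mem_lower, Set.mem_Iio]
  constructor
  · intro h
    by_contra! hn
    rcases hn.eq_or_lt with rfl | h'
    · linarith [hi.2]
    · have := Λ.le i j h'
      have := Λ.l_pos j
      linarith [hi.2]
  · intro h
    exact (Λ.le j i h).trans hi.1

open Classical in
/-- The map from the real line to the end space which runs through the edges of a circle. -/
noncomputable def trace (hΓ : Γ.IsCompatible) (t : ℝ) : EndSpace G :=
  if h : ∃ i, Λ.a i < t ∧ t < Λ.a i + Λ.l i then
    Γ.innerPoint h.choose ⟨(t - Λ.a h.choose) / Λ.l h.choose, by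
      have h1 := h.choose_spec
      have h2 := Λ.l_pos h.choose
      constructor
      · exact div_pos (by linarith) h2
      · rw [div_lt_one h2]; linarith⟩
  else .dir (dirAt hΓ (Λ.lower t))

variable {Λ} (hΓ : Γ.IsCompatible)

lemma trace_of_mem {i : I} {t : ℝ} (h : Λ.a i < t ∧ t < Λ.a i + Λ.l i) :
    ∃ s : Set.Ioo (0 : ℝ) 1, (s : ℝ) = (t - Λ.a i) / Λ.l i ∧
      trace Λ hΓ t = Γ.innerPoint i s := by
  have hex : ∃ i, Λ.a i < t ∧ t < Λ.a i + Λ.l i := ⟨i, h⟩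
  have : hex.choose = i := Λ.eq_of_mem hex.choose_spec h
  rw [trace, dif_pos hex]
  have h0 := Λ.l_pos i
  exact ⟨⟨(t - Λ.a i) / Λ.l i, div_pos (by linarith) h0, by rw [div_lt_one h0]; linarith⟩, rfl,
    by simp only [this]⟩

lemma trace_of_notMem {t : ℝ} (h : ∀ i, ¬ (Λ.a i < t ∧ t < Λ.a i + Λ.l i)) :
    trace Λ hΓ t = .dir (dirAt hΓ (Λ.lower t)) := by
  rw [trace, dif_neg (by push Not at h ⊢; exact h)]

lemma trace_mem_basicNhd_of_mem {i : I} {t : ℝ} (h : Λ.a i < t ∧ t < Λ.a i + Λ.l i)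
    {F : Finset E} (hi : Γ.edge i ∈ F) {K : Set V} {ε : ℝ} :
    trace Λ hΓ t ∈ EndSpace.basicNhd F K ε ↔
      (Γ.fst i ∈ K ∧ (t - Λ.a i) / Λ.l i < ε) ∨ (Γ.snd i ∈ K ∧ 1 - ε < (t - Λ.a i) / Λ.l i) := by
  obtain ⟨s, hs, heq⟩ := trace_of_mem hΓ h
  rw [heq, innerPoint_mem_basicNhd, ← hs]
  simp [hi]

/-- Both ends of an edge outside F lie in the same component of G - F, so its inner points are in
the same basic neighbourhoods for F as the direction at its start. -/
lemma trace_mem_basicNhd_of_notMem {F : Finset E} {t : ℝ}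
    (h : ∀ i, Γ.edge i ∈ F → ¬ (Λ.a i < t ∧ t < Λ.a i + Λ.l i)) (d : G.EdgeDirection) {ε : ℝ} :
    trace Λ hΓ t ∈ EndSpace.basicNhd F (d.comp F) ε ↔
      Γ.last (Γ.within F (Λ.lower t)) ∈ d.comp F := by
  by_cases hex : ∃ i, Λ.a i < t ∧ t < Λ.a i + Λ.l i
  · obtain ⟨i, hi⟩ := hex
    have hiF : Γ.edge i ∉ F := fun hF ↦ h i hF hi
    obtain ⟨s, hs, heq⟩ := trace_of_mem hΓ hi
    have hK := d.cut_comp_subset F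
    rw [heq, innerPoint_mem_basicNhd, Λ.lower_eq_Iio ⟨hi.1.le, hi.2⟩, ← hΓ.fst_mem_iff F _ hK i,
      ← (Γ.isLink i).mem_iff_of_notMem_cut fun h' ↦ hiF (hK h')]
    simp [hiF]
  · push Not at hex
    rw [trace_of_notMem hΓ (by push Not; exact hex), EndSpace.dir_mem_basicNhd, dirAt_comp_eq_iff]

/-- For a basic neighbourhood of a direction only the finitely many edges in F matter, and strict
inequalities between t₀ and the ends of their intervals persist near t₀. The delicate case is that
t₀ is an end of such an interval. -/
lemma continuous_trace : Continuous (trace Λ hΓ) := by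
  classical
  apply continuous_generateFrom_iff.2
  rintro U (⟨d, F, ε, hε, rfl⟩ | ⟨e, U, hU, rfl⟩)
  · rw [isOpen_iff_mem_nhds]
    intro t₀ ht₀
    have hev : ∀ᶠ t in 𝓝 t₀, ∀ i ∈ Γ.within F Set.univ,
        (t₀ < Λ.a i → t < Λ.a i) ∧ (Λ.a i + Λ.l i < t₀ → Λ.a i + Λ.l i < t) ∧
        (Λ.a i < t₀ → Λ.a i < t) ∧ (t₀ < Λ.a i + Λ.l i → t < Λ.a i + Λ.l i) ∧
        ((t₀ - Λ.a i) / Λ.l i < ε → (t - Λ.a i) / Λ.l i < ε) ∧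
        (1 - ε < (t₀ - Λ.a i) / Λ.l i → 1 - ε < (t - Λ.a i) / Λ.l i) := by
      rw [Filter.eventually_all_finset]
      intro i _
      have hc : Continuous fun t : ℝ ↦ (t - Λ.a i) / Λ.l i := by fun_prop
      have aux : ∀ {f g : ℝ → ℝ}, Continuous f → Continuous g →
          ∀ᶠ t in 𝓝 t₀, (f t₀ < g t₀ → f t < g t) := by
        intro f g hf hg
        by_cases h : f t₀ < g t₀
        · filter_upwards [(isOpen_lt hf hg).mem_nhds h] with t ht _ using ht
        · exact Filter.Eventually.of_forall fun t h' ↦ absurd h' h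
      filter_upwards [aux continuous_id (continuous_const (y := Λ.a i)),
        aux (continuous_const (y := Λ.a i + Λ.l i)) continuous_id,
        aux (continuous_const (y := Λ.a i)) continuous_id,
        aux continuous_id (continuous_const (y := Λ.a i + Λ.l i)),
        aux hc (continuous_const (y := ε)), aux (continuous_const (y := 1 - ε)) hc]
        with t h1 h2 h3 h4 h5 h6
      exact ⟨h1, h2, h3, h4, h5, h6⟩
    filter_upwards [hev] with t ht
    have ht' := fun i (hi : Γ.edge i ∈ F) ↦ ht i (mem_within.2 ⟨hi, trivial⟩)
    show trace Λ hΓ t ∈ EndSpace.basicNhd F (d.comp F) ε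
    have ht₀' : trace Λ hΓ t₀ ∈ EndSpace.basicNhd F (d.comp F) ε := ht₀
    by_cases hex : ∃ i, Γ.edge i ∈ F ∧ Λ.a i < t₀ ∧ t₀ < Λ.a i + Λ.l i
    · obtain ⟨i, hiF, hi⟩ := hex
      obtain ⟨-, -, h3, h4, h5, h6⟩ := ht' i hiF
      rw [trace_mem_basicNhd_of_mem hΓ ⟨h3 hi.1, h4 hi.2⟩ hiF]
      rw [trace_mem_basicNhd_of_mem hΓ hi hiF] at ht₀'
      exact ht₀'.imp (fun h ↦ ⟨h.1, h5 h.2⟩) fun h ↦ ⟨h.1, h6 h.2⟩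
    · push Not at hex
      rw [trace_mem_basicNhd_of_notMem hΓ
        (fun i hi ↦ by have := hex i hi; intro h'; linarith [this h'.1, h'.2])] at ht₀'
      by_cases hex' : ∃ i, Γ.edge i ∈ F ∧ Λ.a i < t ∧ t < Λ.a i + Λ.l i
      · obtain ⟨i, hiF, hi⟩ := hex'
        obtain ⟨h1, h2, h3, h4, h5, h6⟩ := ht' i hiF
        rw [trace_mem_basicNhd_of_mem hΓ hi hiF]
        have hl := Λ.l_pos i
        -- Here t lies in the interval of an edge of F but t₀ does not, so t₀ is its left or its
        -- right end.
        rcases lt_trichotomy t₀ (Λ.a i) with h | h | h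
        · linarith [h1 h, hi.1]
        · left
          rw [Λ.lower_eq_Iio ⟨h.ge, by linarith⟩, ← hΓ.fst_mem_iff F _ (d.cut_comp_subset F)] at ht₀'
          exact ⟨ht₀', h5 (by rw [h]; simpa using hε)⟩
        · have h7 := hex i hiF h
          rcases h7.eq_or_lt with h8 | h8
          swap
          · linarith [h2 h8, hi.2]
          right
          refine ⟨?_, h6 (by rw [← h8]; rw [add_sub_cancel_left, div_self hl.ne']; linarith)⟩
          rwa [last_of_isGreatest (i := i)] at ht₀'
          refine ⟨mem_within.2 ⟨hiF, Λ.mem_lower.2 h7⟩, fun j hj ↦ ?_⟩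
          have hj := Λ.mem_lower.1 (mem_within.1 hj).2
          apply Λ.lt_of_lt
          have := Λ.l_pos j
          linarith
      · push Not at hex'
        rw [trace_mem_basicNhd_of_notMem hΓ
          (fun i hi ↦ by have := hex' i hi; intro h'; linarith [this h'.1, h'.2])]
        suffices Γ.within F (Λ.lower t) = Γ.within F (Λ.lower t₀) by rwa [this]
        ext i
        rw [mem_within, mem_within]
        refine and_congr_right fun hiF ↦ ?_
        rw [SetLike.mem_coe, SetLike.mem_coe, Λ.mem_lower, Λ.mem_lower]
        obtain ⟨h1, h2, h3, h4, h5, h6⟩ := ht' i hiF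
        have hl := Λ.l_pos i
        constructor
        · intro h
          by_contra! h'
          linarith [h4 h']
        · intro h
          exact hex' i hiF (h3 (by linarith))
  · by_cases hex : ∃ i, Γ.edge i = e
    · obtain ⟨i, hi⟩ := hex
      have he : (⟨Γ.edge i, (Γ.isLink i).edge_mem⟩ : G.edgeSet) = e := Subtype.ext hi
      have hO : IsOpen {s : Set.Ioo (0 : ℝ) 1 | Γ.orient i s ∈ U} :=
        hU.preimage (continuous_orient i)
      obtain ⟨W, hW, hWU⟩ := isOpen_induced_iff.1 hO
      have hWU' : ∀ s : Set.Ioo (0 : ℝ) 1, (s : ℝ) ∈ W ↔ Γ.orient i s ∈ U := fun s ↦ by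
        have : s ∈ Subtype.val ⁻¹' W ↔ s ∈ {s : Set.Ioo (0 : ℝ) 1 | Γ.orient i s ∈ U} := by rw [hWU]
        exact this
      have heq : trace Λ hΓ ⁻¹' (EndSpace.inner e '' U) =
          Set.Ioo (Λ.a i) (Λ.a i + Λ.l i) ∩ (fun t ↦ (t - Λ.a i) / Λ.l i) ⁻¹' W := by
        ext t
        constructor
        · rintro ⟨s, hs, hst⟩
          by_cases hex : ∃ j, Λ.a j < t ∧ t < Λ.a j + Λ.l j
          · obtain ⟨j, hj⟩ := hex
            obtain ⟨s', hs', heq⟩ := trace_of_mem hΓ hj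
            rw [heq, innerPoint, EndSpace.inner.injEq] at hst
            have hij : i = j := Γ.edge_injective (hi.trans (congrArg Subtype.val hst.1))
            subst hij
            refine ⟨hj, ?_⟩
            show (t - Λ.a i) / Λ.l i ∈ W
            rw [← hs', hWU', ← hst.2]
            exact hs
          · rw [trace_of_notMem hΓ (by push Not at hex ⊢; exact hex)] at hst
            cases hst
        · rintro ⟨hj, ht⟩
          obtain ⟨s', hs', heq⟩ := trace_of_mem hΓ hj
          refine ⟨Γ.orient i s', ?_, ?_⟩
          · rw [← hWU', hs']; exact ht
          · rw [heq, innerPoint, he]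
      rw [heq]
      exact isOpen_Ioo.inter (hW.preimage (by fun_prop))
    · have : trace Λ hΓ ⁻¹' (EndSpace.inner e '' U) = ∅ := by
        rw [Set.eq_empty_iff_forall_notMem]
        rintro t ⟨s, hs, hst⟩
        by_cases hex' : ∃ j, Λ.a j < t ∧ t < Λ.a j + Λ.l j
        · obtain ⟨j, hj⟩ := hex'
          obtain ⟨s', hs', heq⟩ := trace_of_mem hΓ hj
          rw [heq, innerPoint, EndSpace.inner.injEq] at hst
          exact hex ⟨j, (congrArg Subtype.val hst.1).symm⟩
        · rw [trace_of_notMem hΓ (by push Not at hex' ⊢; exact hex')] at hst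
          cases hst
      rw [this]
      exact isOpen_empty

/-- A compatible linear order of countably many edges gives a topological circle. -/
theorem IsCompatible.isTopologicalCycle [Countable I] [Nonempty I] (hΓ : Γ.IsCompatible) :
    G.IsTopologicalCycle (Set.range Γ.edge) := by
  obtain ⟨a, l, T, hl, hle, ha, hT, hgap⟩ := exists_interval_arrangement I
  let Λ : Arrangement I := ⟨a, l, hl, hle⟩
  have hTpos : 0 < T := by
    obtain ⟨i⟩ := ‹Nonempty I›
    linarith [hl i, ha i, hT i]
  have : Fact (0 < T) := ⟨hTpos⟩
  have hnot0 : ∀ i, ¬ (a i < 0 ∧ 0 < a i + l i) := fun i h ↦ by linarith [ha i, h.1]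
  have hnotT : ∀ i, ¬ (a i < T ∧ T < a i + l i) := fun i h ↦ by linarith [hT i, h.2]
  have h0 : trace Λ hΓ 0 = .dir (dirAt hΓ ⊥) := by
    rw [trace_of_notMem hΓ hnot0]
    congr 2
    ext i
    have : ¬ (a i + l i ≤ 0) := by linarith [ha i, hl i]
    simpa [Λ.mem_lower] using this
  have hTT : trace Λ hΓ T = .dir (dirAt hΓ ⊤) := by
    rw [trace_of_notMem hΓ hnotT]
    congr 2
    ext i
    simpa [Λ.mem_lower] using hT i
  have hend : trace Λ hΓ 0 = trace Λ hΓ (0 + T) := by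
    rw [zero_add, h0, hTT, dirAt_univ_eq_empty]
  have hinj : ∀ t t', 0 ≤ t → t < t' → t' < T → trace Λ hΓ t ≠ trace Λ hΓ t' := by
    intro t t' ht0 htt htT heq
    by_cases hex : ∃ i, a i < t ∧ t < a i + l i
    · obtain ⟨i, hi⟩ := hex
      obtain ⟨s, hs, h1⟩ := trace_of_mem (Λ := Λ) hΓ hi
      by_cases hex' : ∃ j, a j < t' ∧ t' < a j + l j
      · obtain ⟨j, hj⟩ := hex'
        obtain ⟨s', hs', h2⟩ := trace_of_mem (Λ := Λ) hΓ hj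
        rw [h1, h2, innerPoint, innerPoint, EndSpace.inner.injEq] at heq
        have hij : i = j := Γ.edge_injective (congrArg Subtype.val heq.1)
        subst hij
        have h3 := congrArg (Γ.orient i) heq.2
        rw [orient_orient, orient_orient] at h3
        rw [h3, hs'] at hs
        have h4 : (t' - a i) / l i = (t - a i) / l i := hs
        rw [div_left_inj' (hl i).ne'] at h4
        linarith
      · push Not at hex'
        rw [h1, trace_of_notMem hΓ (by push Not; exact hex'), innerPoint] at heq
        cases heq
    · push Not at hex
      by_cases hex' : ∃ j, a j < t' ∧ t' < a j + l j
      · obtain ⟨j, hj⟩ := hex'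
        obtain ⟨s', hs', h2⟩ := trace_of_mem (Λ := Λ) hΓ hj
        rw [h2, trace_of_notMem hΓ (by push Not; exact hex), innerPoint] at heq
        cases heq
      · push Not at hex'
        have hn : ∀ i, ¬ (a i < t ∧ t < a i + l i) := by push Not; exact hex
        have hn' : ∀ i, ¬ (a i < t' ∧ t' < a i + l i) := by push Not; exact hex'
        rw [trace_of_notMem hΓ hn, trace_of_notMem hΓ hn', EndSpace.dir.injEq] at heq
        -- To distinguish two points of a circle one needs an edge on each of the two arcs between
        -- them: i lies between t and t', and j between t' and T.
        obtain ⟨i, hi1, hi2⟩ := hgap t t' ht0 htt htT.le hn hn'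
        obtain ⟨j, hj1, hj2⟩ := hgap t' T (ht0.trans htt.le) htT le_rfl hn' hnotT
        have hij : i < j := by
          by_contra! hji
          rcases hji.eq_or_lt with rfl | h
          · linarith [hl j]
          · linarith [hle j i h, hl i, hl j]
        refine dirAt_ne hΓ (A := Λ.lower t') (A' := Λ.lower t) hij ⟨?_, ?_⟩ (Or.inr ?_) heq.symm
        · exact hi2
        · show ¬ (a j + l j ≤ t')
          linarith [hl j]
        · show ¬ (a i + l i ≤ t)
          linarith [hl i]
  let f : AddCircle T → EndSpace G := AddCircle.liftIco T 0 (trace Λ hΓ)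
  have hfc : Continuous f :=
    AddCircle.liftIco_continuous hend (continuous_trace hΓ).continuousOn
  have hfval : ∀ y, ∃ t, 0 ≤ t ∧ t < T ∧ (t : AddCircle T) = y ∧ f y = trace Λ hΓ t := by
    intro y
    obtain ⟨h1, h2⟩ := (AddCircle.equivIco T 0 y).2
    have h2 : (AddCircle.equivIco T 0 y : ℝ) < T := h2.trans_eq (zero_add T)
    refine ⟨AddCircle.equivIco T 0 y, h1, h2, AddCircle.coe_equivIco, ?_⟩
    have h3 : f ((AddCircle.equivIco T 0 y : ℝ) : AddCircle T) = trace Λ hΓ (AddCircle.equivIco T 0 y) :=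
      AddCircle.liftIco_coe_apply (AddCircle.equivIco T 0 y).2
    rwa [AddCircle.coe_equivIco] at h3
  have hfinj : Function.Injective f := by
    intro y y' hyy
    obtain ⟨t, ht0, htT, rfl, h1⟩ := hfval y
    obtain ⟨t', ht0', htT', rfl, h2⟩ := hfval y'
    rw [h1, h2] at hyy
    rcases lt_trichotomy t t' with h | h | h
    · exact absurd hyy (hinj t t' ht0 h htT')
    · rw [h]
    · exact absurd hyy.symm (hinj t' t ht0' h htT)
  let φ := (AddCircle.homeomorphCircle hTpos.ne').symm
  refine ⟨f ∘ φ, ?_, ?_⟩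
  · exact ((hfc.comp φ.continuous).isClosedEmbedding (hfinj.comp φ.injective)).isEmbedding
  · have hrange : Set.range (f ∘ φ) = Set.range f := φ.surjective.range_comp f
    rw [hrange]
    ext e
    constructor
    · rintro ⟨i, rfl⟩
      refine ⟨(Γ.isLink i).edge_mem, fun s ↦ ?_⟩
      obtain ⟨hs0, hs1⟩ := (Γ.orient i s).2
      have hli := hl i
      have hmem : a i < a i + l i * (Γ.orient i s : ℝ) ∧
          a i + l i * (Γ.orient i s : ℝ) < a i + l i := by
        constructor
        · have := mul_pos hli hs0; linarith
        · have := mul_lt_mul_of_pos_left hs1 hli; linarith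
      obtain ⟨s', hs', h1⟩ := trace_of_mem (Λ := Λ) hΓ hmem
      refine ⟨((a i + l i * (Γ.orient i s : ℝ) : ℝ) : AddCircle T), ?_⟩
      have h2 : f ((a i + l i * (Γ.orient i s : ℝ) : ℝ) : AddCircle T) =
          trace Λ hΓ (a i + l i * (Γ.orient i s : ℝ)) := by
        refine AddCircle.liftIco_coe_apply ⟨?_, ?_⟩
        · linarith [ha i, hmem.1]
        · linarith [hT i, hmem.2]
      rw [h2, h1, innerPoint]
      congr 1
      have : s' = Γ.orient i s := by
        ext
        rw [hs']
        show (a i + l i * (Γ.orient i s : ℝ) - a i) / l i = _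
        rw [add_sub_cancel_left, mul_div_cancel_left₀ _ hli.ne']
      rw [this, orient_orient]
    · rintro ⟨he, hall⟩
      obtain ⟨y, hy⟩ := hall ⟨1 / 2, by norm_num, by norm_num⟩
      obtain ⟨t, ht0, htT, rfl, h1⟩ := hfval y
      rw [h1] at hy
      by_cases hex : ∃ i, a i < t ∧ t < a i + l i
      · obtain ⟨i, hi⟩ := hex
        obtain ⟨s', hs', h2⟩ := trace_of_mem (Λ := Λ) hΓ hi
        rw [h2, innerPoint, EndSpace.inner.injEq] at hy
        exact ⟨i, congrArg Subtype.val hy.1⟩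
      · rw [trace_of_notMem hΓ (by push Not at hex ⊢; exact hex)] at hy
        cases hy

end Graph.CircularOrder


/-! ### Spanning trees and countability of orders given by finite cuts -/

namespace Graph

variable {V E : Type*} {G : Graph V E} {A : Set E} {u : V}

/-- A spanning tree of the component of `u`, by its parent function: the parent of a vertex is
closer to the root. -/
structure ParentTree (G : Graph V E) (A : Set E) (u : V) where
  /-- the parent of a vertex -/
  parent : V → V
  /-- the distance from the root -/
  depth : V → ℕ
  /-- the edge to the parent -/
  up : V → E
  depth_root : depth u = 0
  up_mem : ∀ v ∈ G.componentIn A u, v ≠ u → up v ∈ A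
  isLink : ∀ v ∈ G.componentIn A u, v ≠ u → G.IsLink (up v) v (parent v)
  depth_parent : ∀ v ∈ G.componentIn A u, v ≠ u → depth (parent v) + 1 = depth v

/-- `v` can be reached from `u` by a walk of length `n` in `A`. -/
def ReachedIn (G : Graph V E) (A : Set E) (u : V) : ℕ → V → Prop
  | 0, v => v = u
  | n + 1, v => ∃ x, ReachedIn G A u n x ∧ ∃ f ∈ A, G.IsLink f x v

theorem nonempty_parentTree [Nonempty E] (G : Graph V E) (A : Set E) (u : V) :
    Nonempty (G.ParentTree A u) := by
  obtain ⟨reach, hr⟩ : ∃ r, r = G.ReachedIn A u := ⟨_, rfl⟩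
  have hreach : ∀ v ∈ G.componentIn A u, ∃ n, reach n v := by
    intro v hv
    induction hv with
    | refl => exact ⟨0, by rw [hr]; rfl⟩
    | tail _ h ih =>
      obtain ⟨n, hn⟩ := ih
      exact ⟨n + 1, by rw [hr] at hn ⊢; exact ⟨_, hn, h⟩⟩
  let depth : V → ℕ := fun v ↦ sInf {n | reach n v}
  have hdle : ∀ n v, reach n v → depth v ≤ n := fun n v h ↦ Nat.sInf_le h
  have hdspec : ∀ n v, reach n v → reach (depth v) v := fun n v h ↦
    Nat.sInf_mem (s := {n | reach n v}) ⟨n, h⟩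
  have hpar : ∀ v, ∃ (x : V) (f : E), v ∈ G.componentIn A u → v ≠ u →
      f ∈ A ∧ G.IsLink f v x ∧ depth x + 1 = depth v := by
    intro v
    by_cases h : v ∈ G.componentIn A u ∧ v ≠ u
    · obtain ⟨n, hn⟩ := hreach v h.1
      have h1 := hdspec n v hn
      rcases hd : depth v with _ | m
      · rw [hd, hr] at h1
        exact absurd h1 h.2
      · rw [hd] at h1
        have h1 : ∃ x, reach m x ∧ ∃ f ∈ A, G.IsLink f x v := by rw [hr] at h1 ⊢; exact h1
        obtain ⟨x, hx, f, hf, hl⟩ := h1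
        refine ⟨x, f, fun _ _ ↦ ⟨hf, hl.symm, ?_⟩⟩
        have h2 := hdle m x hx
        have h3 := hdle (depth x + 1) v (by
          have := hdspec m x hx
          rw [hr] at this ⊢
          exact ⟨x, this, f, hf, hl⟩)
        omega
    · exact ⟨u, Classical.arbitrary E, fun h1 h2 ↦ absurd ⟨h1, h2⟩ h⟩
  choose parent up hup using hpar
  exact ⟨⟨parent, depth, up, Nat.le_zero.1 (hdle 0 u (by rw [hr]; rfl)), fun v h1 h2 ↦ (hup v h1 h2).1,
    fun v h1 h2 ↦ (hup v h1 h2).2.1, fun v h1 h2 ↦ (hup v h1 h2).2.2⟩⟩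

namespace ParentTree

variable (T : G.ParentTree A u)

lemma ne_root {v : V} (h : 0 < T.depth v) : v ≠ u := by
  rintro rfl
  rw [T.depth_root] at h
  exact lt_irrefl _ h

lemma depth_pos {v : V} (hv : v ∈ G.componentIn A u) (h : v ≠ u) : 0 < T.depth v := by
  have := T.depth_parent v hv h
  omega

lemma parent_mem {v : V} (hv : v ∈ G.componentIn A u) (h : v ≠ u) :
    T.parent v ∈ G.componentIn A u :=
  hv.trans ((T.isLink v hv h).joined (T.up_mem v hv h))

/-- The `k`th ancestor of a vertex of depth at least `k`. -/
lemma iterate_parent {v : V} (hv : v ∈ G.componentIn A u) {k : ℕ} (hk : k ≤ T.depth v) :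
    T.parent^[k] v ∈ G.componentIn A u ∧ T.depth (T.parent^[k] v) + k = T.depth v := by
  induction k with
  | zero => exact ⟨hv, rfl⟩
  | succ k ih =>
    obtain ⟨h1, h2⟩ := ih (by omega)
    have hne := T.ne_root (v := T.parent^[k] v) (by omega)
    rw [Function.iterate_succ_apply']
    refine ⟨T.parent_mem h1 hne, ?_⟩
    have := T.depth_parent _ h1 hne
    omega

/-- The ancestor of `v` at depth `n`. -/
def ancestor (n : ℕ) (v : V) : V := T.parent^[T.depth v - n] v

variable {T}

lemma ancestor_mem {v : V} (hv : v ∈ G.componentIn A u) (n : ℕ) :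
    T.ancestor n v ∈ G.componentIn A u :=
  (T.iterate_parent hv (Nat.sub_le _ _)).1

lemma depth_ancestor {v : V} (hv : v ∈ G.componentIn A u) {n : ℕ} (hn : n ≤ T.depth v) :
    T.depth (T.ancestor n v) = n := by
  have := (T.iterate_parent hv (Nat.sub_le _ n)).2
  rw [ancestor]
  omega

lemma ancestor_depth (v : V) : T.ancestor (T.depth v) v = v := by
  simp [ancestor]

lemma parent_ancestor {v : V} {n : ℕ} (hn : n < T.depth v) :
    T.parent (T.ancestor (n + 1) v) = T.ancestor n v := by
  rw [ancestor, ancestor, ← Function.iterate_succ_apply' T.parent]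
  congr 2
  omega

lemma ancestor_ancestor {v : V} (hv : v ∈ G.componentIn A u) {m n : ℕ} (hmn : m ≤ n)
    (hn : n ≤ T.depth v) : T.ancestor m (T.ancestor n v) = T.ancestor m v := by
  rw [ancestor, depth_ancestor hv hn, ancestor, ancestor, ← Function.iterate_add_apply]
  congr 2
  omega

lemma ancestor_zero {v : V} (hv : v ∈ G.componentIn A u) : T.ancestor 0 v = u := by
  by_contra h
  have h1 := T.depth_pos (ancestor_mem hv 0) h
  rw [depth_ancestor hv (Nat.zero_le _)] at h1
  exact lt_irrefl _ h1

lemma up_injOn : Set.InjOn T.up {v | v ∈ G.componentIn A u ∧ v ≠ u} := by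
  rintro v ⟨hv, hvu⟩ w ⟨hw, hwu⟩ h
  have h1 := T.isLink v hv hvu
  have h2 := T.isLink w hw hwu
  rw [h] at h1
  rcases h1.eq_and_eq_or_eq_and_eq h2 with ⟨h3, -⟩ | ⟨h3, h4⟩
  · exact h3
  · have h5 := T.depth_parent v hv hvu
    have h6 := T.depth_parent w hw hwu
    rw [h4] at h5
    rw [← h3] at h6
    omega

lemma isLink_ancestor {v : V} (hv : v ∈ G.componentIn A u) {n : ℕ} (hn : n < T.depth v) :
    G.IsLink (T.up (T.ancestor (n + 1) v)) (T.ancestor (n + 1) v) (T.ancestor n v) := by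
  rw [← parent_ancestor hn]
  refine T.isLink _ (ancestor_mem hv _) (T.ne_root ?_)
  rw [depth_ancestor hv hn]
  omega

/-- If `v` and its ancestor at depth `n` are on different sides of a cut, then the path between them
has an edge in the cut. -/
lemma exists_up_mem_cut {v : V} (hv : v ∈ G.componentIn A u) {K : Set V} {n : ℕ}
    (hn : n ≤ T.depth v) (h : ¬ (v ∈ K ↔ T.ancestor n v ∈ K)) :
    ∃ m, n < m ∧ m ≤ T.depth v ∧ T.up (T.ancestor m v) ∈ G.cut K := by
  by_contra! hno
  apply h
  have : ∀ k, n + k ≤ T.depth v → (T.ancestor (n + k) v ∈ K ↔ T.ancestor n v ∈ K) := by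
    intro k
    induction k with
    | zero => intro _; rfl
    | succ k ih =>
      intro hk
      rw [← ih (by omega)]
      exact (isLink_ancestor hv (n := n + k) (by omega)).mem_iff_of_notMem_cut
        (hno _ (by omega) (by omega))
  have h1 := this (T.depth v - n) (by omega)
  rwa [Nat.add_sub_cancel' hn, ancestor_depth] at h1

end ParentTree

/-- Counting the smaller elements is an injection into the natural numbers. -/
lemma countable_of_finite_lt {α S : Type*} [LinearOrder S] {C : Set α} {f : α → S}
    (hf : Set.InjOn f C) (h : ∀ c ∈ C, {c' ∈ C | f c' < f c}.Finite) : C.Countable := by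
  have hinj : Set.InjOn (fun c ↦ {c' ∈ C | f c' < f c}.ncard) C := by
    have hlt : ∀ c ∈ C, ∀ d ∈ C, f c < f d →
        {c' ∈ C | f c' < f c}.ncard < {c' ∈ C | f c' < f d}.ncard := by
      intro c hc d hd hcd
      refine Set.ncard_lt_ncard ⟨fun x hx ↦ ⟨hx.1, hx.2.trans hcd⟩, fun hsub ↦ ?_⟩ (h d hd)
      exact lt_irrefl _ (hsub (show c ∈ {c' ∈ C | f c' < f d} from ⟨hc, hcd⟩)).2
    intro c hc d hd hcd
    rcases lt_trichotomy (f c) (f d) with h1 | h1 | h1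
    · exact absurd hcd (hlt c hc d hd h1).ne
    · exact hf hc hd h1
    · exact absurd hcd (hlt d hd c hc h1).ne'
  exact (Set.mapsTo_univ _ _).countable_of_injOn hinj Set.countable_univ

/-- A linear order is countable if its elements are attached to vertices of a connected graph such
that every initial segment is cut off by finitely many edges. -/
theorem countable_of_finite_cuts [Nonempty E] {S : Type*} [LinearOrder S] {y : S → V}
    {K : S → Set V} (hK : ∀ s, (G.cut (K s)).Finite) (hy : ∀ s t, y t ∈ K s ↔ t < s)
    (hu : ∀ s, y s ∈ G.componentIn A u) : Countable S := by
  classical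
  rcases isEmpty_or_nonempty S with hS | hS
  · infer_instance
  obtain ⟨T⟩ := nonempty_parentTree G A u
  have hyinj : Function.Injective y := by
    intro s t hst
    rcases lt_trichotomy s t with h | h | h
    · rw [← hy t s, hst, hy] at h; exact absurd h (lt_irrefl _)
    · exact h
    · rw [← hy s t, ← hst, hy] at h; exact absurd h (lt_irrefl _)
  -- The ancestors at depth n of the vertices y s. All levels are countable once each vertex has
  -- only countably many relevant children.
  let L : ℕ → Set V := fun n ↦ {v | ∃ s, n ≤ T.depth (y s) ∧ T.ancestor n (y s) = v}
  have hLstep : ∀ n z, {c ∈ L (n + 1) | T.parent c = z}.Countable := by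
    intro n z
    set C := {c ∈ L (n + 1) | T.parent c = z} with hC
    have hs : ∀ c, ∃ s, c ∈ C → n + 1 ≤ T.depth (y s) ∧ T.ancestor (n + 1) (y s) = c := by
      intro c
      by_cases h : c ∈ C
      · obtain ⟨s, hs⟩ := h.1
        exact ⟨s, fun _ ↦ hs⟩
      · exact ⟨Classical.arbitrary S, fun h' ↦ absurd h' h⟩
    choose s hs using hs
    have hinj : Set.InjOn s C := by
      intro c hc d hd hcd
      rw [← (hs c hc).2, ← (hs d hd).2, hcd]
    have hz : ∀ c ∈ C, T.ancestor n (y (s c)) = z := by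
      intro c hc
      rw [← hc.2, ← ParentTree.parent_ancestor (hs c hc).1, (hs c hc).2]
    -- Tree paths which descend from z through different children share no edges, and each one that
    -- changes the side of K t uses an edge of this finite cut.
    have hfin : ∀ t, {c ∈ C | ¬ (y (s c) ∈ K t ↔ z ∈ K t)}.Finite := by
      intro t
      have hbad : {v | (v ∈ G.componentIn A u ∧ v ≠ u) ∧ T.up v ∈ G.cut (K t)}.Finite := by
        refine Set.Finite.of_finite_image ((hK t).subset ?_) (f := T.up)
          (ParentTree.up_injOn.mono fun v hv ↦ hv.1)
        rintro _ ⟨v, hv, rfl⟩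
        exact hv.2
      refine (hbad.image (T.ancestor (n + 1))).subset ?_
      rintro c ⟨hc, hne⟩
      have hcs := hs c hc
      rw [← hz c hc] at hne
      obtain ⟨m, hm1, hm2, hm3⟩ := ParentTree.exists_up_mem_cut (hu _) (by omega) hne
      refine ⟨T.ancestor m (y (s c)), ⟨⟨ParentTree.ancestor_mem (hu _) _, T.ne_root ?_⟩, hm3⟩, ?_⟩
      · rw [ParentTree.depth_ancestor (hu _) hm2]
        omega
      · rw [ParentTree.ancestor_ancestor (hu _) hm1 hm2, hcs.2]
    -- If z is outside K (s c), every child with a smaller index is separated from z by K (s c), so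
    -- there are finitely many of them. If z is inside, the same holds for larger indices.
    have h1 : {c ∈ C | z ∉ K (s c)}.Countable := by
      refine countable_of_finite_lt (f := s) (hinj.mono fun c hc ↦ hc.1) fun c hc ↦ ?_
      refine (hfin (s c)).subset fun c' hc' ↦ ⟨hc'.1.1, fun hiff ↦ hc.2 (hiff.1 ?_)⟩
      exact (hy _ _).2 hc'.2
    have h2 : {c ∈ C | z ∈ K (s c)}.Countable := by
      refine countable_of_finite_lt (f := fun c ↦ OrderDual.toDual (s c))
        (fun c hc d hd hcd ↦ hinj hc.1 hd.1 (OrderDual.toDual.injective hcd)) fun c hc ↦ ?_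
      refine (hfin (s c)).subset fun c' hc' ↦ ⟨hc'.1.1, fun hiff ↦ ?_⟩
      exact lt_asymm ((hy _ _).1 (hiff.2 hc.2)) (OrderDual.toDual_lt_toDual.1 hc'.2)
    refine (h1.union h2).mono fun c hc ↦ ?_
    by_cases h : z ∈ K (s c)
    · exact Or.inr ⟨hc, h⟩
    · exact Or.inl ⟨hc, h⟩
  have hL : ∀ n, (L n).Countable := by
    intro n
    induction n with
    | zero =>
      refine (Set.countable_singleton u).mono ?_
      rintro _ ⟨s, -, rfl⟩
      exact ParentTree.ancestor_zero (hu s)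
    | succ n ih =>
      refine (ih.biUnion fun z _ ↦ hLstep n z).mono fun c hc ↦ ?_
      obtain ⟨s, hs, rfl⟩ := hc
      refine Set.mem_biUnion (x := T.ancestor n (y s)) ⟨s, by omega, rfl⟩ ⟨⟨s, hs, rfl⟩, ?_⟩
      exact ParentTree.parent_ancestor hs
  have hrange : (Set.range y).Countable := by
    refine (Set.countable_iUnion hL).mono ?_
    rintro _ ⟨s, rfl⟩
    exact Set.mem_iUnion.2 ⟨T.depth (y s), s, le_rfl, ParentTree.ancestor_depth _⟩
  exact Set.countable_univ_iff.1
    ((Set.mapsTo_range y Set.univ).countable_of_injOn hyinj.injOn hrange)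

end Graph


/-! ### Minimal edge sets meeting all finite cuts through an edge -/

namespace Graph

variable {V E : Type*} {G : Graph V E}

lemma cut_compl (K : Set V) : G.cut Kᶜ = G.cut K := by
  ext f
  constructor
  · rintro ⟨x, y, hl, hx, hy⟩
    exact ⟨y, x, hl.symm, not_not.1 hy, hx⟩
  · rintro ⟨x, y, hl, hx, hy⟩
    exact ⟨y, x, hl.symm, hy, not_not.2 hx⟩

/-- The cut of a set of vertices that is determined by `K` and `K'` is contained in the union of
their cuts. -/
lemma cut_subset_union {K K' L : Set V}
    (h : ∀ x y, (x ∈ K ↔ y ∈ K) → (x ∈ K' ↔ y ∈ K') → (x ∈ L ↔ y ∈ L)) :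
    G.cut L ⊆ G.cut K ∪ G.cut K' := by
  rintro f ⟨x, y, hl, hx, hy⟩
  by_contra hn
  rw [Set.mem_union, not_or] at hn
  exact hy ((h x y (hl.mem_iff_of_notMem_cut hn.1) (hl.mem_iff_of_notMem_cut hn.2)).1 hx)

/-- `A` meets all finite cuts which contain `e`. -/
def MeetsFiniteCuts (G : Graph V E) (e : E) (A : Set E) : Prop :=
  ∀ K, (G.cut K).Finite → e ∈ G.cut K → (G.cut K ∩ A).Nonempty

/-- Zorn's lemma applies because the cuts are finite: if every edge of a finite cut is missing from
some member of a chain, then one member misses the whole cut. -/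
lemma MeetsFiniteCuts.exists_minimal {e : E} {A : Set E} (h : G.MeetsFiniteCuts e A) :
    ∃ S ⊆ A, G.MeetsFiniteCuts e S ∧ ∀ S' ⊆ S, G.MeetsFiniteCuts e S' → S' = S := by
  obtain ⟨S, hS⟩ := zorn_superset {S | S ⊆ A ∧ G.MeetsFiniteCuts e S} (by
    intro c hc hchain
    rcases c.eq_empty_or_nonempty with rfl | hne
    · exact ⟨A, ⟨subset_rfl, h⟩, by simp⟩
    refine ⟨⋂₀ c, ⟨?_, fun K hK he ↦ ?_⟩, fun s hs ↦ Set.sInter_subset_of_mem hs⟩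
    · obtain ⟨s, hs⟩ := hne
      exact (Set.sInter_subset_of_mem hs).trans (hc hs).1
    · by_contra hn
      rw [Set.not_nonempty_iff_eq_empty] at hn
      have aux : ∀ D : Set E, D.Finite → D ∩ ⋂₀ c = ∅ → ∃ s ∈ c, D ∩ s = ∅ := by
        intro D hD
        induction D, hD using Set.Finite.induction_on with
        | empty => intro _; obtain ⟨s, hs⟩ := hne; exact ⟨s, hs, by simp⟩
        | @insert f D _ _ ih =>
          intro hfD
          have h1 : D ∩ ⋂₀ c = ∅ := Set.subset_empty_iff.1
            ((Set.inter_subset_inter_left _ (Set.subset_insert f D)).trans hfD.subset)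
          obtain ⟨s, hs, hDs⟩ := ih h1
          have hf : f ∉ ⋂₀ c := fun hf ↦ by
            have : f ∈ insert f D ∩ ⋂₀ c := ⟨Set.mem_insert _ _, hf⟩
            rw [hfD] at this
            exact this
          rw [Set.mem_sInter] at hf
          push Not at hf
          obtain ⟨t, ht, hft⟩ := hf
          have hmem : ∀ x, x ∈ D → x ∉ s := fun x hx hxs ↦ by
            have : x ∈ D ∩ s := ⟨hx, hxs⟩
            rw [hDs] at this
            exact this
          rcases hchain.total hs ht with hst | hts
          · refine ⟨s, hs, Set.eq_empty_iff_forall_notMem.2 ?_⟩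
            rintro x ⟨rfl | hx, hxs⟩
            · exact hft (hst hxs)
            · exact hmem x hx hxs
          · refine ⟨t, ht, Set.eq_empty_iff_forall_notMem.2 ?_⟩
            rintro x ⟨rfl | hx, hxs⟩
            · exact hft hxs
            · exact hmem x hx (hts hxs)
      obtain ⟨s, hs, hKs⟩ := aux _ hK hn
      have := (hc hs).2 K hK he
      rw [hKs] at this
      exact Set.not_nonempty_empty this)
  refine ⟨S, hS.prop.1, hS.prop.2, fun S' hS' h' ↦ ?_⟩
  exact hS'.antisymm (hS.le_of_le ⟨hS'.trans hS.prop.1, h'⟩ hS')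

/-- A set `S` of edges together with, for every edge `s` of `S`, a finite cut which meets `S ∪ {e}`
in `s` and `e` only, such that no finite cut meets `S ∪ {e}` in exactly one edge. -/
structure FundamentalCuts (G : Graph V E) (e : E) (u w : V) (S : Set E) where
  /-- the side of the cut which contains `u` -/
  side : S → Set V
  /-- the end vertex of `s` on the side of `u` -/
  fst : S → V
  /-- the end vertex of `s` on the side of `w` -/
  snd : S → V
  isLink_base : G.IsLink e u w
  notMem : e ∉ S
  finite_cut : ∀ s, (G.cut (side s)).Finite
  isLink : ∀ s : S, G.IsLink (s : E) (fst s) (snd s)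
  fst_mem_self : ∀ s, fst s ∈ side s
  snd_notMem_self : ∀ s, snd s ∉ side s
  left_mem : ∀ s, u ∈ side s
  right_notMem : ∀ s, w ∉ side s
  mem_iff : ∀ s t, s ≠ t → (fst t ∈ side s ↔ snd t ∈ side s)
  inter_ne : ∀ K, (G.cut K).Finite → ∀ f, G.cut K ∩ insert e S ≠ {f}

/-- By minimality, S ∖ {s} misses some finite cut through e, and this cut meets S in s alone. -/
theorem nonempty_fundamentalCuts {e : E} {u w : V} (he : G.IsLink e u w) {S : Set E} (heS : e ∉ S)
    (hS : G.MeetsFiniteCuts e S) (hmin : ∀ S' ⊆ S, G.MeetsFiniteCuts e S' → S' = S) :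
    Nonempty (G.FundamentalCuts e u w S) := by
  have hex : ∀ s : S, ∃ K, (G.cut K).Finite ∧ u ∈ K ∧ w ∉ K ∧ G.cut K ∩ S = {(s : E)} := by
    intro s
    have : ¬ G.MeetsFiniteCuts e (S \ {(s : E)}) := fun h ↦ by
      have h1 := hmin _ Set.sdiff_subset h
      have h2 : (s : E) ∈ S \ {(s : E)} := h1.symm.subset s.2
      exact h2.2 rfl
    unfold MeetsFiniteCuts at this
    push Not at this
    obtain ⟨K, hK, heK, hn⟩ := this
    have hcut : G.cut K ∩ S = {(s : E)} := by
      obtain ⟨f, hf⟩ := hS K hK heK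
      have hall : ∀ g ∈ G.cut K ∩ S, g = s := fun g hg ↦ by
        by_contra hne
        have : g ∈ G.cut K ∩ (S \ {(s : E)}) := ⟨hg.1, hg.2, hne⟩
        rw [hn] at this
        exact this
      refine Set.Subset.antisymm hall ?_
      rintro _ rfl
      rw [← hall f hf]
      exact hf
    have huw := he.mem_cut_iff.1 heK
    by_cases hu : u ∈ K
    · exact ⟨K, hK, hu, by tauto, hcut⟩
    · exact ⟨Kᶜ, by rwa [cut_compl], hu, fun h ↦ h (by tauto), by rwa [cut_compl]⟩
  choose K hK hu hw hcut using hex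
  have hmem : ∀ s : S, (s : E) ∈ G.cut (K s) := fun s ↦
    ((hcut s).symm ▸ rfl : (s : E) ∈ G.cut (K s) ∩ S).1
  choose x y hl hx hy using hmem
  refine ⟨⟨K, x, y, he, heS, hK, hl, hx, hy, hu, hw, fun s t hst ↦ ?_, fun L hL f hf ↦ ?_⟩⟩
  · refine (hl t).mem_iff_of_notMem_cut fun h ↦ hst ?_
    have : (t : E) ∈ G.cut (K s) ∩ S := ⟨h, t.2⟩
    rw [hcut s] at this
    exact (Subtype.ext this).symm
  · have hfm : f ∈ G.cut L ∩ insert e S := hf ▸ rfl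
    have hall : ∀ g ∈ insert e S, g ∈ G.cut L ↔ g = f := fun g hg ↦
      ⟨fun h ↦ by
        have : g ∈ G.cut L ∩ insert e S := ⟨h, hg⟩
        rwa [hf] at this, fun h ↦ h ▸ hfm.1⟩
    rcases hfm.2 with rfl | hfS
    · obtain ⟨g, hg1, hg2⟩ := hS L hL hfm.1
      have := (hall g (Or.inr hg2)).1 hg1
      exact heS (this ▸ hg2)
    · have hef : e ≠ f := by rintro rfl; exact heS hfS
      have heL : e ∉ G.cut L := fun h ↦ hef ((hall e (Set.mem_insert _ _)).1 h)
      -- The symmetric difference of L and the side belonging to f: its cut still contains e but has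
      -- lost f, so it misses S.
      let M : Set V := {v | ¬ (v ∈ L ↔ v ∈ K ⟨f, hfS⟩)}
      have hM : G.cut M ⊆ G.cut L ∪ G.cut (K ⟨f, hfS⟩) := by
        apply cut_subset_union
        intro x y h1 h2
        simp only [M, Set.mem_ofPred_eq, h1, h2]
      have heM : e ∈ G.cut M := by
        rw [he.mem_cut_iff]
        have h1 := he.mem_iff_of_notMem_cut heL
        have h2 := hu ⟨f, hfS⟩
        have h3 := hw ⟨f, hfS⟩
        simp only [M, Set.mem_ofPred_eq]
        tauto
      obtain ⟨g, hg1, hg2⟩ := hS M ((hL.union (hK _)).subset hM) heM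
      have hgf : g = f := by
        rcases hM hg1 with h | h
        · exact (hall g (Or.inr hg2)).1 h
        · have : g ∈ G.cut (K ⟨f, hfS⟩) ∩ S := ⟨h, hg2⟩
          rw [hcut] at this
          exact this
      subst hgf
      have h1 := (hl ⟨g, hfS⟩).mem_cut_iff.1 hg1
      have h2 := (hl ⟨g, hfS⟩).mem_cut_iff.1 hfm.1
      have h3 := hx ⟨g, hfS⟩
      have h4 := hy ⟨g, hfS⟩
      simp only [M, Set.mem_ofPred_eq] at h1
      tauto

namespace FundamentalCuts

variable {e : E} {u w : V} {S : Set E} (Φ : G.FundamentalCuts e u w S)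

lemma mem_insert_cases {P : E → Prop} (he : P e) (hS : ∀ s : S, P s) : ∀ f ∈ insert e S, P f := by
  rintro f (rfl | hf)
  · exact he
  · exact hS ⟨f, hf⟩

/-- There is no finite cut which separates `u` from `w` but no edge of `S`. -/
lemma false_of_cut {L : Set V} (hL : (G.cut L).Finite) (hu : u ∈ L) (hw : w ∉ L)
    (h : ∀ s, Φ.fst s ∈ L ↔ Φ.snd s ∈ L) : False := by
  refine Φ.inter_ne L hL e (Set.Subset.antisymm ?_ ?_)
  · rintro f ⟨hf, rfl | hfS⟩
    · rfl
    · exact absurd (h ⟨f, hfS⟩) ((Φ.isLink ⟨f, hfS⟩).mem_cut_iff.1 hf)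
  · rintro _ rfl
    exact ⟨⟨u, w, Φ.isLink_base, hu, hw⟩, Set.mem_insert _ _⟩

/-- The order in which the edges of `S` are traversed. -/
def Before (t s : S) : Prop := t ≠ s ∧ Φ.fst t ∈ Φ.side s

/-- Here and in the next two lemmas, a violation of the order axioms makes a union or intersection
of sides a set whose finite cut separates u from w and avoids S. -/
lemma not_before_and_before {s t : S} (h : Φ.Before t s) (h' : Φ.Before s t) : False := by
  refine Φ.false_of_cut (L := Φ.side s ∪ Φ.side t)
    (((Φ.finite_cut s).union (Φ.finite_cut t)).subset (cut_subset_union fun x y h1 h2 ↦ by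
      simp only [Set.mem_union, h1, h2])) (Or.inl (Φ.left_mem s))
    (fun h ↦ h.elim (Φ.right_notMem s) (Φ.right_notMem t)) fun r ↦ ?_
  simp only [Set.mem_union]
  rcases eq_or_ne s r with rfl | hsr
  · have h1 := (Φ.mem_iff t s h.1).1 h'.2
    have h2 := Φ.fst_mem_self s
    tauto
  · rcases eq_or_ne t r with rfl | htr
    · have h1 := (Φ.mem_iff s t hsr).1 h.2
      have h2 := Φ.fst_mem_self t
      tauto
    · rw [Φ.mem_iff s r hsr, Φ.mem_iff t r htr]

lemma before_or_before {s t : S} (hst : s ≠ t) : Φ.Before s t ∨ Φ.Before t s := by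
  by_contra hn
  rw [not_or] at hn
  have h1 : Φ.fst s ∉ Φ.side t := fun h ↦ hn.1 ⟨hst, h⟩
  have h2 : Φ.fst t ∉ Φ.side s := fun h ↦ hn.2 ⟨hst.symm, h⟩
  refine Φ.false_of_cut (L := Φ.side s ∩ Φ.side t)
    (((Φ.finite_cut s).union (Φ.finite_cut t)).subset (cut_subset_union fun x y h1 h2 ↦ by
      simp only [Set.mem_inter_iff, h1, h2])) ⟨Φ.left_mem s, Φ.left_mem t⟩
    (fun h ↦ Φ.right_notMem s h.1) fun r ↦ ?_
  simp only [Set.mem_inter_iff]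
  rcases eq_or_ne s r with rfl | hsr
  · have := Φ.mem_iff t s hst.symm
    tauto
  · rcases eq_or_ne t r with rfl | htr
    · have := Φ.mem_iff s t hsr
      tauto
    · rw [Φ.mem_iff s r hsr, Φ.mem_iff t r htr]

lemma Before.trans {Φ : G.FundamentalCuts e u w S} {r s t : S} (h : Φ.Before r s)
    (h' : Φ.Before s t) : Φ.Before r t := by
  by_contra hn
  have hrt : r ≠ t := by
    rintro rfl
    exact Φ.not_before_and_before h h'
  have h'' := (Φ.before_or_before hrt).resolve_left hn
  refine Φ.false_of_cut (L := Φ.side r ∪ (Φ.side s ∪ Φ.side t)) ?_ (Or.inl (Φ.left_mem r))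
    (fun h ↦ h.elim (Φ.right_notMem r) fun h ↦ h.elim (Φ.right_notMem s) (Φ.right_notMem t))
    fun q ↦ ?_
  · refine ((Φ.finite_cut r).union ((Φ.finite_cut s).union (Φ.finite_cut t))).subset ?_
    refine (cut_subset_union fun x y h1 h2 ↦ ?_).trans (Set.union_subset_union_right _
      (cut_subset_union (K := Φ.side s) (K' := Φ.side t) (L := Φ.side s ∪ Φ.side t)
        fun x y h1 h2 ↦ ?_))
    · simp only [Set.mem_union] at h1 h2 ⊢; tauto
    · simp only [Set.mem_union]; tauto
  have h1 := Φ.fst_mem_self q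
  simp only [Set.mem_union]
  rcases eq_or_ne r q with rfl | hr
  · have := (Φ.mem_iff s r h.1.symm).1 h.2
    tauto
  rcases eq_or_ne s q with rfl | hs
  · have := (Φ.mem_iff t s h'.1.symm).1 h'.2
    tauto
  rcases eq_or_ne t q with rfl | ht
  · have := (Φ.mem_iff r t h''.1.symm).1 h''.2
    tauto
  rw [Φ.mem_iff r q hr, Φ.mem_iff s q hs, Φ.mem_iff t q ht]

open Classical in
/-- The edges of `S` in the order of traversal from `u` to `w`. -/
@[reducible]
noncomputable def linearOrder : LinearOrder S where
  le s t := s = t ∨ Φ.Before s t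
  lt := Φ.Before
  le_refl s := Or.inl rfl
  le_trans := by
    rintro r s t (rfl | h) (rfl | h')
    · exact Or.inl rfl
    · exact Or.inr h'
    · exact Or.inr h
    · exact Or.inr (h.trans h')
  lt_iff_le_not_ge s t := by
    constructor
    · intro h
      exact ⟨Or.inr h, fun h' ↦ h'.elim (fun h'' ↦ h.1 h''.symm) (Φ.not_before_and_before h)⟩
    · rintro ⟨rfl | h, h'⟩
      · exact absurd (Or.inl rfl) h'
      · exact h
  le_antisymm := by
    rintro s t (rfl | h) (h' | h')
    · rfl
    · rfl
    · exact h'.symm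
    · exact (Φ.not_before_and_before h h').elim
  le_total s t := by
    rcases eq_or_ne s t with rfl | h
    · exact Or.inl (Or.inl rfl)
    · exact (Φ.before_or_before h).imp Or.inr Or.inr
  toDecidableLE := Classical.decRel _

lemma fst_mem_side_iff {s t : S} (hst : t ≠ s) : Φ.fst t ∈ Φ.side s ↔ Φ.Before t s :=
  ⟨fun h ↦ ⟨hst, h⟩, fun h ↦ h.2⟩

lemma snd_mem_side_iff {s t : S} : Φ.snd t ∈ Φ.side s ↔ Φ.Before t s := by
  rcases eq_or_ne t s with rfl | hst
  · exact ⟨fun h ↦ absurd h (Φ.snd_notMem_self t), fun h ↦ absurd rfl h.1⟩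
  · rw [← Φ.mem_iff s t hst.symm, Φ.fst_mem_side_iff hst]

/-- Let `L` be one side of a finite cut which meets `S ∪ {e}` in `f` and `g` only. Then the ends of
`f` and `g` in `L` are on the same side of every finite cut which does not contain edges of
`S ∪ {e}` in between. -/
lemma mem_of_mem (Φ : G.FundamentalCuts e u w S) {L K : Set V} (hL : (G.cut L).Finite) (hK : (G.cut K).Finite) {f g : E}
    {p p' q q' : V} (hf : f ∈ insert e S) (hlf : G.IsLink f p p') (hlg : G.IsLink g q q')
    (hp : p ∈ L) (hp' : p' ∉ L) (hq' : q' ∉ L)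
    (h : ∀ k ∈ insert e S, k ≠ f → k ≠ g → ∀ a b, G.IsLink k a b →
      (a ∈ L ↔ b ∈ L) ∧ (k ∈ G.cut K → a ∉ L)) (hpK : p ∈ K) : q ∈ K := by
  by_contra hqK
  -- If p is in K and q is not, the finite cut of K ∩ L meets S ∪ {e} in f only.
  refine Φ.inter_ne (K ∩ L) ((hK.union hL).subset (cut_subset_union fun x y h1 h2 ↦ by
    simp only [Set.mem_inter_iff, h1, h2])) f (Set.Subset.antisymm ?_ ?_)
  · rintro k ⟨⟨a, b, hl, ha, hb⟩, hkS⟩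
    by_contra hkf
    by_cases hkg : k = g
    · subst hkg
      rcases hl.left_eq_or_eq hlg with rfl | rfl
      · exact hqK ha.1
      · exact hq' ha.2
    · obtain ⟨h1, h2⟩ := h k hkS hkf hkg a b hl
      have h3 : k ∉ G.cut K := fun h' ↦ h2 h' ha.2
      exact hb ⟨(hl.mem_iff_of_notMem_cut h3).1 ha.1, h1.1 ha.2⟩
  · rintro _ rfl
    exact ⟨⟨p, p', hlf, ⟨hpK, hp⟩, fun h' ↦ hp' h'.2⟩, hf⟩

lemma mem_iff_mem (Φ : G.FundamentalCuts e u w S) {L K : Set V} (hL : (G.cut L).Finite) (hK : (G.cut K).Finite) {f g : E}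
    {p p' q q' : V} (hf : f ∈ insert e S) (hg : g ∈ insert e S) (hlf : G.IsLink f p p')
    (hlg : G.IsLink g q q') (hp : p ∈ L) (hp' : p' ∉ L) (hq : q ∈ L) (hq' : q' ∉ L)
    (h : ∀ k ∈ insert e S, k ≠ f → k ≠ g → ∀ a b, G.IsLink k a b →
      (a ∈ L ↔ b ∈ L) ∧ (k ∈ G.cut K → a ∉ L)) : p ∈ K ↔ q ∈ K :=
  ⟨Φ.mem_of_mem hL hK hf hlf hlg hp hp' hq' h,
    Φ.mem_of_mem hL hK hg hlg hlf hq hq' hp' fun k hk h1 h2 ↦ h k hk h2 h1⟩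

/-- The circular order given by fundamental cuts. -/
noncomputable def circularOrder :
    letI := Φ.linearOrder
    G.CircularOrder (WithTop S) :=
  letI := Φ.linearOrder
  -- The top element stands for e, which is traversed last, from w back to u.
  { edge := fun i ↦ i.recTopCoe e fun s ↦ s
    fst := fun i ↦ i.recTopCoe w Φ.fst
    snd := fun i ↦ i.recTopCoe u Φ.snd
    start := u
    edge_injective := by
      intro i j hij
      induction i using WithTop.recTopCoe with
      | top =>
        induction j using WithTop.recTopCoe with
        | top => rfl
        | coe t =>
          have hij : e = (t : E) := hij
          exact absurd (by rw [hij]; exact t.2) Φ.notMem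
      | coe s =>
        induction j using WithTop.recTopCoe with
        | top =>
          have hij : (s : E) = e := hij
          exact absurd (by rw [← hij]; exact s.2) Φ.notMem
        | coe t => exact congrArg _ (Subtype.ext hij)
    isLink := by
      intro i
      induction i using WithTop.recTopCoe with
      | top => exact Φ.isLink_base.symm
      | coe s => exact Φ.isLink s
    start_mem := Φ.isLink_base.left_mem }

/-- Each stretch of the circle between two edges is cut out by a finite cut: by `side t` from e to
t, by the complement of `side s` from s to e, and by `side t \ side s` from s to t. If no edge of F
lies on the stretch, `mem_iff_mem` shows that its two ends are on the same side of K. The same sets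
are the cuts required for pairs of edges. -/
lemma isCompatible_circularOrder :
    letI := Φ.linearOrder
    Φ.circularOrder.IsCompatible := by
  let _ := Φ.linearOrder
  have hlt : ∀ s t : S, s < t ↔ Φ.Before s t := fun s t ↦ Iff.rfl
  have hdiff : ∀ s t : S, (G.cut (Φ.side t \ Φ.side s)).Finite := fun s t ↦
    ((Φ.finite_cut t).union (Φ.finite_cut s)).subset (cut_subset_union fun x y h1 h2 ↦ by
      simp only [Set.mem_sdiff, h1, h2])
  have hends : ∀ r s : S, r ≠ s → ∀ a b, G.IsLink r a b →
      (a ∈ Φ.side s ↔ b ∈ Φ.side s) ∧ (a ∈ Φ.side s ↔ Φ.Before r s) := by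
    intro r s hrs a b hl
    have h1 := Φ.mem_iff s r hrs.symm
    have h2 := Φ.fst_mem_side_iff hrs
    rcases hl.eq_and_eq_or_eq_and_eq (Φ.isLink r) with ⟨rfl, rfl⟩ | ⟨rfl, rfl⟩ <;> tauto
  have hebase : ∀ a b, G.IsLink e a b → (a = u ∧ b = w) ∨ (a = w ∧ b = u) := fun a b hl ↦
    hl.eq_and_eq_or_eq_and_eq Φ.isLink_base
  have hfst : ∀ (F : Finset E) (K : Set V), G.cut K ⊆ F → ∀ i,
      Φ.circularOrder.fst i ∈ K ↔
        Φ.circularOrder.last (Φ.circularOrder.within F (Set.Iio i)) ∈ K := by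
    intro F K hKF i
    have hK : (G.cut K).Finite := F.finite_toSet.subset hKF
    rcases (Φ.circularOrder.within F (Set.Iio i)).eq_empty_or_nonempty with hZ | hZ
    · rw [CircularOrder.last_of_empty hZ]
      have hZ' : ∀ r : S, (r : E) ∈ F → ¬ ((r : WithTop S) < i) := fun r hr hri ↦ by
        have : (r : WithTop S) ∈ Φ.circularOrder.within F (Set.Iio i) :=
          CircularOrder.mem_within.2 ⟨hr, hri⟩
        rw [hZ] at this
        simp at this
      induction i using WithTop.recTopCoe with
      | top =>
        show w ∈ K ↔ u ∈ K
        by_contra hne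
        refine Φ.inter_ne K hK e (Set.Subset.antisymm ?_ ?_)
        · rintro f ⟨hf, rfl | hfS⟩
          · rfl
          · exact absurd (WithTop.coe_lt_top _) (hZ' ⟨f, hfS⟩ (hKF hf))
        · rintro _ rfl
          refine ⟨?_, Set.mem_insert _ _⟩
          rw [Φ.isLink_base.mem_cut_iff]
          tauto
      | coe t =>
        show Φ.fst t ∈ K ↔ u ∈ K
        refine Φ.mem_iff_mem (L := Φ.side t) (Φ.finite_cut t) hK (Or.inr t.2)
          (Set.mem_insert _ _) (Φ.isLink t) Φ.isLink_base (Φ.fst_mem_self t)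
          (Φ.snd_notMem_self t) (Φ.left_mem t) (Φ.right_notMem t) (mem_insert_cases ?_ ?_)
        · intro _ h; exact absurd rfl h
        · intro r hrt _ a b hl
          have hrt : r ≠ t := fun h ↦ hrt (congrArg _ h)
          refine ⟨(hends r t hrt a b hl).1, fun hrK ha ↦ ?_⟩
          exact hZ' r (hKF hrK) (WithTop.coe_lt_coe.2 ((hends r t hrt a b hl).2.1 ha))
    · have hm := Finset.max'_mem _ hZ
      have hgr := Finset.isGreatest_max' _ hZ
      generalize (Φ.circularOrder.within F (Set.Iio i)).max' hZ = m at hm hgr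
      rw [CircularOrder.last_of_isGreatest hgr]
      obtain ⟨hmF, hmi⟩ := CircularOrder.mem_within.1 hm
      induction m using WithTop.recTopCoe with
      | top => exact absurd (Set.mem_Iio.1 hmi) not_top_lt
      | coe s =>
      have hgr' : ∀ r : S, (r : E) ∈ F → (r : WithTop S) < i → r ≠ s → Φ.Before r s := by
        intro r hr hri hrs
        have h1 : (r : WithTop S) ∈ Φ.circularOrder.within F (Set.Iio i) :=
          CircularOrder.mem_within.2 ⟨hr, hri⟩
        exact (WithTop.coe_le_coe.1 (hgr.2 h1)).lt_of_ne hrs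
      induction i using WithTop.recTopCoe with
      | top =>
        show w ∈ K ↔ Φ.snd s ∈ K
        refine Φ.mem_iff_mem (L := (Φ.side s)ᶜ) (by rw [cut_compl]; exact Φ.finite_cut s) hK
          (Set.mem_insert _ _) (Or.inr s.2) Φ.isLink_base.symm (Φ.isLink s).symm (Φ.right_notMem s)
          (fun h ↦ h (Φ.left_mem s)) (Φ.snd_notMem_self s) (fun h ↦ h (Φ.fst_mem_self s))
          (mem_insert_cases ?_ ?_)
        · intro h; exact absurd rfl h
        · intro r _ hrs a b hl
          have hrs : r ≠ s := fun h ↦ hrs (congrArg _ h)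
          have h1 := hends r s hrs a b hl
          refine ⟨not_congr h1.1, fun hrK ha ↦ ha (h1.2.2 ?_)⟩
          exact hgr' r (hKF hrK) (WithTop.coe_lt_top _) hrs
      | coe t =>
        show Φ.fst t ∈ K ↔ Φ.snd s ∈ K
        have hst : Φ.Before s t := WithTop.coe_lt_coe.1 (Set.mem_Iio.1 hmi)
        have hts : ¬ Φ.Before t s := Φ.not_before_and_before hst
        refine Φ.mem_iff_mem (L := Φ.side t \ Φ.side s) (hdiff s t) hK
          (Or.inr t.2) (Or.inr s.2) (Φ.isLink t) (Φ.isLink s).symm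
          ⟨Φ.fst_mem_self t, fun h ↦ hts ((Φ.fst_mem_side_iff hst.1.symm).1 h)⟩
          (fun h ↦ Φ.snd_notMem_self t h.1)
          ⟨Φ.snd_mem_side_iff.2 hst, Φ.snd_notMem_self s⟩
          (fun h ↦ h.2 (Φ.fst_mem_self s)) (mem_insert_cases ?_ ?_)
        · intro _ _ a b hl
          have h1 := Φ.left_mem s
          have h2 := Φ.right_notMem t
          rcases hebase a b hl with ⟨rfl, rfl⟩ | ⟨rfl, rfl⟩
          · exact ⟨⟨fun h ↦ absurd h1 h.2, fun h ↦ absurd h.1 h2⟩, fun _ h ↦ h.2 h1⟩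
          · exact ⟨⟨fun h ↦ absurd h.1 h2, fun h ↦ absurd h1 h.2⟩, fun _ h ↦ h2 h.1⟩
        · intro r hrt hrs a b hl
          have hrt : r ≠ t := fun h ↦ hrt (congrArg _ h)
          have hrs : r ≠ s := fun h ↦ hrs (congrArg _ h)
          have h1 := hends r s hrs a b hl
          have h2 := hends r t hrt a b hl
          refine ⟨and_congr h2.1 (not_congr h1.1), fun hrK ha ↦ ha.2 (h1.2.2 ?_)⟩
          exact hgr' r (hKF hrK) (WithTop.coe_lt_coe.2 (h2.2.1 ha.1)) hrs
  refine ⟨hfst, fun F K hKF ↦ ?_, fun i j hij ↦ ?_⟩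
  · show u ∈ K ↔ _
    by_cases he : e ∈ F
    · rw [CircularOrder.last_of_isGreatest (i := ⊤)]
      · rfl
      · exact ⟨CircularOrder.mem_within.2 ⟨he, trivial⟩, fun k _ ↦ le_top⟩
    · have h1 := hfst F K hKF ⊤
      have h2 : Φ.circularOrder.within F Set.univ = Φ.circularOrder.within F (Set.Iio ⊤) := by
        ext k
        rw [CircularOrder.mem_within, CircularOrder.mem_within]
        refine and_congr_right fun hk ↦ ⟨fun _ ↦ Set.mem_Iio.2 (lt_top_iff_ne_top.2 ?_), fun _ ↦ trivial⟩
        rintro rfl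
        exact he hk
      rw [h2, ← h1]
      exact Φ.isLink_base.mem_iff_of_notMem_cut fun h ↦ he (hKF h)
  · induction i using WithTop.recTopCoe with
    | top => exact absurd hij not_top_lt
    | coe s =>
    induction j using WithTop.recTopCoe with
    | top =>
      refine ⟨(Φ.side s)ᶜ, by rw [cut_compl]; exact Φ.finite_cut s, fun k ↦ ?_,
        Φ.snd_notMem_self s, fun h ↦ h (Φ.left_mem s), fun h ↦ h (Φ.left_mem s)⟩
      rw [cut_compl]
      induction k using WithTop.recTopCoe with
      | top =>
        simp only [or_true, iff_true]
        exact ⟨u, w, Φ.isLink_base, Φ.left_mem s, Φ.right_notMem s⟩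
      | coe r =>
        rw [WithTop.coe_inj]
        simp only [WithTop.coe_ne_top, or_false]
        constructor
        · intro h
          by_contra hrs
          exact (Φ.isLink r).mem_cut_iff.1 h (Φ.mem_iff s r (Ne.symm hrs))
        · rintro rfl
          exact ⟨_, _, Φ.isLink r, Φ.fst_mem_self r, Φ.snd_notMem_self r⟩
    | coe t =>
      have hst : Φ.Before s t := WithTop.coe_lt_coe.1 hij
      have hts : ¬ Φ.Before t s := Φ.not_before_and_before hst
      refine ⟨Φ.side t \ Φ.side s, hdiff s t, fun k ↦ ?_,
        ⟨Φ.snd_mem_side_iff.2 hst, Φ.snd_notMem_self s⟩, fun h ↦ Φ.snd_notMem_self t h.1,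
        fun h ↦ h.2 (Φ.left_mem s)⟩
      induction k using WithTop.recTopCoe with
      | top =>
        simp only [WithTop.top_ne_coe, or_false, iff_false]
        intro h
        refine Φ.isLink_base.mem_cut_iff.1 h ⟨fun h ↦ absurd (Φ.left_mem s) h.2,
          fun h ↦ absurd h.1 (Φ.right_notMem t)⟩
      | coe r =>
        rw [WithTop.coe_inj, WithTop.coe_inj]
        have hl := Φ.isLink r
        constructor
        · intro h
          by_contra! hr
          exact hl.mem_cut_iff.1 h (and_congr (Φ.mem_iff t r hr.2.symm)
            (not_congr (Φ.mem_iff s r hr.1.symm)))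
        · rintro (rfl | rfl)
          · exact ⟨_, _, hl.symm, ⟨Φ.snd_mem_side_iff.2 hst, Φ.snd_notMem_self r⟩,
              fun h ↦ h.2 (Φ.fst_mem_self r)⟩
          · exact ⟨_, _, hl, ⟨Φ.fst_mem_self r,
              fun h ↦ hts ((Φ.fst_mem_side_iff hst.1.symm).1 h)⟩,
              fun h ↦ Φ.snd_notMem_self r h.1⟩

lemma range_edge_circularOrder (Φ : G.FundamentalCuts e u w S) :
    letI := Φ.linearOrder
    Set.range Φ.circularOrder.edge = insert e S := by
  let _ := Φ.linearOrder
  ext f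
  constructor
  · rintro ⟨i, rfl⟩
    induction i using WithTop.recTopCoe with
    | top => exact Or.inl rfl
    | coe s => exact Or.inr s.2
  · rintro (rfl | hf)
    · exact ⟨⊤, rfl⟩
    · exact ⟨((⟨f, hf⟩ : S) : WithTop S), rfl⟩

theorem isTopologicalCycle (Φ : G.FundamentalCuts e u w S) : G.IsTopologicalCycle (insert e S) := by
  let _ := Φ.linearOrder
  have : Nonempty E := ⟨e⟩
  -- The component of u has an empty cut, so compatibility with this cut puts all edges of S into
  -- it. Countability needs this connectedness.
  have hu : ∀ s, Φ.snd s ∈ G.componentIn Set.univ u := by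
    intro s
    have hcut : G.cut (G.componentIn Set.univ u) ⊆ (∅ : Finset E) := by
      intro f hf
      exact absurd hf (Set.disjoint_left.1 (G.disjoint_cut_componentIn Set.univ u) trivial)
    have h1 := Φ.isCompatible_circularOrder.fst_mem_iff ∅ _ hcut s
    rw [CircularOrder.last_of_empty (Finset.eq_empty_of_forall_notMem fun i hi ↦ by
      simpa using (CircularOrder.mem_within.1 hi).1)] at h1
    have h2 : Φ.fst s ∈ G.componentIn Set.univ u := h1.2 (Joined.refl _ _ _)
    exact h2.trans ((Φ.isLink s).joined trivial)
  have : Countable S := countable_of_finite_cuts Φ.finite_cut (fun s t ↦ Φ.snd_mem_side_iff) hu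
  have : Countable (WithTop S) := inferInstanceAs (Countable (Option S))
  have h := Φ.isCompatible_circularOrder.isTopologicalCycle
  rwa [Φ.range_edge_circularOrder] at h

end FundamentalCuts

end Graph


/-! ### Topological circles and finite cuts -/

namespace Graph

variable {V E : Type*} {G : Graph V E}

namespace EndSpace

/-- One side of a cut contained in `F`, where the edges of `F` are cut at the points `τ`. -/
def side (F : Finset E) (τ : G.edgeSet → Set.Ioo (0 : ℝ) 1) (K : Set V) : Set (EndSpace G) :=
  {p | match p with
    | dir d => d.comp F ⊆ K
    | inner e t => (G.src e ∈ K ∧ ((e : E) ∈ F → t < τ e)) ∨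
        (G.tgt e ∈ K ∧ ((e : E) ∈ F → τ e < t))}

variable {F : Finset E} {τ : G.edgeSet → Set.Ioo (0 : ℝ) 1} {K : Set V}

lemma dir_mem_side {d : G.EdgeDirection} : dir d ∈ side F τ K ↔ d.comp F ⊆ K := Iff.rfl

lemma inner_mem_side {e : G.edgeSet} {t : Set.Ioo (0 : ℝ) 1} :
    inner e t ∈ side F τ K ↔ (G.src e ∈ K ∧ ((e : E) ∈ F → t < τ e)) ∨
      (G.tgt e ∈ K ∧ ((e : E) ∈ F → τ e < t)) := Iff.rfl

lemma exists_forall_le (F : Finset E) (τ : G.edgeSet → Set.Ioo (0 : ℝ) 1) :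
    ∃ ε : ℝ, 0 < ε ∧ ∀ g : G.edgeSet, (g : E) ∈ F → ε ≤ τ g ∧ ε ≤ 1 - τ g := by
  classical
  induction F using Finset.induction_on with
  | empty => exact ⟨1, one_pos, by simp⟩
  | insert a F ha ih =>
    obtain ⟨ε, hε, h⟩ := ih
    by_cases haE : a ∈ G.edgeSet
    · obtain ⟨h0, h1⟩ := (τ ⟨a, haE⟩).2
      refine ⟨min ε (min (τ ⟨a, haE⟩) (1 - τ ⟨a, haE⟩)),
        lt_min hε (lt_min h0 (by linarith)), fun g hg ↦ ?_⟩
      rcases Finset.mem_insert.1 hg with hg | hg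
      · obtain rfl : g = ⟨a, haE⟩ := Subtype.ext hg
        exact ⟨(min_le_right _ _).trans (min_le_left _ _),
          (min_le_right _ _).trans (min_le_right _ _)⟩
      · exact ⟨(min_le_left _ _).trans (h g hg).1, (min_le_left _ _).trans (h g hg).2⟩
    · refine ⟨ε, hε, fun g hg ↦ ?_⟩
      rcases Finset.mem_insert.1 hg with hg | hg
      · exact absurd (hg ▸ g.2) haE
      · exact h g hg

lemma isOpen_side (F : Finset E) (τ : G.edgeSet → Set.Ioo (0 : ℝ) 1) (K : Set V) :
    IsOpen (side F τ K) := by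
  rw [isOpen_iff_forall_mem_open]
  intro p hp
  cases p with
  | dir d =>
    obtain ⟨ε, hε, h⟩ := exists_forall_le F τ
    refine ⟨basicNhd F (d.comp F) ε, fun q hq ↦ ?_, isOpen_basicNhd d F hε, rfl⟩
    rw [dir_mem_side] at hp
    cases q with
    | dir d' =>
      rw [dir_mem_basicNhd] at hq
      rw [dir_mem_side, hq]
      exact hp
    | inner e t =>
      rw [inner_mem_basicNhd] at hq
      rw [inner_mem_side]
      refine hq.imp (fun h1 ↦ ⟨hp h1.1, fun he ↦ ?_⟩) (fun h1 ↦ ⟨hp h1.1, fun he ↦ ?_⟩)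
      · exact Subtype.coe_lt_coe.1 ((h1.2 he).trans_le (h e he).1)
      · have h2 := h1.2 he
        have h3 := (h e he).2
        exact Subtype.coe_lt_coe.1 (by linarith)
  | inner e t =>
    refine ⟨inner e '' {s | inner e s ∈ side F τ K}, ?_, isOpen_inner_image e ?_, ⟨t, hp, rfl⟩⟩
    · rintro _ ⟨s, hs, rfl⟩
      exact hs
    · simp only [inner_mem_side]
      refine IsOpen.union (s₁ := {s | _ ∧ _}) (s₂ := {s | _ ∧ _})
        (IsOpen.and isOpen_const ?_) (IsOpen.and isOpen_const ?_)
      · by_cases he : (e : E) ∈ F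
        · simp only [he, true_imp_iff]
          exact isOpen_Iio
        · simp [he]
      · by_cases he : (e : E) ∈ F
        · simp only [he, true_imp_iff]
          exact isOpen_Ioi
        · simp [he]

lemma disjoint_side_compl (hK : G.cut K ⊆ F) : Disjoint (side F τ K) (side F τ Kᶜ) := by
  rw [Set.disjoint_left]
  intro p hp hp'
  cases p with
  | dir d =>
    obtain ⟨v, -, hv⟩ := d.exists_eq_comp F
    have h := mem_componentAvoiding_self (G := G) F v
    rw [← hv] at h
    exact hp' h (hp h)
  | inner e t =>
    rw [inner_mem_side] at hp hp'
    have hl := isLink_src_tgt e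
    have h1 : ¬ (G.src e ∈ K ↔ G.tgt e ∈ K) → (e : E) ∈ F := fun h ↦ hK (hl.mem_cut_iff.2 h)
    simp only [Set.mem_compl_iff] at hp'
    rcases hp with ⟨h2, h3⟩ | ⟨h2, h3⟩ <;> rcases hp' with ⟨h4, h5⟩ | ⟨h4, h5⟩
    · exact h4 h2
    · have h6 := h1 (by tauto)
      exact (h3 h6).asymm (h5 h6)
    · have h6 := h1 (by tauto)
      exact (h3 h6).asymm (h5 h6)
    · exact h4 h2

lemma mem_side_or_mem_side_compl (hK : G.cut K = F) {p : EndSpace G}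
    (hp : ∀ g : G.edgeSet, (g : E) ∈ F → p ≠ inner g (τ g)) :
    p ∈ side F τ K ∨ p ∈ side F τ Kᶜ := by
  cases p with
  | dir d =>
    obtain ⟨v, -, hv⟩ := d.exists_eq_comp F
    rw [dir_mem_side, dir_mem_side, hv]
    by_cases h : v ∈ K
    · exact Or.inl fun x hx ↦ (mem_iff_of_mem_componentAvoiding hK.subset hx).1 h
    · exact Or.inr fun x hx hxK ↦ h ((mem_iff_of_mem_componentAvoiding hK.subset hx).2 hxK)
  | inner e t =>
    rw [inner_mem_side, inner_mem_side]
    have hl := isLink_src_tgt e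
    have h1 : (e : E) ∈ F ↔ ¬ (G.src e ∈ K ↔ G.tgt e ∈ K) := by
      rw [← hl.mem_cut_iff, hK, Finset.mem_coe]
    have h2 : (e : E) ∈ F → t < τ e ∨ τ e < t := fun he ↦ lt_or_gt_of_ne fun h ↦
      hp e he (by rw [h])
    simp only [Set.mem_compl_iff]
    tauto

end EndSpace

/-- Starting from the antipode of p, the rest of the circle is the image of the open interval from
-π to π. -/
lemma isPreconnected_compl_singleton_circle (p : Circle) : IsPreconnected ({p}ᶜ : Set Circle) := by
  have h : ({p}ᶜ : Set Circle) =
      (fun t : ℝ ↦ p * Circle.exp Real.pi * Circle.exp t) '' Set.Ioo (-Real.pi) Real.pi := by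
    ext q
    constructor
    · intro hq
      have hexp := Circle.exp_arg ((p * Circle.exp Real.pi)⁻¹ * q)
      refine ⟨Complex.arg ((p * Circle.exp Real.pi)⁻¹ * q : Circle), ⟨Complex.neg_pi_lt_arg _,
        lt_of_le_of_ne (Complex.arg_le_pi _) fun h ↦ hq ?_⟩, ?_⟩
      · rw [h] at hexp
        have h2 : Circle.exp Real.pi * Circle.exp Real.pi = 1 := by
          rw [← Circle.exp_add, ← two_mul, Circle.exp_two_pi]
        have : q = p * (Circle.exp Real.pi * Circle.exp Real.pi) := by
          rw [← mul_assoc]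
          exact (eq_inv_mul_iff_mul_eq.1 hexp).symm
        rw [this, h2, mul_one]; rfl
      · dsimp only
        rw [hexp, mul_inv_cancel_left]
    · rintro ⟨t, ⟨ht, ht'⟩, rfl⟩ h
      have h : p * Circle.exp Real.pi * Circle.exp t = p := h
      rw [mul_assoc, mul_eq_left, ← Circle.exp_two_pi, two_mul,
        Circle.exp_add Real.pi Real.pi] at h
      have h := congrArg (fun z : Circle ↦ Complex.arg z) (mul_left_cancel h)
      rw [Circle.arg_exp ht ht'.le, Circle.arg_exp (by linarith) le_rfl] at h
      exact ht'.ne h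
  rw [h]
  refine isPreconnected_Ioo.image _ (Continuous.continuousOn ?_)
  fun_prop

/-- A topological circle does not meet a finite cut in exactly one edge. -/
theorem IsTopologicalCycle.inter_cut_ne {C : Set E} (hC : G.IsTopologicalCycle C) {K : Set V}
    (hK : (G.cut K).Finite) (e : E) : C ∩ G.cut K ≠ {e} := by
  classical
  obtain ⟨f, hf, hCf⟩ := hC
  intro hCe
  have heC : e ∈ C ∩ G.cut K := hCe ▸ rfl
  have heC' := heC.1
  rw [hCf] at heC'
  obtain ⟨heE, he⟩ := heC'
  obtain ⟨p, hp⟩ := he ⟨1 / 2, by norm_num, by norm_num⟩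
  -- Cut points are chosen at the middle of e and, on the other edges of the cut, at points missed
  -- by the circle. The circle without the middle of e avoids them all, so it lies in two disjoint
  -- open sides; the quarter points of e show that it meets both.
  have hτ : ∀ g : G.edgeSet, ∃ t : Set.Ioo (0 : ℝ) 1,
      ((g : E) = e → (t : ℝ) = 1 / 2) ∧
      ((g : E) ∈ G.cut K → (g : E) ≠ e → EndSpace.inner g t ∉ Set.range f) := by
    intro g
    by_cases hge : (g : E) = e
    · exact ⟨⟨1 / 2, by norm_num, by norm_num⟩, fun _ ↦ rfl, fun _ h ↦ absurd hge h⟩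
    by_cases hg : (g : E) ∈ G.cut K
    · have : (g : E) ∉ C := fun h ↦ hge (hCe.subset ⟨h, hg⟩)
      rw [hCf] at this
      have : ¬ ∀ t, EndSpace.inner g t ∈ Set.range f := fun h ↦ this ⟨g.2, h⟩
      push Not at this
      obtain ⟨t, ht⟩ := this
      exact ⟨t, fun h ↦ absurd h hge, fun _ _ ↦ ht⟩
    · exact ⟨⟨1 / 2, by norm_num, by norm_num⟩, fun _ ↦ rfl, fun h ↦ absurd h hg⟩
  choose τ hτe hτ using hτ
  have hF : G.cut K = hK.toFinset := by simp
  have hconn := (isPreconnected_compl_singleton_circle p).image f hf.continuous.continuousOn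
  have hmem : ∀ t : Set.Ioo (0 : ℝ) 1, (t : ℝ) ≠ 1 / 2 →
      EndSpace.inner ⟨e, heE⟩ t ∈ f '' {p}ᶜ := by
    intro t ht
    obtain ⟨q, hq⟩ := he t
    refine ⟨q, ?_, hq⟩
    rintro rfl
    rw [hp] at hq
    simp only [EndSpace.inner.injEq, true_and] at hq
    exact ht (by rw [← hq])
  have hτ' : (τ ⟨e, heE⟩ : ℝ) = 1 / 2 := hτe _ rfl
  have hl := isLink_src_tgt ⟨e, heE⟩
  have hsep := hl.mem_cut_iff.1 heC.2
  have h14 := hmem ⟨1 / 4, by norm_num, by norm_num⟩ (by norm_num)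
  have h34 := hmem ⟨3 / 4, by norm_num, by norm_num⟩ (by norm_num)
  have hlt : (⟨1 / 4, by norm_num, by norm_num⟩ : Set.Ioo (0 : ℝ) 1) < τ ⟨e, heE⟩ :=
    Subtype.coe_lt_coe.1 (by rw [hτ']; norm_num)
  have hgt : τ ⟨e, heE⟩ < (⟨3 / 4, by norm_num, by norm_num⟩ : Set.Ioo (0 : ℝ) 1) :=
    Subtype.coe_lt_coe.1 (by rw [hτ']; norm_num)
  have hside : ∀ L, (L = K ∨ L = Kᶜ) →
      (f '' {p}ᶜ ∩ EndSpace.side hK.toFinset τ L).Nonempty := by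
    intro L hL
    by_cases hs : G.src ⟨e, heE⟩ ∈ L
    · exact ⟨_, h14, EndSpace.inner_mem_side.2 (Or.inl ⟨hs, fun _ ↦ hlt⟩)⟩
    · refine ⟨_, h34, EndSpace.inner_mem_side.2 (Or.inr ⟨?_, fun _ ↦ hgt⟩)⟩
      rcases hL with rfl | rfl
      · tauto
      · simp only [Set.mem_compl_iff] at hs ⊢
        tauto
  have hsub : f '' {p}ᶜ ⊆
      EndSpace.side hK.toFinset τ K ∪ EndSpace.side hK.toFinset τ Kᶜ := by
    rintro _ ⟨q, hq, rfl⟩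
    refine EndSpace.mem_side_or_mem_side_compl hF fun g hg hfq ↦ ?_
    rw [Set.Finite.mem_toFinset] at hg
    by_cases hge : (g : E) = e
    · obtain rfl : g = ⟨e, heE⟩ := Subtype.ext hge
      refine hq (hf.injective ?_)
      rw [hfq, hp]
      congr 1
      exact Subtype.ext hτ'
    · exact hτ g hg hge ⟨q, hfq⟩
  obtain ⟨q, -, hq1, hq2⟩ := hconn _ _ (EndSpace.isOpen_side hK.toFinset τ K)
    (EndSpace.isOpen_side hK.toFinset τ Kᶜ) hsub (hside K (Or.inl rfl)) (hside Kᶜ (Or.inr rfl))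
  exact Set.disjoint_left.1 (EndSpace.disjoint_side_compl hF.subset) hq1 hq2

end Graph


/-! ### Signing the topological cycle matroid -/

namespace Graph

variable {V E : Type*} {G : Graph V E}

namespace CircularOrder

variable {I : Type*} [LinearOrder I] {Γ : G.CircularOrder I}

-- Telescoping in increasing order: by the hypothesis each edge of Z starts on the side where the
-- preceding one ended.
open Classical in
lemma sum_indicator_sub {K : Set V} (Z : Finset I)
    (h : ∀ i ∈ Z, Γ.fst i ∈ K ↔ Γ.last (Z.filter (· < i)) ∈ K) :
    ∑ i ∈ Z, (K.indicator (fun _ ↦ (1 : ℤ)) (Γ.fst i) - K.indicator (fun _ ↦ 1) (Γ.snd i)) =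
      K.indicator (fun _ ↦ 1) Γ.start - K.indicator (fun _ ↦ 1) (Γ.last Z) := by
  induction Z using Finset.induction_on_max with
  | empty => rw [last_of_empty rfl]; simp
  | insert a Z hZ ih =>
    have ha : a ∉ Z := fun h ↦ (hZ a h).false
    have hfilter : ∀ i, i ≤ a → (insert a Z).filter (· < i) = Z.filter (· < i) := by
      intro i hi
      rw [Finset.filter_insert, if_neg hi.not_gt]
    have h1 := h a (Finset.mem_insert_self _ _)
    rw [hfilter a le_rfl, Finset.filter_true_of_mem hZ] at h1
    have h2 : Γ.last (insert a Z) = Γ.snd a := by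
      refine last_of_isGreatest ⟨by simp, ?_⟩
      intro i hi
      rcases Finset.mem_insert.1 (Finset.mem_coe.1 hi) with rfl | hi
      · exact le_rfl
      · exact (hZ i hi).le
    rw [Finset.sum_insert ha, ih fun i hi ↦ ?_, h2]
    · have : K.indicator (fun _ ↦ (1 : ℤ)) (Γ.fst a) = K.indicator (fun _ ↦ 1) (Γ.last Z) := by
        simp only [Set.indicator_apply, h1]
      rw [this]
      ring
    · rw [h i (Finset.mem_insert_of_mem hi), hfilter i (hZ i hi).le]

theorem IsCompatible.exists_balanced (hΓ : Γ.IsCompatible) :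
    ∃ c : E → ℤˣ, ∀ K, (G.cut K).Finite → G.Balanced (Set.range Γ.edge) c K := by
  classical
  let c : E → ℤˣ := fun f ↦ if h : ∃ i, Γ.edge i = f then G.traverseSign f (Γ.fst h.choose) else 1
  have hc : ∀ i, c (Γ.edge i) = G.traverseSign (Γ.edge i) (Γ.fst i) := by
    intro i
    have h : ∃ j, Γ.edge j = Γ.edge i := ⟨i, rfl⟩
    simp only [c, dif_pos h]
    rw [Γ.edge_injective h.choose_spec]
  refine ⟨c, fun K hK ↦ ⟨hK.subset Set.inter_subset_right, ?_⟩⟩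
  have hF : G.cut K ⊆ hK.toFinset := by simp
  rw [finsum_mem_range Γ.edge_injective, finsum_eq_sum_of_support_subset
    (s := Γ.within hK.toFinset Set.univ)]
  · simp only [hc, (Γ.isLink _).traverseSign_mul_cutSign]
    rw [sum_indicator_sub, sub_eq_zero]
    · simp only [Set.indicator_apply, hΓ.start_mem_iff _ _ hF]
    · intro i _
      rw [hΓ.fst_mem_iff _ _ hF]
      suffices (Γ.within hK.toFinset Set.univ).filter (· < i) =
        Γ.within hK.toFinset (Set.Iio i) by rw [this]
      ext j
      simp [mem_within]
  · intro i hi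
    rw [Finset.mem_coe, mem_within, Set.Finite.mem_toFinset]
    refine ⟨?_, trivial⟩
    by_contra h
    exact hi (by simp [cutSign_of_notMem h])

end CircularOrder

lemma FundamentalCuts.exists_balanced {e : E} {u w : V} {S : Set E}
    (Φ : G.FundamentalCuts e u w S) :
    ∃ c : E → ℤˣ, ∀ K, (G.cut K).Finite → G.Balanced (insert e S) c K := by
  let _ := Φ.linearOrder
  rw [← Φ.range_edge_circularOrder]
  exact Φ.isCompatible_circularOrder.exists_balanced

/-- If every finite cut containing `e` meets `A`, then `A` contains the other edges of a topological
circle through `e`. -/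
lemma MeetsFiniteCuts.exists_isTopologicalCycle {e : E} {A : Set E} (he : e ∈ G.edgeSet)
    (heA : e ∉ A) (h : G.MeetsFiniteCuts e A) :
    ∃ S ⊆ A, G.IsTopologicalCycle (insert e S) ∧
      ∃ c : E → ℤˣ, ∀ K, (G.cut K).Finite → G.Balanced (insert e S) c K := by
  obtain ⟨u, w, hl⟩ := G.exists_isLink_of_mem_edgeSet he
  obtain ⟨S, hSA, hS, hmin⟩ := h.exists_minimal
  obtain ⟨Φ⟩ := nonempty_fundamentalCuts hl (fun h ↦ heA (hSA h)) hS hmin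
  exact ⟨S, hSA, Φ.isTopologicalCycle, Φ.exists_balanced⟩

end Graph

namespace Matroid

variable {V E : Type*} {G : Graph V E} {M : Matroid E}

/-- A given circle need not be oriented through its embedding. If e is one of its edges, the others
meet every finite cut through e, so they contain a set which forms an oriented circle with e; as
circuits are minimal, this is the given circle. -/
theorem IsTopologicalCycleMatroid.nonempty_signing (h : M.IsTopologicalCycleMatroid G) :
    Nonempty (Signing M) := by
  refine nonempty_signing_of_balanced G {K | (G.cut K).Finite} (fun b hb ↦ ?_) fun o ho ↦ ?_
  · obtain ⟨e, he⟩ := hb.nonempty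
    have heE : e ∈ G.edgeSet := h.1 ▸ hb.subset_ground he
    by_contra! hn
    obtain ⟨S, hSA, hcyc, -⟩ := Graph.MeetsFiniteCuts.exists_isTopologicalCycle (A := bᶜ) heE
      (fun h ↦ h he) fun K hK heK ↦ Set.inter_compl_nonempty_iff.2 (hn K hK ⟨e, heK⟩)
    refine ((h.2 _).2 hcyc).inter_isCocircuit_ne_singleton hb (e := e) (Set.Subset.antisymm ?_ ?_)
    · rintro f ⟨rfl | hf, hfb⟩
      · rfl
      · exact absurd hfb (hSA hf)
    · rintro _ rfl
      exact ⟨Set.mem_insert _ _, he⟩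
  · obtain ⟨e, he⟩ := ho.nonempty
    have heE : e ∈ G.edgeSet := h.1 ▸ ho.subset_ground he
    have hmeets : G.MeetsFiniteCuts e (o \ {e}) := by
      intro K hK heK
      by_contra hn
      rw [Set.not_nonempty_iff_eq_empty] at hn
      refine ((h.2 o).1 ho).inter_cut_ne hK e (Set.Subset.antisymm ?_ ?_)
      · rintro f ⟨hfo, hfK⟩
        by_contra hfe
        exact hn.subset ⟨hfK, hfo, hfe⟩
      · rintro _ rfl
        exact ⟨he, heK⟩
    obtain ⟨S, hS, hcyc, hbal⟩ := hmeets.exists_isTopologicalCycle heE (fun h ↦ h.2 rfl)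
    have heq : insert e S = o := ((h.2 _).2 hcyc).eq_of_subset_isCircuit ho
      (Set.insert_subset he (hS.trans Set.sdiff_subset))
    rwa [heq] at hbal

end Matroid


/-! ### Infinite fans to double rays -/

namespace Graph

variable {V E : Type*} {G : Graph V E}

/-- Paths from a vertex `z` to the vertices `v i` with `i ∈ I` of a double ray `v` which are
disjoint outside `z` and meet the double ray outside `z` only in `v i`. -/
structure Fan (G : Graph V E) (v : ℤ → V) (I : Set ℤ) where
  /-- the centre of the fan -/
  center : V
  /-- the vertices of the paths, without the centre -/
  verts : ℤ → Set V
  /-- the edges of the paths -/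
  path : ℤ → Set E
  finite_verts : ∀ i ∈ I, (verts i).Finite
  center_notMem : ∀ i ∈ I, center ∉ verts i
  disjoint_verts : ∀ i ∈ I, ∀ j ∈ I, i ≠ j → Disjoint (verts i) (verts j)
  mem_verts_iff : ∀ i ∈ I, ∀ j, v j ∈ verts i ↔ j = i
  isLink : ∀ i ∈ I, ∀ p ∈ path i, ∃ x ∈ insert center (verts i), ∃ y ∈ insert center (verts i),
    G.IsLink p x y
  joined : ∀ i ∈ I, G.Joined (path i) center (v i)

/-- The mirror image of a fan. -/
def Fan.reverse {v : ℤ → V} {I : Set ℤ} (Φ : G.Fan v I) : G.Fan (fun i ↦ v (-i)) (Neg.neg ⁻¹' I) where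
  center := Φ.center
  verts i := Φ.verts (-i)
  path i := Φ.path (-i)
  finite_verts i hi := Φ.finite_verts _ hi
  center_notMem i hi := Φ.center_notMem _ hi
  disjoint_verts i hi j hj h := Φ.disjoint_verts _ hi _ hj (neg_injective.ne h)
  mem_verts_iff i hi j := by rw [Φ.mem_verts_iff _ hi, neg_inj]
  isLink i hi := Φ.isLink _ hi
  joined i hi := Φ.joined _ hi

lemma joined_segment {v : ℤ → V} {f : ℤ → E} (hl : ∀ i, G.IsLink (f i) (v i) (v (i + 1)))
    {a b : ℤ} (hab : a ≤ b) : G.Joined (f '' Set.Ico a b) (v a) (v b) := by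
  induction b, hab using Int.leInduction with
  | base => exact Joined.refl _ _ _
  | succ b hab ih =>
    refine (ih.mono (Set.image_mono (Set.Ico_subset_Ico_right (by omega)))).trans
      ((hl b).joined ⟨b, ⟨hab, by omega⟩, rfl⟩)

lemma edge_injective_of_isLink {v : ℤ → V} {f : ℤ → E} (hv : Function.Injective v)
    (hl : ∀ i, G.IsLink (f i) (v i) (v (i + 1))) : Function.Injective f := by
  intro i j h
  have h1 := hl i
  rw [h] at h1
  rcases h1.eq_and_eq_or_eq_and_eq (hl j) with ⟨h2, -⟩ | ⟨h2, h3⟩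
  · exact hv h2
  · have := hv h2
    have := hv h3
    omega

lemma exists_least_ge {I : Set ℤ} (hI : ¬ BddAbove I) (a : ℤ) :
    ∃ k ∈ I, a ≤ k ∧ ∀ i ∈ I, a ≤ i → k ≤ i := by
  obtain ⟨m, hm, ham⟩ : ∃ m ∈ I, a < m := by
    by_contra! h
    exact hI ⟨a, h⟩
  obtain ⟨k, ⟨hk, hak⟩, h⟩ := Int.exists_least_of_bdd (P := fun i ↦ i ∈ I ∧ a ≤ i)
    ⟨a, fun _ h ↦ h.2⟩ ⟨m, hm, ham.le⟩
  exact ⟨k, hk, hak, fun i hi hai ↦ h i ⟨hi, hai⟩⟩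

namespace Fan

variable {v : ℤ → V} {f : ℤ → E} {I : Set ℤ} (Φ : G.Fan v I)

/-- The double ray without the edges after the ends of the paths, together with the paths. -/
def edges (f : ℤ → E) : Set E := f '' Iᶜ ∪ ⋃ i ∈ I, Φ.path i

/-- The part of the fan and the double ray between two deleted edges. -/
def tooth (N k : ℤ) : Set V :=
  Φ.verts k ∪ v '' {j | N ≤ j ∧ j ≤ k ∧ ∀ i ∈ I, j ≤ i → k ≤ i}

variable {Φ} {N : ℤ}

lemma finite_tooth {k : ℤ} (hk : k ∈ I) : (Φ.tooth N k).Finite :=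
  (Φ.finite_verts k hk).union (((Set.finite_Icc N k).subset fun _ h ↦ ⟨h.1, h.2.1⟩).image v)

lemma eq_of_mem_tooth (hv : Function.Injective v) {k m : ℤ} (hk : k ∈ I) (hm : m ∈ I) {x : V}
    (hxk : x ∈ Φ.tooth N k) (hxm : x ∈ Φ.tooth N m) : k = m := by
  rcases hxk with hxk | ⟨j, ⟨-, h1, h2⟩, rfl⟩ <;> rcases hxm with hxm | ⟨j', ⟨-, h3, h4⟩, hj⟩
  · by_contra h
    exact Set.disjoint_left.1 (Φ.disjoint_verts k hk m hm h) hxk hxm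
  · subst hj
    have := (Φ.mem_verts_iff k hk _).1 hxk
    subst this
    exact le_antisymm h3 (h4 j' hk le_rfl)
  · have := (Φ.mem_verts_iff m hm _).1 hxm
    subst this
    exact le_antisymm (h2 j hm le_rfl) h1
  · have := hv hj
    subst this
    exact le_antisymm (h2 m hm h3) (h4 k hk h1)

/-- Without the centre and the double ray before N, what remains falls into finite pieces: the path
to v k together with the segment of the double ray which ends at v k. -/
lemma exists_tooth (hl : ∀ i, G.IsLink (f i) (v i) (v (i + 1))) (hI : ¬ BddAbove I)
    {p : E} (hp : p ∈ Φ.edges f) {x y : V} (hlp : G.IsLink p x y) (hx : x ≠ Φ.center)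
    (hy : y ≠ Φ.center) (hxN : x ∉ v '' Set.Iio N) (hyN : y ∉ v '' Set.Iio N) :
    ∃ k ∈ I, x ∈ Φ.tooth N k ∧ y ∈ Φ.tooth N k := by
  rcases hp with ⟨j, hj, rfl⟩ | hp
  · have hjN : N ≤ j := by
      by_contra! h
      rcases hlp.eq_and_eq_or_eq_and_eq (hl j) with ⟨rfl, rfl⟩ | ⟨rfl, rfl⟩
      · exact hxN ⟨j, h, rfl⟩
      · exact hyN ⟨j, h, rfl⟩
    obtain ⟨k, hk, hjk, hmin⟩ := exists_least_ge hI j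
    have hne : j ≠ k := by rintro rfl; exact hj hk
    have h1 : v j ∈ Φ.tooth N k := Or.inr ⟨j, ⟨hjN, hjk, hmin⟩, rfl⟩
    have h2 : v (j + 1) ∈ Φ.tooth N k :=
      Or.inr ⟨j + 1, ⟨by omega, by omega, fun i hi h ↦ hmin i hi (by omega)⟩, rfl⟩
    refine ⟨k, hk, ?_⟩
    rcases hlp.eq_and_eq_or_eq_and_eq (hl j) with ⟨rfl, rfl⟩ | ⟨rfl, rfl⟩
    · exact ⟨h1, h2⟩
    · exact ⟨h2, h1⟩
  · simp only [Set.mem_iUnion] at hp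
    obtain ⟨k, hk, hp⟩ := hp
    obtain ⟨a, ha, b, hb, hab⟩ := Φ.isLink k hk p hp
    refine ⟨k, hk, ?_⟩
    rcases hlp.eq_and_eq_or_eq_and_eq hab with ⟨rfl, rfl⟩ | ⟨rfl, rfl⟩
    · exact ⟨Or.inl (ha.resolve_left hx), Or.inl (hb.resolve_left hy)⟩
    · exact ⟨Or.inl (hb.resolve_left hx), Or.inl (ha.resolve_left hy)⟩

/-- There are no rays in the part of the fan and the double ray to the right of `N`. -/
lemma false_of_ray (hv : Function.Injective v) (hl : ∀ i, G.IsLink (f i) (v i) (v (i + 1)))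
    (hI : ¬ BddAbove I) {g : ℕ → V} {q : ℕ → E} (hg : Function.Injective g)
    (hq : ∀ n, q n ∈ Φ.edges f) (hlq : ∀ n, G.IsLink (q n) (g n) (g (n + 1)))
    (hgN : ∀ n, g n ∉ v '' Set.Iio N) : False := by
  obtain ⟨n₀, hn₀⟩ : ∃ n₀, ∀ n, n₀ ≤ n → g n ≠ Φ.center := by
    by_cases h : ∃ m, g m = Φ.center
    · obtain ⟨m, hm⟩ := h
      refine ⟨m + 1, fun n hn h ↦ ?_⟩
      have := hg (h.trans hm.symm)
      omega
    · push Not at h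
      exact ⟨0, fun n _ ↦ h n⟩
  have hstep := fun n (hn : n₀ ≤ n) ↦ exists_tooth hl hI (hq n) (hlq n) (hn₀ n hn)
    (hn₀ (n + 1) (by omega)) (hgN n) (hgN (n + 1))
  obtain ⟨k, hk, hmem, -⟩ := hstep n₀ le_rfl
  have hall : ∀ n, n₀ ≤ n → g n ∈ Φ.tooth N k := by
    intro n hn
    induction n, hn using Nat.le_induction with
    | base => exact hmem
    | succ n hn ih =>
      obtain ⟨m, hm, h1, h2⟩ := hstep n hn
      rwa [eq_of_mem_tooth hv hk hm ih h1]
  refine Set.infinite_of_injective_forall_mem (f := fun n ↦ g (n₀ + n)) (fun a b h ↦ ?_)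
    (fun n ↦ hall _ (by omega)) (finite_tooth (Φ := Φ) (N := N) hk)
  exact Nat.add_left_cancel (hg h)

end Fan

end Graph

namespace Matroid

variable {V E : Type*} {G : Graph V E} {M : Matroid E}

open Graph

/-- Delete from the double ray the edges after the ends of the fan paths and add these paths. Each
deleted edge is spanned through a finite cycle via the centre, so f (N - 1) is spanned by the other
edges of the resulting set. But f (N - 1) is the only one of its edges in the cut of K, which
excludes finite cycles, and there is no ray on the other side, which excludes double rays. -/
lemma false_of_fan_not_bddAbove (hM : ∀ C, M.IsCircuit C ↔ G.IsFiniteCycle C ∨ G.IsDoubleRay C)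
    {v : ℤ → V} {f : ℤ → E} (hv : Function.Injective v)
    (hl : ∀ i, G.IsLink (f i) (v i) (v (i + 1))) {I : Set ℤ} (Φ : G.Fan v I)
    (hI : ¬ BddAbove I) {N : ℤ} (hN : ∀ i ∈ I, N < i) (hz : ∀ j, v j = Φ.center → j = N) :
    False := by
  have hf := edge_injective_of_isLink hv hl
  let H := Φ.edges f
  let K := v '' Set.Iio N
  have hvK : ∀ j, v j ∈ K ↔ j < N := fun j ↦ hv.mem_set_image
  have hpath : ∀ k ∈ I, ∀ p ∈ Φ.path k, ∀ j < N, ∀ y, ¬ G.IsLink p (v j) y := by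
    intro k hk p hp j hj y hly
    obtain ⟨a, ha, b, hb, hab⟩ := Φ.isLink k hk p hp
    have : v j ∈ insert Φ.center (Φ.verts k) := by
      rcases hly.left_eq_or_eq hab with h | h <;> rwa [h]
    rcases this with h | h
    · have := hz j h; omega
    · have := (Φ.mem_verts_iff k hk j).1 h
      have := hN k hk
      omega
  have hcut : ∀ p ∈ H, p ∈ G.cut K → p = f (N - 1) := by
    rintro p (⟨j, hj, rfl⟩ | hp) hpK
    · rw [(hl j).mem_cut_iff, hvK, hvK] at hpK
      congr 1
      omega
    · simp only [Set.mem_iUnion] at hp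
      obtain ⟨k, hk, hp⟩ := hp
      obtain ⟨x, y, hxy, ⟨j, hj, rfl⟩, -⟩ := hpK
      exact absurd hxy (hpath k hk p hp j hj y)
  have hN' : N - 1 ∉ I := fun h ↦ by have := hN _ h; omega
  have heK : f (N - 1) ∈ G.cut K := by
    rw [(hl _).mem_cut_iff, hvK, hvK]
    omega
  have hground : ∀ j, f j ∈ M.E := fun j ↦
    ((hM _).2 (Or.inr ⟨v, f, hv, hl, rfl⟩)).subset_ground ⟨j, rfl⟩
  have hpathH : ∀ k ∈ I, Φ.path k ⊆ H \ {f (N - 1)} := by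
    intro k hk p hp
    refine ⟨Or.inr (Set.mem_biUnion hk hp), ?_⟩
    rintro rfl
    exact hpath k hk _ hp (N - 1) (by omega) _ (hl _)
  -- For a deleted edge f k, go from v k through the centre to the next end v m of a path, and back
  -- along the double ray to v (k + 1).
  have hcl : Set.range f \ {f (N - 1)} ⊆ M.closure (H \ {f (N - 1)}) := by
    rintro _ ⟨⟨k, rfl⟩, hne⟩
    by_cases hkH : f k ∈ H
    · exact M.mem_closure_of_mem' ⟨hkH, hne⟩ (hground k)
    have hk : k ∈ I := by
      by_contra h
      exact hkH (Or.inl ⟨k, h, rfl⟩)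
    obtain ⟨m, hm, hkm, hmin⟩ := exists_least_ge hI (k + 1)
    have hj : G.Joined (H \ {f (N - 1)}) (v k) (v (k + 1)) := by
      refine ((Φ.joined k hk).symm.mono (hpathH k hk)).trans
        (((Φ.joined m hm).mono (hpathH m hm)).trans ((joined_segment hl hkm).symm.mono ?_))
      rintro _ ⟨j, ⟨hj1, hj2⟩, rfl⟩
      refine ⟨Or.inl ⟨j, fun hjI ↦ ?_, rfl⟩, fun h ↦ ?_⟩
      · have := hmin j hjI hj1
        omega
      · have := hf h
        have := hN k hk
        omega
    obtain ⟨o, ho, hko, hoH⟩ := (hl k).exists_isFiniteCycle (fun h ↦ hkH h.1) hj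
    refine M.closure_subset_closure ?_
      (((hM o).2 (Or.inl ho)).mem_closure_sdiff_singleton_of_mem hko)
    rintro p ⟨hpo, hpk⟩
    exact (hoH hpo).resolve_left hpk
  have he : f (N - 1) ∈ M.closure (H \ {f (N - 1)}) :=
    M.closure_subset_closure_of_subset_closure hcl
      (((hM _).2 (Or.inr ⟨v, f, hv, hl, rfl⟩)).mem_closure_sdiff_singleton_of_mem ⟨N - 1, rfl⟩)
  obtain ⟨o, hoH, ho, heo⟩ := exists_isCircuit_of_mem_closure he (fun h ↦ h.2 rfl)
  have hoH' : o ⊆ H := hoH.trans (Set.insert_subset (Or.inl ⟨_, hN', rfl⟩) Set.sdiff_subset)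
  rcases (hM o).1 ho with hfin | ⟨w, q, hw, hlq, rfl⟩
  · obtain ⟨c, hc⟩ := hfin.exists_balanced
    refine (hc K).inter_ne_singleton (f (N - 1)) (Set.Subset.antisymm ?_ ?_)
    · rintro p ⟨hpo, hpK⟩
      exact hcut p (hoH' hpo) hpK
    · rintro _ rfl
      exact ⟨heo, heK⟩
  · have hq := edge_injective_of_isLink hw hlq
    obtain ⟨i₀, hi₀⟩ := heo
    have hnotcut : ∀ i, i ≠ i₀ → (w i ∈ K ↔ w (i + 1) ∈ K) := by
      intro i hi
      refine (hlq i).mem_iff_of_notMem_cut fun h ↦ hi (hq ?_)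
      rw [hi₀]
      exact hcut _ (hoH' ⟨i, rfl⟩) h
    rw [← hi₀, (hlq i₀).mem_cut_iff] at heK
    -- The double ray w crosses the cut only once, so its half on the side outside K is a ray that
    -- never enters K.
    by_cases hK : w i₀ ∈ K
    · refine Fan.false_of_ray (Φ := Φ) (N := N) (g := fun n ↦ w (i₀ + 1 + n))
        (q := fun n ↦ q (i₀ + 1 + n)) hv hl hI (fun a b h ↦ ?_) (fun n ↦ hoH' ⟨_, rfl⟩)
        (fun n ↦ ?_) (fun n ↦ ?_)
      · have := hw h
        omega
      · have := hlq (i₀ + 1 + n)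
        rwa [add_assoc (i₀ + 1)] at this
      · induction n with
        | zero =>
          rw [Nat.cast_zero, add_zero]
          tauto
        | succ n ih =>
          rw [Nat.cast_succ, ← add_assoc]
          exact fun h ↦ ih ((hnotcut _ (by omega)).2 h)
    · refine Fan.false_of_ray (Φ := Φ) (N := N) (g := fun n ↦ w (i₀ - n))
        (q := fun n ↦ q (i₀ - n - 1)) hv hl hI (fun a b h ↦ ?_) (fun n ↦ hoH' ⟨_, rfl⟩)
        (fun n ↦ ?_) (fun n ↦ ?_)
      · have := hw h
        omega
      · have := (hlq (i₀ - n - 1)).symm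
        rw [sub_add_cancel] at this
        rwa [Nat.cast_succ, ← sub_sub]
      · induction n with
        | zero =>
          rw [Nat.cast_zero, sub_zero]
          exact hK
        | succ n ih =>
          rw [Nat.cast_succ, ← sub_sub]
          intro h
          have := (hnotcut (i₀ - n - 1) (by omega)).1 h
          rw [sub_add_cancel] at this
          exact ih this

end Matroid


/-! ### A star-comb argument: rays or infinite fans -/

namespace Graph

variable {V E : Type*} {G : Graph V E}

/-- The paths of a fan to the vertices with indices in a subset. -/
def Fan.restrict {v : ℤ → V} {I J : Set ℤ} (Φ : G.Fan v I) (h : J ⊆ I) : G.Fan v J where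
  center := Φ.center
  verts := Φ.verts
  path := Φ.path
  finite_verts i hi := Φ.finite_verts i (h hi)
  center_notMem i hi := Φ.center_notMem i (h hi)
  disjoint_verts i hi j hj := Φ.disjoint_verts i (h hi) j (h hj)
  mem_verts_iff i hi := Φ.mem_verts_iff i (h hi)
  isLink i hi := Φ.isLink i (h hi)
  joined i hi := Φ.joined i (h hi)

namespace ParentTree

variable {A : Set E} {u : V} (T : G.ParentTree A u)

/-- The indices of the vertices of the double ray `v` which are descendants of the vertex `z` at
depth `n`. -/
def descIndices (v : ℤ → V) (n : ℕ) (z : V) : Set ℤ :=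
  {i | v i ∈ G.componentIn A u ∧ n ≤ T.depth (v i) ∧ T.ancestor n (v i) = z}

variable {T}

/-- König's argument: always move on to a child with infinitely many descendants on the double ray.
-/
lemma exists_ray {v : ℤ → V} (h0 : (T.descIndices v 0 u).Infinite)
    (h : ∀ n z, (T.descIndices v n z).Infinite →
      ∃ z', T.parent z' = z ∧ (T.descIndices v (n + 1) z').Infinite) :
    ∃ (g : ℕ → V) (q : ℕ → E), g 0 = u ∧ Function.Injective g ∧
      ∀ n, q n ∈ A ∧ G.IsLink (q n) (g n) (g (n + 1)) := by
  choose! s hs hs' using h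
  let g : ℕ → V := fun n ↦ n.rec u fun k z ↦ s k z
  have hg : ∀ n, (T.descIndices v n (g n)).Infinite := by
    intro n
    induction n with
    | zero => exact h0
    | succ n ih => exact hs' n _ ih
  have hmem : ∀ n, g n ∈ G.componentIn A u ∧ T.depth (g n) = n := by
    intro n
    obtain ⟨i, h1, h2, h3⟩ := (hg n).nonempty
    rw [← h3]
    exact ⟨ancestor_mem h1 n, depth_ancestor h1 h2⟩
  have hne : ∀ n, g (n + 1) ≠ u := fun n ↦ T.ne_root (by rw [(hmem (n + 1)).2]; omega)
  refine ⟨g, fun n ↦ T.up (g (n + 1)), rfl, fun a b hab ↦ ?_, fun n ↦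
    ⟨T.up_mem _ (hmem (n + 1)).1 (hne n), ?_⟩⟩
  · rw [← (hmem a).2, hab, (hmem b).2]
  · have := T.isLink _ (hmem (n + 1)).1 (hne n)
    rw [show T.parent (g (n + 1)) = g n from hs n _ (hg n)] at this
    exact this.symm

/-- Infinitely many children of z have descendants on the double ray. Choosing below each of them
such a descendant of minimal depth keeps the tree path from meeting the double ray earlier, apart
possibly from z; paths through different children are disjoint below z. -/
theorem exists_fan {v : ℤ → V} (hv : Function.Injective v) {n : ℕ} {z : V}
    (hinf : (T.descIndices v n z).Infinite)
    (hfin : ∀ z', T.parent z' = z → (T.descIndices v (n + 1) z').Finite) :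
    ∃ I : Set ℤ, I.Infinite ∧ Nonempty (G.Fan v I) := by
  obtain ⟨Y, hY⟩ : ∃ Y : Set ℤ,
      Y = {i | v i ∈ G.componentIn A u ∧ n < T.depth (v i) ∧ T.ancestor n (v i) = z} := ⟨_, rfl⟩
  have hYmem : ∀ i, i ∈ Y ↔
      v i ∈ G.componentIn A u ∧ n < T.depth (v i) ∧ T.ancestor n (v i) = z := by
    intro i; rw [hY]; rfl
  have hYinf : Y.Infinite := by
    intro h
    refine hinf (((Set.finite_singleton z).preimage hv.injOn |>.union h).subset ?_)
    rintro i ⟨h1, h2, h3⟩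
    rcases h2.eq_or_lt with h4 | h4
    · rw [h4, ancestor_depth] at h3
      exact Or.inl h3
    · exact Or.inr ((hYmem i).2 ⟨h1, h4, h3⟩)
  let χ : ℤ → V := fun i ↦ T.ancestor (n + 1) (v i)
  have hχinf : (χ '' Y).Infinite := by
    intro h
    refine hYinf ((h.biUnion (t := fun c ↦ {i ∈ Y | χ i = c}) ?_).subset fun i hi ↦
      Set.mem_biUnion (Set.mem_image_of_mem χ hi) ⟨hi, rfl⟩)
    rintro _ ⟨i, hi, rfl⟩
    obtain ⟨h1, h2, h3⟩ := (hYmem i).1 hi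
    refine (hfin (χ i) (by rw [← h3]; exact parent_ancestor h2)).subset ?_
    rintro j ⟨hj, hji⟩
    obtain ⟨h4, h5, -⟩ := (hYmem j).1 hj
    exact ⟨h4, h5, hji⟩
  have hmin : ∀ c : V, ∃ i, c ∈ χ '' Y →
      i ∈ Y ∧ χ i = c ∧ ∀ j ∈ Y, χ j = c → T.depth (v i) ≤ T.depth (v j) := by
    intro c
    by_cases hc : c ∈ χ '' Y
    · obtain ⟨i, hi, hic⟩ := hc
      let D : Set ℕ := {d | ∃ i ∈ Y, χ i = c ∧ T.depth (v i) = d}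
      obtain ⟨i', hi', hic', hd⟩ := Nat.sInf_mem (s := D) ⟨_, i, hi, hic, rfl⟩
      exact ⟨i', fun _ ↦ ⟨hi', hic', fun j hj hjc ↦ hd ▸ Nat.sInf_le ⟨j, hj, hjc, rfl⟩⟩⟩
    · exact ⟨0, fun h ↦ absurd h hc⟩
  choose m hmY hmχ hmin using hmin
  have hI : ∀ i ∈ m '' (χ '' Y), i ∈ Y ∧ i = m (χ i) ∧
      ∀ j ∈ Y, χ j = χ i → T.depth (v i) ≤ T.depth (v j) := by
    rintro _ ⟨c, hc, rfl⟩
    exact ⟨hmY c hc, by rw [hmχ c hc], fun j hj hjc ↦ hmin c hc j hj (hjc.trans (hmχ c hc))⟩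
  let W : ℤ → Set V := fun i ↦ (fun k ↦ T.ancestor k (v i)) '' Set.Ioc n (T.depth (v i))
  have hW : ∀ i ∈ Y, ∀ x ∈ W i, x ∈ G.componentIn A u ∧ n < T.depth x ∧
      T.depth x ≤ T.depth (v i) ∧ T.ancestor n x = z ∧ T.ancestor (n + 1) x = χ i ∧
      x = T.ancestor (T.depth x) (v i) := by
    rintro i hi _ ⟨k, ⟨hk, hk'⟩, rfl⟩
    obtain ⟨h1, h2, h3⟩ := (hYmem i).1 hi
    dsimp only
    rw [depth_ancestor h1 hk', ancestor_ancestor h1 hk.le hk', ancestor_ancestor h1 hk hk']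
    exact ⟨ancestor_mem h1 k, hk, hk', h3, rfl, rfl⟩
  refine ⟨m '' (χ '' Y), hχinf.image fun c hc d hd hcd ↦ ?_, ⟨⟨z, W, fun i ↦ T.up '' W i,
    fun i hi ↦ (Set.finite_Ioc _ _).image _, fun i hi hz ↦ ?_, fun i hi j hj hij ↦ ?_,
    fun i hi j ↦ ⟨fun hj ↦ ?_, ?_⟩, fun i hi ↦ ?_, fun i hi ↦ ?_⟩⟩⟩
  · rw [← hmχ c hc, hcd, hmχ d hd]
  · obtain ⟨h1, h2, h3⟩ := (hYmem i).1 (hI i hi).1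
    have h4 := (hW i (hI i hi).1 z hz).2.1
    have h5 := depth_ancestor h1 h2.le
    rw [h3] at h5
    omega
  · rw [Set.disjoint_left]
    intro x hxi hxj
    have h1 := (hW i (hI i hi).1 x hxi).2.2.2.2.1
    have h2 := (hW j (hI j hj).1 x hxj).2.2.2.2.1
    rw [(hI i hi).2.1, ← h1, h2, ← (hI j hj).2.1] at hij
    exact hij rfl
  · obtain ⟨h1, h2, h3, h4, h5, h6⟩ := hW i (hI i hi).1 _ hj
    have h7 := (hI i hi).2.2 j ((hYmem j).2 ⟨h1, h2, h4⟩) h5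
    rw [le_antisymm h3 h7, ancestor_depth] at h6
    exact hv h6
  · rintro rfl
    exact ⟨T.depth (v j), ⟨((hYmem j).1 (hI j hi).1).2.1, le_rfl⟩, ancestor_depth _⟩
  · obtain ⟨h1, h2, h3⟩ := (hYmem i).1 (hI i hi).1
    rintro _ ⟨_, ⟨k, ⟨hk, hk'⟩, rfl⟩, rfl⟩
    obtain ⟨k, rfl⟩ := Nat.exists_eq_succ_of_ne_zero (n := k) (by omega)
    refine ⟨_, Or.inr ⟨k + 1, ⟨hk, hk'⟩, rfl⟩, _, ?_, isLink_ancestor h1 hk'⟩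
    rcases (Nat.lt_succ_iff.1 hk).eq_or_lt with rfl | h4
    · exact Or.inl h3
    · exact Or.inr ⟨k, ⟨h4, by omega⟩, rfl⟩
  · obtain ⟨h1, h2, h3⟩ := (hYmem i).1 (hI i hi).1
    have : ∀ k, n ≤ k → k ≤ T.depth (v i) →
        G.Joined (T.up '' W i) z (T.ancestor k (v i)) := by
      intro k hk
      induction k, hk using Nat.le_induction with
      | base => intro _; rw [h3]; exact Joined.refl _ _ _
      | succ k hk ih =>
        intro hk'
        exact (ih (by omega)).trans ((isLink_ancestor h1 hk').symm.joined
          ⟨_, ⟨k + 1, ⟨by omega, hk'⟩, rfl⟩, rfl⟩)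
    have h4 := this _ h2.le le_rfl
    rwa [ancestor_depth] at h4

end ParentTree

end Graph

namespace Matroid

variable {V E : Type*} {G : Graph V E} {M : Matroid E}

open Graph

lemma bddAbove_of_fan (hM : ∀ C, M.IsCircuit C ↔ G.IsFiniteCycle C ∨ G.IsDoubleRay C)
    {v : ℤ → V} {f : ℤ → E} (hv : Function.Injective v)
    (hl : ∀ i, G.IsLink (f i) (v i) (v (i + 1))) {I : Set ℤ} (Φ : G.Fan v I) : BddAbove I := by
  by_contra hI
  -- N is the position of the centre if it lies on the double ray; only paths ending to the right of
  -- it are kept.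
  obtain ⟨N, hN⟩ : ∃ N, ∀ j, v j = Φ.center → j = N := by
    by_cases h : ∃ j, v j = Φ.center
    · obtain ⟨N, hN⟩ := h
      exact ⟨N, fun j hj ↦ hv (hj.trans hN.symm)⟩
    · push Not at h
      exact ⟨0, fun j hj ↦ absurd hj (h j)⟩
  refine false_of_fan_not_bddAbove hM hv hl (Φ.restrict (J := {i ∈ I | N < i}) fun i hi ↦ hi.1)
    ?_ (fun i hi ↦ hi.2) hN
  rintro ⟨B, hB⟩
  refine hI ⟨max B N, fun i hi ↦ ?_⟩
  by_contra! h
  have := hB ⟨hi, (le_max_right _ _).trans_lt h⟩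
  exact absurd ((le_max_left _ _).trans_lt h) this.not_gt

/-- In the graph of an algebraic cycle matroid there is no infinite fan to a double ray. -/
lemma finite_of_fan (hM : ∀ C, M.IsCircuit C ↔ G.IsFiniteCycle C ∨ G.IsDoubleRay C)
    {v : ℤ → V} {f : ℤ → E} (hv : Function.Injective v)
    (hl : ∀ i, G.IsLink (f i) (v i) (v (i + 1))) {I : Set ℤ} (Φ : G.Fan v I) : I.Finite := by
  obtain ⟨B, hB⟩ := bddAbove_of_fan hM hv hl Φ
  obtain ⟨B', hB'⟩ := bddAbove_of_fan (f := fun i ↦ f (-i - 1)) hM (hv.comp neg_injective)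
    (fun i ↦ by
      have := (hl (-i - 1)).symm
      rw [sub_add_cancel] at this
      simpa only [Function.comp_apply, neg_add'] using this) Φ.reverse
  refine (Set.finite_Icc (-B') B).subset fun i hi ↦ ⟨?_, hB hi⟩
  have := hB' (a := -i) (by simpa using hi)
  omega

/-- A component without rays contains only finitely many vertices of a double ray. -/
lemma finite_preimage_componentIn
    (hM : ∀ C, M.IsCircuit C ↔ G.IsFiniteCycle C ∨ G.IsDoubleRay C) {A : Set E} {u : V}
    (hA : ∀ (g : ℕ → V) (q : ℕ → E), g 0 = u → Function.Injective g →
      ¬ ∀ n, q n ∈ A ∧ G.IsLink (q n) (g n) (g (n + 1)))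
    {v : ℤ → V} {f : ℤ → E} (hv : Function.Injective v)
    (hl : ∀ i, G.IsLink (f i) (v i) (v (i + 1))) : (v ⁻¹' G.componentIn A u).Finite := by
  by_contra hinf
  have : Nonempty E := ⟨f 0⟩
  obtain ⟨T⟩ := nonempty_parentTree G A u
  have h0 : (T.descIndices v 0 u).Infinite := Set.Infinite.mono
    (fun i hi ↦ ⟨hi, Nat.zero_le _, ParentTree.ancestor_zero hi⟩) hinf
  by_cases h : ∀ n z, (T.descIndices v n z).Infinite →
      ∃ z', T.parent z' = z ∧ (T.descIndices v (n + 1) z').Infinite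
  · obtain ⟨g, q, h1, h2, h3⟩ := ParentTree.exists_ray h0 h
    exact hA g q h1 h2 h3
  · push Not at h
    obtain ⟨n, z, hz, hz'⟩ := h
    obtain ⟨I, hI, ⟨Φ⟩⟩ := ParentTree.exists_fan hv hz fun z' h ↦ hz' z' h
    exact hI (finite_of_fan hM hv hl Φ)

end Matroid

/-! ### Signing the algebraic cycle matroid -/

namespace Graph

variable {V E : Type*} {G : Graph V E}

/-- Finiteness of K along the double ray makes both sums of indicators finite, and they differ by a
shift. -/
lemma exists_balanced_of_isDoubleRay {v : ℤ → V} {f : ℤ → E} (hv : Function.Injective v)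
    (hl : ∀ i, G.IsLink (f i) (v i) (v (i + 1))) :
    ∃ c : E → ℤˣ, ∀ K, (v ⁻¹' K).Finite → G.Balanced (Set.range f) c K := by
  classical
  have hf := edge_injective_of_isLink hv hl
  let c : E → ℤˣ := fun p ↦ if h : ∃ i, f i = p then G.traverseSign p (v h.choose) else 1
  have hc : ∀ i, c (f i) = G.traverseSign (f i) (v i) := by
    intro i
    have h : ∃ j, f j = f i := ⟨i, rfl⟩
    simp only [c, dif_pos h]
    rw [hf h.choose_spec]
  refine ⟨c, fun K hK ↦ ⟨?_, ?_⟩⟩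
  · refine ((hK.union (hK.preimage (add_left_injective (1 : ℤ)).injOn)).image f).subset ?_
    rintro _ ⟨⟨i, rfl⟩, hi⟩
    refine ⟨i, ?_, rfl⟩
    rw [(hl i).mem_cut_iff] at hi
    simp only [Set.mem_union, Set.mem_preimage]
    tauto
  · have h1 : (Function.support fun i ↦ K.indicator (fun _ ↦ (1 : ℤ)) (v i)).Finite :=
      hK.subset fun i hi ↦ by
        by_contra h
        exact hi (Set.indicator_of_notMem (s := K) h _)
    have h2 : (Function.support fun i ↦ K.indicator (fun _ ↦ (1 : ℤ)) (v (i + 1))).Finite :=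
      h1.preimage (add_left_injective (1 : ℤ)).injOn
    rw [finsum_mem_range hf]
    simp only [hc, (hl _).traverseSign_mul_cutSign]
    rw [finsum_sub_distrib h1 h2, sub_eq_zero]
    exact (finsum_comp_equiv (Equiv.addRight (1 : ℤ))
      (f := fun i ↦ K.indicator (fun _ ↦ (1 : ℤ)) (v i))).symm

end Graph

namespace Matroid

variable {V E : Type*} {G : Graph V E} {M : Matroid E}

open Graph

/-- Two rays in `bᶜ` from the ends of an edge of a cocircuit `b` would form a double ray that meets
`b` in this edge only. -/
lemma IsCocircuit.not_rays {b : Set E} (hb : M.IsCocircuit b)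
    (hM : ∀ C, M.IsCircuit C ↔ G.IsFiniteCycle C ∨ G.IsDoubleRay C) {e : E} (he : e ∈ b)
    {g g' : ℕ → V} {q q' : ℕ → E} (hl : G.IsLink e (g 0) (g' 0)) (hg : Function.Injective g)
    (hg' : Function.Injective g') (hq : ∀ n, q n ∈ bᶜ ∧ G.IsLink (q n) (g n) (g (n + 1)))
    (hq' : ∀ n, q' n ∈ bᶜ ∧ G.IsLink (q' n) (g' n) (g' (n + 1))) : False := by
  have hj : ∀ n, G.Joined bᶜ (g 0) (g n) := by
    intro n
    induction n with
    | zero => exact Graph.Joined.refl _ _ _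
    | succ n ih => exact ih.trans ((hq n).2.joined (hq n).1)
  have hj' : ∀ n, G.Joined bᶜ (g' 0) (g' n) := by
    intro n
    induction n with
    | zero => exact Graph.Joined.refl _ _ _
    | succ n ih => exact ih.trans ((hq' n).2.joined (hq' n).1)
  have hne : ∀ m n, g m ≠ g' n := fun m n h ↦
    hb.not_joined (fun C hC ↦ (hM C).2 (Or.inl hC)) he hl
      ((hj m).trans (by rw [h]; exact (hj' n).symm))
  -- The nonnegative indices run along g' and the negative ones along g; the edge with index -1 is
  -- e, which joins g 0 to g' 0.
  let v : ℤ → V := fun i ↦ Int.casesOn i g' g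
  let f : ℤ → E := fun i ↦ Int.casesOn i q' fun n ↦ Nat.casesOn n e q
  have hv : Function.Injective v := by
    rintro (m | m) (n | n) h
    · exact congrArg Int.ofNat (hg' h)
    · exact absurd h.symm (hne _ _)
    · exact absurd h (hne _ _)
    · exact congrArg Int.negSucc (hg h)
  have hf : ∀ i, G.IsLink (f i) (v i) (v (i + 1)) := by
    rintro (m | _ | m)
    · exact (hq' m).2
    · exact hl
    · exact (hq m).2.symm
  refine ((hM _).2 (Or.inr ⟨v, f, hv, hf, rfl⟩)).inter_isCocircuit_ne_singleton hb (e := e)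
    (Set.Subset.antisymm ?_ ?_)
  · rintro _ ⟨⟨m | _ | m, rfl⟩, hmb⟩
    · exact absurd hmb (hq' m).1
    · rfl
    · exact absurd hmb (hq m).1
  · rintro _ rfl
    exact ⟨⟨-1, rfl⟩, he⟩

/-- By `IsCocircuit.not_rays` some end of e starts no ray in the complement of b. Its component
there contains only finitely many vertices of each double ray, by `finite_preimage_componentIn`, and
so belongs to the family. -/
theorem IsAlgebraicCycleMatroid.nonempty_signing (h : M.IsAlgebraicCycleMatroid G) :
    Nonempty (Signing M) := by
  refine nonempty_signing_of_balanced G {K | ∀ (v : ℤ → V) (f : ℤ → E), Function.Injective v →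
    (∀ i, G.IsLink (f i) (v i) (v (i + 1))) → (v ⁻¹' K).Finite} (fun b hb ↦ ?_) fun o ho ↦ ?_
  · obtain ⟨e, he⟩ := hb.nonempty
    have heE : e ∈ G.edgeSet := h.1 ▸ hb.subset_ground he
    have key : ∀ u w, G.IsLink e u w →
        (∀ (g : ℕ → V) (q : ℕ → E), g 0 = u → Function.Injective g →
          ¬ ∀ n, q n ∈ bᶜ ∧ G.IsLink (q n) (g n) (g (n + 1))) →
        ∃ K ∈ {K | ∀ (v : ℤ → V) (f : ℤ → E), Function.Injective v →
          (∀ i, G.IsLink (f i) (v i) (v (i + 1))) → (v ⁻¹' K).Finite},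
          (G.cut K).Nonempty ∧ G.cut K ⊆ b := by
      intro u w hl hray
      refine ⟨G.componentIn bᶜ u, fun v f hv hf ↦
        finite_preimage_componentIn h.2 hray hv hf, ⟨e, u, w, hl, Graph.Joined.refl _ _ _,
          hb.not_joined (fun C hC ↦ (h.2 C).2 (Or.inl hC)) he hl⟩, fun f hf ↦ ?_⟩
      by_contra hfb
      exact Set.disjoint_left.1 (G.disjoint_cut_componentIn bᶜ u) hfb hf
    obtain ⟨u, w, hl⟩ := G.exists_isLink_of_mem_edgeSet heE
    by_cases hu : ∀ (g : ℕ → V) (q : ℕ → E), g 0 = u → Function.Injective g →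
        ¬ ∀ n, q n ∈ bᶜ ∧ G.IsLink (q n) (g n) (g (n + 1))
    · exact key u w hl hu
    · refine key w u hl.symm fun g' q' h1 h2 h3 ↦ ?_
      push Not at hu
      obtain ⟨g, q, h4, h5, h6⟩ := hu
      subst h1 h4
      exact hb.not_rays h.2 he hl h5 h2 h6 h3
  · rcases (h.2 o).1 ho with hfin | ⟨v, f, hv, hl, rfl⟩
    · obtain ⟨c, hc⟩ := hfin.exists_balanced
      exact ⟨c, fun K _ ↦ hc K⟩
    · obtain ⟨c, hc⟩ := exists_balanced_of_isDoubleRay hv hl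
      exact ⟨c, fun K hK ↦ hc K (hK v f hv hl)⟩

end Matroid

theorem theorem5p5 {E : Type*} :
    (∀ (M : Matroid E) (P Q : M.Painting (ZMod 3)), P.Equivalent Q) ∧
    (∀ (M : Matroid E) (P Q : M.Signing), Matroid.Signing.Equivalent P Q) ∧
    (∀ {V : Type*} (G : Graph V E) (M : Matroid E),
      (M.IsFiniteCycleMatroid G ∨ M.IsAlgebraicCycleMatroid G ∨ M.IsTopologicalCycleMatroid G) →
      M.HasUniqueSigning ∧ M✶.HasUniqueSigning) := by
  refine ⟨fun M P Q ↦ P.equivalent_zmod_three Q, fun M P Q ↦ Matroid.signing_equivalent P Q,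
    fun G M hM ↦ Matroid.hasUniqueSigning_and_dual ?_⟩
  rcases hM with h | h | h
  · exact h.nonempty_signing
  · exact h.nonempty_signing
  · exact h.nonempty_signing
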